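/- **Setting.** Let $d\ge 1$, write $x[1]$ for the first coordinate of $x\in\mathbb Z^d$ and $\mathbb Z^d_{0+}=\{x\in\mathbb Z^d:x[1]\ge0\}$. Let $S_t=S_0+\xi_1+\dots+\xi_t$, $t\ge 0$, be a random walk on $\mathbb Z^d$ and let $H(x)\in\{0,1,2,\dots\}\cup\{\infty\}$, $x\in\mathbb Z^d$, be a random environment ($H(x)$ is the number of allowed visits to $x$). Put $L_t(x)=\#\{0\le j\le t:S_j=x\}$, $T_*=\inf\{t\ge0:L_t(S_t)>H(S_t)\}$ and $\alpha(n)=\inf\{t\ge 0:S_t[1]\ge n\}$ ($\inf\emptyset=\infty$). Let $\mathbf P_*=\mathbf P$ be the law of the model, and let $\mathbf P_0$ denote probabilities when $S_0$ is replaced by $0$ and $H(x)$ by $0$ for every $x\notin\mathbb Z^d_{0+}$, while $(\xi_t)$ and $(H(x))_{x\in\mathbb Z^d_{0+}}$ are unchanged. **Assumptions.** (A1) $\xi_1,\xi_2,\dots$ are i.i.d. in $\mathbb Z^d$, $\mathbf P(\xi_1[1]\le 1)=1$ and $\mathbf P(\xi_1[1]=1)>0$. (A2) The families $\{S_0;H(x),x\notin\mathbb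 Z^d_{0+}\}$, $\{\xi_i,i\ge1\}$, $\{H(x),x\in\mathbb Z^d_{0+}\}$ are mutually independent, $S_0[1]\le 0$ a.s., and $\mathbf P_*(\alpha(0)<T_*)>0$. (A3) The variables $H(x)$, $x\in\mathbb Z^d_{0+}$, are i.i.d. and $H(0)\ge1$ a.s. (A4) With $\beta_0=\inf\{t>0:(\xi_1+\dots+\xi_t)[1]=0\}$ and $\beta_{0,0}=\inf\{t>0:\xi_1+\dots+\xi_t=0\}$: if $\mathbf P(\beta_0<\infty)=1$, then $\mathbf P(\beta_{0,0}<\infty)>0$ and $\mathbf P(H(0)<\infty)>0$; and if $\mathbf P(\beta_0=\beta_{0,0}<\infty)=1$, then $\mathbf E H(0)<\infty$. **Separating levels and blocks.** For a path $y$ with hitting times $\alpha(k|y)=\inf\{t\ge0:y_t[1]\ge k\}$, a level $k\in\{0,\dots,n\}$ is $n$-separating if $\alpha(n|y)<\infty$ and $\sup_{t<\alpha(k|y)}y_t[1]<k=y_{\alpha(k|y)}[1]\le\inf_{\alpha(k|y)<t<\alpha(n|y)}y_t[1]$. If $\alpha(n)<T_*$, let $\eta_*(n)+1$ be the number of $n$-separating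 levels of $(S_t)$; otherwise $\eta_*(n)=-1$. If $\eta_*(n)\ge1$, let $\varkappa_*(n)$ be the largest $n$-separating level of $(S_t)$ that is smaller than $n$; otherwise $\varkappa_*(n)=-\infty$. When $\eta_*(n)\ge0$ let $\nu_0(n)<\dots<\nu_{\eta_*(n)}(n)=n$ be the $n$-separating levels, $T_i(n)=\alpha(\nu_i(n))$, and for $i\ge1$ let $\lambda_i(n)=\nu_i(n)-\nu_{i-1}(n)$ (height) and $\tau_i(n)=T_i(n)-T_{i-1}(n)$ (duration). **Statement.** Assume (A1)–(A4). There is $q\in(0,1]$ with $$\sum_{k\ge1}\frac{\mathbf P_0(\varkappa_*(k)=0)}{q^k}=1,\qquad 1\le\sum_{k\ge1}k\,\frac{\mathbf P_0(\varkappa_*(k)=0)}{q^k}<\infty,\qquad 0<\psi_0:=\sum_{k\ge0}\frac{\mathbf P_*(\eta_*(k)=0)}{q^k}<\infty,$$ for which the following holds. There exists a core process, i.e. a random sequence $(\overline S_t)_{t\ge0}$ in $\mathbb Z^d$ with random variables $\overline\nu_0,\overline T_0,\overline\lambda_i,\overline\tau_i$ ($i\ge1$) with values in $\{0,1,2,\dots\}$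 such that, with $\overline T_i=\overline T_0+\overline\tau_1+\dots+\overline\tau_i$, the blocks $$(\overline\nu_0,\overline T_0,(\overline S_0,\dots,\overline S_{\overline T_0})),\qquad (\overline\lambda_i,\overline\tau_i,(\overline S_{\overline T_{i-1}+t}-\overline S_{\overline T_{i-1}})_{1\le t\le\overline\tau_i}),\quad i\ge1,$$ are mutually independent, with distributions given by $$\mathbf P(\overline\nu_0=k)=\frac{\mathbf P_*(\eta_*(k)=0)}{\psi_0q^k},\qquad \mathbf P(\overline\lambda_i=l)=\frac{\mathbf P_0(\varkappa_*(l)=0)}{q^l}\quad(k\ge0,\ l\ge1),$$ $$\mathbf P\big(\overline T_0=K,(\overline S_t)_{t\le K}=\vec y\,\big|\,\overline\nu_0=k\big)=\mathbf P_*\big(\alpha(k)=K<T_*,(S_t)_{t\le K}=\vec y\,\big|\,\eta_*(k)=0\big),$$ $$\mathbf P\big(\overline\tau_i=L,(\overline S_{\overline T_{i-1}+t}-\overline S_{\overline T_{i-1}})_{1\le t\le L}=\vec x\,\big|\,\overline\lambda_i=l\big)=\mathbf P_0\big(\alpha(l)=L<T_*,(S_t-S_0)_{1\le t\le L}=\vec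 x\,\big|\,\varkappa_*(l)=0\big)$$ (conditional laws being prescribed when the conditioning events have positive probability). Moreover, for every such core process, all $n\ge m\ge1$, all integers $0\le L_0<\dots<L_m=n$ and $0\le K_0<\dots<K_m$ with $1\le l_i:=L_i-L_{i-1}\le k_i:=K_i-K_{i-1}$, and all $\vec y\in\mathbb Z^{(K_0+1)\times d}$, $\vec x_i\in\mathbb Z^{k_i\times d}$ ($1\le i\le m$), $$\mathbf P_*\Big(\eta_*(n)=m,\ \nu_0(n)=L_0,\ \alpha(\nu_0(n))=K_0,\ (S_t)_{0\le t\le K_0}=\vec y,\ \bigcap_{i=1}^m\big\{\lambda_i(n)=l_i,\ \tau_i(n)=k_i,\ (S_{K_{i-1}+t}-S_{K_{i-1}})_{1\le t\le k_i}=\vec x_i\big\}\Big)$$ $$=\psi_0q^n\,\mathbf P\big(\overline\nu_0=L_0,\ \overline\alpha(\overline\nu_0)=K_0,\ (\overline S_t)_{0\le t\le K_0}=\vec y\big)\prod_{i=1}^m\mathbf P\big(\overline\lambda_i=l_i,\ \overline\tau_i=k_i,\ (\overline S_{\overline T_{i-1}+t}-\overline S_{\overline T_{i-1}})_{1\le t\le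 k_i}=\vec x_i\big),$$ where $\overline\alpha(k)=\inf\{t\ge0:\overline S_t[1]\ge k\}$. -/

import Mathlib

open MeasureTheory ProbabilityTheory
open scoped ENNReal

noncomputable section

/-! ### Deterministic functionals of a path and of an environment -/

/-- The lattice `ℤ^d`. The height of `x` is its first coordinate `x 0`. -/
abbrev Site (d : ℕ) : Type := Fin d → ℤ

namespace SitePath

variable {d : ℕ}

/-- `hit n y` is the first time at which the height of the path `y` is at least `n`
(`⊤` if there is no such time). -/
def hit [NeZero d] (n : ℕ) (y : ℕ → Site d) : ℕ∞ :=
  sInf ((fun t : ℕ => (t : ℕ∞)) '' {t : ℕ | (n : ℤ) ≤ y t 0})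

/-- The local time: the number of visits of the path `y` to `x` at times `0, …, t`. -/
def visits (y : ℕ → Site d) (t : ℕ) (x : Site d) : ℕ :=
  ((Finset.range (t + 1)).filter fun j => y j = x).card

/-- The death time: the first time at which the number of visits to the current state
exceeds its upper limit in the environment `h` (`⊤` if there is no such time). -/
def death (y : ℕ → Site d) (h : Site d → ℕ∞) : ℕ∞ :=
  sInf ((fun t : ℕ => (t : ℕ∞)) '' {t : ℕ | h (y t) < (visits y t (y t) : ℕ∞)})

/-- `k` is an `n`-separating level of the path `y`. -/
def IsSep [NeZero d] (n : ℕ) (y : ℕ → Site d) (k : ℕ) : Prop :=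
  k ≤ n ∧ hit n y < ⊤ ∧
    (∀ t : ℕ, (t : ℕ∞) < hit k y → y t 0 < (k : ℤ)) ∧
    y (hit k y).toNat 0 = (k : ℤ) ∧
    ∀ t : ℕ, hit k y < (t : ℕ∞) → (t : ℕ∞) < hit n y → (k : ℤ) ≤ y t 0

open Classical in
/-- `eta n y + 1` is the number of `n`-separating levels of `y`. -/
def eta [NeZero d] (n : ℕ) (y : ℕ → Site d) : ℤ :=
  (((Finset.range (n + 1)).filter fun k => IsSep n y k).card : ℤ) - 1

open Classical in
/-- The largest `n`-separating level `k < n` of `y`, and `⊥` (that is, `-∞`) if there is none. -/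
def kappa [NeZero d] (n : ℕ) (y : ℕ → Site d) : WithBot ℕ :=
  ((Finset.range n).filter fun k => IsSep n y k).max

open Classical in
/-- `eta`, restricted to the event that the level `n` is hit before death. -/
def etaStar [NeZero d] (n : ℕ) (y : ℕ → Site d) (h : Site d → ℕ∞) : ℤ :=
  if hit n y < death y h then eta n y else -1

open Classical in
/-- `kappa`, restricted to the event that `1 ≤ etaStar`. -/
def kappaStar [NeZero d] (n : ℕ) (y : ℕ → Site d) (h : Site d → ℕ∞) : WithBot ℕ :=
  if 1 ≤ etaStar n y h then kappa n y else ⊥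

/-- `nu n y i` is the `i`-th (`i = 0, 1, …`) `n`-separating level of `y` in increasing order. -/
def nu [NeZero d] (n : ℕ) (y : ℕ → Site d) (i : ℕ) : ℕ :=
  Nat.nth (IsSep n y) i

/-- The hitting time of the `i`-th `n`-separating level. -/
def sepTime [NeZero d] (n : ℕ) (y : ℕ → Site d) (i : ℕ) : ℕ :=
  (hit (nu n y i) y).toNat

/-- The height of the block between the `n`-separating levels number `i` and `i + 1`. -/
def blockHeight [NeZero d] (n : ℕ) (y : ℕ → Site d) (i : ℕ) : ℕ :=
  nu n y (i + 1) - nu n y i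

/-- The duration of the block between the `n`-separating levels number `i` and `i + 1`. -/
def blockDuration [NeZero d] (n : ℕ) (y : ℕ → Site d) (i : ℕ) : ℕ :=
  sepTime n y (i + 1) - sepTime n y i

end SitePath

open SitePath

/-! ### The random walk with random constraints on its local times -/

/-- The random data: the initial state `S₀`, the increments (`ξ j` is the increment between the
times `j` and `j + 1`) and the environment `H`, where `H x` is the number of allowed visits
to `x`. -/
structure ConstrainedWalk (d : ℕ) (Ω : Type*) where
  S₀ : Ω → Site d
  ξ : ℕ → Ω → Site d
  H : Site d → Ω → ℕ∞

namespace ConstrainedWalk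

variable {d : ℕ} {Ω : Type*}

/-- The path of the walk, `S_t = S_0 + ξ_1 + ⋯ + ξ_t`. -/
def path (W : ConstrainedWalk d Ω) (ω : Ω) (t : ℕ) : Site d :=
  W.S₀ ω + ∑ j ∈ Finset.range t, W.ξ j ω

/-- The environment as a function of the site. -/
def env (W : ConstrainedWalk d Ω) (ω : Ω) (x : Site d) : ℕ∞ := W.H x ω

/-- The same increments and the same environment on the half-space of nonnegative heights, but
with the initial state `0` and no visits allowed outside that half-space. Its law is the
law denoted by `P_0`. -/
def zeroEnv [NeZero d] (W : ConstrainedWalk d Ω) : ConstrainedWalk d Ω where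
  S₀ := fun _ => 0
  ξ := W.ξ
  H := fun x ω => if 0 ≤ x 0 then W.H x ω else 0

/-- The first return time to height `0` of the walk `ξ_1 + ⋯ + ξ_t`. -/
def returnLevel [NeZero d] (W : ConstrainedWalk d Ω) (ω : Ω) : ℕ∞ :=
  sInf ((fun t : ℕ => (t : ℕ∞)) '' {t : ℕ | 0 < t ∧ (∑ j ∈ Finset.range t, W.ξ j ω) 0 = 0})

/-- The first return time to the origin of the walk `ξ_1 + ⋯ + ξ_t`. -/
def returnOrigin (W : ConstrainedWalk d Ω) (ω : Ω) : ℕ∞ :=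
  sInf ((fun t : ℕ => (t : ℕ∞)) '' {t : ℕ | 0 < t ∧ ∑ j ∈ Finset.range t, W.ξ j ω = 0})

variable [MeasurableSpace Ω]

/-- The increments are i.i.d. and their first component is skip-free upwards. -/
structure A1 [NeZero d] (W : ConstrainedWalk d Ω) (P : Measure Ω) : Prop where
  meas : ∀ j, Measurable (W.ξ j)
  indep : iIndepFun W.ξ P
  ident : ∀ j, IdentDistrib (W.ξ j) (W.ξ 0) P P
  skip_free : ∀ᵐ ω ∂P, W.ξ 0 ω 0 ≤ 1
  up : 0 < P {ω | W.ξ 0 ω 0 = 1}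

/-- The pair (initial state, environment outside the half-space of nonnegative heights), the
increments, and the environment in that half-space are mutually independent; the walk starts at
a nonpositive height and hits the height `0` before death with positive probability. -/
structure A2 [NeZero d] (W : ConstrainedWalk d Ω) (P : Measure Ω) : Prop where
  meas_init : Measurable W.S₀
  meas_env : ∀ x, Measurable (W.H x)
  indep : iIndep
    ![MeasurableSpace.comap W.S₀ inferInstance ⊔
        ⨆ x : {x : Site d // ¬ 0 ≤ x 0}, MeasurableSpace.comap (W.H x) inferInstance,
      ⨆ j, MeasurableSpace.comap (W.ξ j) inferInstance,
      ⨆ x : {x : Site d // 0 ≤ x 0}, MeasurableSpace.comap (W.H x) inferInstance] P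
  start : ∀ᵐ ω ∂P, W.S₀ ω 0 ≤ 0
  reach : 0 < P {ω | hit 0 (W.path ω) < death (W.path ω) (W.env ω)}

/-- The environment in the half-space of nonnegative heights is i.i.d. and at least `1`. -/
structure A3 [NeZero d] (W : ConstrainedWalk d Ω) (P : Measure Ω) : Prop where
  indep : iIndepFun (fun x : {x : Site d // 0 ≤ x 0} => W.H x) P
  ident : ∀ x : Site d, 0 ≤ x 0 → IdentDistrib (W.H x) (W.H 0) P P
  one_le : ∀ᵐ ω ∂P, 1 ≤ W.H 0 ω

/-- The technical assumption for a walk whose first component is recurrent. -/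
structure A4 [NeZero d] (W : ConstrainedWalk d Ω) (P : Measure Ω) : Prop where
  returns : P {ω | W.returnLevel ω < ⊤} = 1 → 0 < P {ω | W.returnOrigin ω < ⊤}
  finite_mean : P {ω | W.returnLevel ω = W.returnOrigin ω ∧ W.returnOrigin ω < ⊤} = 1 →
    ∫⁻ ω, (W.H 0 ω : ℝ≥0∞) ∂P < ⊤

/-- `P_*(η_*(n) = 0)`. -/
def probEtaZero [NeZero d] (W : ConstrainedWalk d Ω) (P : Measure Ω) (n : ℕ) : ℝ :=
  P.real {ω | etaStar n (W.path ω) (W.env ω) = 0}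

/-- `P_0(ϰ_*(n) = 0)`. -/
def probKappaZero [NeZero d] (W : ConstrainedWalk d Ω) (P : Measure Ω) (n : ℕ) : ℝ :=
  P.real {ω | kappaStar n (W.zeroEnv.path ω) (W.zeroEnv.env ω) = ((0 : ℕ) : WithBot ℕ)}

end ConstrainedWalk

/-! ### The core process -/

/-- The random elements of a core process: the initial level `ν₀` and the initial time `T₀`, the
heights `lam i` and the durations `tau i` of the successive blocks (the block with index `i` here
is the block number `i + 1`), and the process `S`. -/
structure CoreData (d : ℕ) (Ω' : Type*) where
  ν₀ : Ω' → ℕ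
  T₀ : Ω' → ℕ
  lam : ℕ → Ω' → ℕ
  tau : ℕ → Ω' → ℕ
  S : Ω' → ℕ → Site d

namespace CoreData

variable {d : ℕ} {Ω' : Type*}

/-- The time `T_i = T_0 + τ_1 + ⋯ + τ_i` at which the block number `i` ends. -/
def T (C : CoreData d Ω') (i : ℕ) (ω : Ω') : ℕ :=
  C.T₀ ω + ∑ j ∈ Finset.range i, C.tau j ω

/-- The increment vector of the block with index `i`, at the position `t`. -/
def incr (C : CoreData d Ω') (i : ℕ) (ω : Ω') (t : ℕ) : Site d :=
  C.S ω (C.T i ω + t + 1) - C.S ω (C.T i ω)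

/-- The sequence of random blocks: the initial block `(ν₀, T₀, (S_0, …, S_{T₀}))`, followed by
the blocks (height, duration, increments). -/
def block (C : CoreData d Ω') : ℕ → Ω' → ℕ × ℕ × List (Site d)
  | 0, ω => (C.ν₀ ω, C.T₀ ω, List.ofFn fun t : Fin (C.T₀ ω + 1) => C.S ω t)
  | i + 1, ω => (C.lam i ω, C.tau i ω, List.ofFn fun t : Fin (C.tau i ω) => C.incr i ω t)

/-- `C`, defined on the probability space `(Ω', Q)`, is a core process of the walk `W` under `P`
for the numbers `q` and `ψ₀`: the blocks are mutually independent, and their distributions are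
the prescribed ones (`P_*` and `P_0` being the laws of `W` and of `W.zeroEnv` under `P`). -/
structure IsCore [NeZero d] [MeasurableSpace Ω'] {Ω : Type*} [MeasurableSpace Ω]
    (C : CoreData d Ω') (Q : Measure Ω')
    (W : ConstrainedWalk d Ω) (P : Measure Ω) (q ψ₀ : ℝ) : Prop where
  meas_nu : Measurable C.ν₀
  meas_T : Measurable C.T₀
  meas_lam : ∀ i, Measurable (C.lam i)
  meas_tau : ∀ i, Measurable (C.tau i)
  meas_S : ∀ t, Measurable fun ω => C.S ω t
  /-- mutual independence of the blocks (a block takes values in a countable discrete space) -/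
  indep : iIndepFun (m := fun _ => ⊤) C.block Q
  /-- the distribution of the initial level -/
  law_nu : ∀ k : ℕ, Q.real {ω | C.ν₀ ω = k} = W.probEtaZero P k / (ψ₀ * q ^ k)
  /-- the conditional distribution of the rest of the initial block, given the initial level -/
  law_init : ∀ (k K : ℕ) (y : Fin (K + 1) → Site d),
    cond Q {ω | C.ν₀ ω = k} {ω | C.T₀ ω = K ∧ ∀ t : Fin (K + 1), C.S ω t = y t} =
      cond P {ω | etaStar k (W.path ω) (W.env ω) = 0}
        {ω | hit k (W.path ω) = (K : ℕ∞) ∧ (K : ℕ∞) < death (W.path ω) (W.env ω) ∧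
          ∀ t : Fin (K + 1), W.path ω t = y t}
  /-- the distribution of the height of a block -/
  law_lam : ∀ i l : ℕ, 1 ≤ l → Q.real {ω | C.lam i ω = l} = W.probKappaZero P l / q ^ l
  /-- the conditional distribution of the rest of a block, given its height -/
  law_block : ∀ (i l k : ℕ) (x : Fin k → Site d), 1 ≤ l →
    cond Q {ω | C.lam i ω = l} {ω | C.tau i ω = k ∧ ∀ t : Fin k, C.incr i ω t = x t} =
      cond P {ω | kappaStar l (W.zeroEnv.path ω) (W.zeroEnv.env ω) = ((0 : ℕ) : WithBot ℕ)}
        {ω | hit l (W.zeroEnv.path ω) = (k : ℕ∞) ∧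
          (k : ℕ∞) < death (W.zeroEnv.path ω) (W.zeroEnv.env ω) ∧
          ∀ t : Fin k, W.zeroEnv.path ω (t + 1) - W.zeroEnv.path ω 0 = x t}

end CoreData

end

/-! At the first visit of a separating level only strictly lower sites have been used, apart from
the site just reached, where one visit is always allowed. Afterwards, until height `n` is reached,
the path uses only sites on or above that level. Since the environment there is i.i.d. and
independent of the increments, the rest of the path behaves like a fresh walk under P_0
(`pathWeight_append`, `measure_pathEvent_shift`). Cutting at all separating levels therefore turns
the probability of prescribed blocks into a product of one initial factor and one factor per block
(`measure_blockChain`). Dividing each factor by `q` to the power of its height makes block laws out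
of them, and the powers telescope to `q ^ n`.

It remains to find the `q` for which these laws have total mass one. Let a_n be the P_0-probability
of reaching `n` before death and u_k = P_0(ϰ_*(k) = 0). Cutting at the last separating level below
the target gives the renewal equation a_{n+1} = ∑ u_{k+1} a_{n-k} (`probReach_succ`), and requiring
`m` to be separating gives a_m a_n ≤ a_{m+n}. The essential estimate is the converse a_{m+n} ≤ M a_m
a_n (`probReach_add_le`): cut at the first and at the last visit of level `m`. The middle piece
contributes at most M = `levelSojourn`, the expected number of visits of a level when only the
limits on that level are enforced. Fekete's lemma then yields `q` with q^n / M ≤ a_n ≤ q^n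
(`exists_geometric_bounds`), and a renewal sequence bounded away from zero has a proper step law
with finite mean (`hasSum_of_renewal`). The same constant bounds ψ_0.

The finiteness of M (`levelSojourn_ne_top`) carries the technical assumptions. The positions at the
successive visits of a level form a random walk whose steps are displacements of excursions. If the
level is left for good with positive probability, M is bounded by a geometric series. If every
excursion almost surely returns to its starting point, M is at most the mean of H(0). Otherwise the
walk of excursions is nondegenerate and can return to its start. Suppose r sites have been visited
more than h times. By a Littlewood–Offord estimate (`stepOp_pow_indicator_le`) the walk is off these
sites after order (r+1)² steps with probability at least 1/2, and with a fixed probability it then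
runs through a loop h+1 times, which adds a site to the list. Each listed site costs a factor γ < 1,
and ∑ (r+1)² γ^r is finite (`lifetime_bounded_of_returning`).

A core process is obtained by gluing the coordinates of an infinite product of the block laws
(`isCore_ofBlocks`). -/

noncomputable section

open SitePath

set_option linter.unusedSectionVars false

/-! ### Almost multiplicative sequences and the renewal equation -/

section Renewal

/-- A supermultiplicative sequence in `(0, 1]` which is submultiplicative up to a constant grows
like a geometric sequence, up to a constant. -/
theorem exists_geometric_bounds {a : ℕ → ℝ} {M : ℝ} (hpos : ∀ n, 0 < a n) (hle : ∀ n, a n ≤ 1)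
    (hsup : ∀ m n, a m * a n ≤ a (m + n)) (hsub : ∀ m n, a (m + n) ≤ M * a m * a n) :
    ∃ q : ℝ, 0 < q ∧ q ≤ 1 ∧ (∀ n, 1 ≤ n → a n ≤ q ^ n) ∧ ∀ n, 1 ≤ n → q ^ n ≤ M * a n := by
  have hM : 0 < M := by
    have h1 := hsub 0 0
    have h2 := hpos 0
    by_contra h
    push Not at h
    nlinarith [mul_pos h2 h2, hpos (0 + 0)]
  -- Both `-log a` and `log M + log a` are subadditive. Since `log M / n` tends to zero, their
  -- Fekete limits are opposite numbers, and each limit bounds its quotients from below: this gives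
  -- the two inequalities for the same `q`.
  have hu : Subadditive fun n => -Real.log (a n) := fun m n => by
    have := Real.log_le_log (mul_pos (hpos m) (hpos n)) (hsup m n)
    rw [Real.log_mul (hpos m).ne' (hpos n).ne'] at this
    linarith
  have hv : Subadditive fun n => Real.log M + Real.log (a n) := fun m n => by
    have := Real.log_le_log (hpos _) (hsub m n)
    rw [Real.log_mul (mul_pos hM (hpos m)).ne' (hpos n).ne', Real.log_mul hM.ne' (hpos m).ne']
      at this
    linarith
  have hlog : ∀ n, Real.log (a n) ≤ 0 := fun n => Real.log_nonpos (hpos n).le (hle n)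
  have hub : BddBelow (Set.range fun n : ℕ => -Real.log (a n) / n) :=
    ⟨0, by rintro _ ⟨n, rfl⟩; exact div_nonneg (by linarith [hlog n]) n.cast_nonneg⟩
  -- A geometric lower bound for `a`, needed only to see that the second Fekete quotient is bounded
  -- below.
  have hpow : ∀ n : ℕ, a 1 ^ n * a 0 ≤ a n := fun n => by
    induction n with
    | zero => simp
    | succ n ih =>
      calc a 1 ^ (n + 1) * a 0 = (a 1 ^ n * a 0) * a 1 := by ring
        _ ≤ a n * a 1 := by gcongr; exact (hpos 1).le
        _ ≤ a (n + 1) := hsup _ _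
  have hvb : BddBelow (Set.range fun n : ℕ => (Real.log M + Real.log (a n)) / n) := by
    refine ⟨Real.log (a 1) + (-|Real.log M| + Real.log (a 0)), ?_⟩
    rintro _ ⟨n, rfl⟩
    have h0 := hlog 0
    have h1 := hlog 1
    have h2 := abs_nonneg (Real.log M)
    rcases Nat.eq_zero_or_pos n with rfl | hn
    · simp only [Nat.cast_zero, div_zero]; linarith
    · have h3 := Real.log_le_log (mul_pos (pow_pos (hpos 1) n) (hpos 0)) (hpow n)
      rw [Real.log_mul (pow_pos (hpos 1) n).ne' (hpos 0).ne', Real.log_pow] at h3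
      have hn' : (1 : ℝ) ≤ n := by exact_mod_cast hn
      rw [le_div_iff₀ (by linarith)]
      have h4 := neg_abs_le (Real.log M)
      nlinarith
  have hlu := hu.tendsto_lim hub
  have hlv := hv.tendsto_lim hvb
  have hlim : hv.lim = -hu.lim := by
    refine tendsto_nhds_unique hlv ?_
    have h1 : Filter.Tendsto (fun n : ℕ => Real.log M / (n : ℝ)) Filter.atTop (nhds 0) :=
      tendsto_const_div_atTop_nhds_zero_nat _
    have := h1.sub hlu
    rw [zero_sub] at this
    refine this.congr fun n => ?_
    ring
  have hl0 : 0 ≤ hu.lim :=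
    ge_of_tendsto' hlu fun n => div_nonneg (by linarith [hlog n]) n.cast_nonneg
  refine ⟨Real.exp (-hu.lim), Real.exp_pos _, Real.exp_le_one_iff.2 (by linarith), ?_, ?_⟩
  · intro n hn
    have h := hu.lim_le_div hub (by omega : n ≠ 0)
    rw [le_div_iff₀ (by exact_mod_cast hn)] at h
    rw [← Real.exp_nat_mul, ← Real.log_le_iff_le_exp (hpos n)]
    linarith
  · intro n hn
    have h := hv.lim_le_div hvb (by omega : n ≠ 0)
    rw [hlim, le_div_iff₀ (by exact_mod_cast hn), ← Real.log_mul hM.ne' (hpos n).ne'] at h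
    rw [← Real.exp_nat_mul, ← Real.le_log_iff_exp_le (mul_pos hM (hpos n))]
    linarith

/-- A renewal sequence that is bounded away from zero comes from a proper distribution with a
finite mean. -/
theorem hasSum_of_renewal {r f : ℕ → ℝ} {M : ℝ} (hr0 : r 0 = 1) (hM : ∀ n, 1 ≤ M * r n)
    (hM0 : 0 < M) (hf : ∀ n, 0 ≤ f n)
    (hren : ∀ n, r (n + 1) = ∑ k ∈ Finset.range (n + 1), f k * r (n - k))
    (hr1 : ∀ n, r n ≤ 1) :
    HasSum f 1 ∧ ∃ μ, HasSum (fun k : ℕ => ((k + 1 : ℕ) : ℝ) * f k) μ ∧ 1 ≤ μ := by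
  have hr : ∀ n, 0 < r n := fun n => by
    by_contra h
    push Not at h
    nlinarith [hM n]
  set s : ℕ → ℝ := fun n => ∑ k ∈ Finset.range n, f k with hs
  -- Decomposition at the last renewal not after `n`: `f k` is the weight of a step of size `k + 1`,
  -- so `1 - s k` is the weight of the steps larger than `k`.
  have hkey : ∀ n, ∑ k ∈ Finset.range (n + 1), (1 - s k) * r (n - k) = 1 := fun n => by
    induction n with
    | zero => simp [hs, hr0]
    | succ n ih =>
      rw [Finset.sum_range_succ']
      have h1 : ∀ k ∈ Finset.range (n + 1), (1 - s (k + 1)) * r (n + 1 - (k + 1)) =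
          (1 - s k) * r (n - k) - f k * r (n - k) := fun k _ => by
        simp only [hs, Finset.sum_range_succ, Nat.add_sub_add_right]
        ring
      rw [Finset.sum_congr rfl h1, Finset.sum_sub_distrib, ih, ← hren]
      simp [hs]
  -- If a partial sum exceeded one by `δ`, every later term of `hkey` would be at most `-δ / M`
  -- while the earlier ones are at most one each; the sum would become arbitrarily negative instead
  -- of being one.
  have hs1 : ∀ n, s n ≤ 1 := fun n => by
    rcases n with _ | n
    · simp [hs]
    · by_contra hcon
      push Not at hcon
      set δ := s (n + 1) - 1 with hδ
      have hδ0 : 0 < δ := by linarith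
      have hmono : Monotone s := fun i j hij =>
        Finset.sum_le_sum_of_subset_of_nonneg (Finset.range_mono hij) fun k _ _ => hf k
      have hlow : ∀ N, ∑ k ∈ Finset.range (n + 1 + N + 1), (1 - s k) * r (n + 1 + N - k) ≤
          (n + 1 : ℝ) - (N + 1) * (δ / M) := fun N => by
        rw [show n + 1 + N + 1 = (n + 1) + (N + 1) by ring, Finset.sum_range_add]
        have e1 : ∑ k ∈ Finset.range (n + 1), (1 - s k) * r (n + 1 + N - k) ≤ (n + 1 : ℝ) := by
          calc _ ≤ ∑ k ∈ Finset.range (n + 1), (1 : ℝ) := Finset.sum_le_sum fun k _ => by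
                have : 0 ≤ s k := Finset.sum_nonneg fun k _ => hf k
                nlinarith [hr (n + 1 + N - k), hr1 (n + 1 + N - k)]
            _ = _ := by simp
        have e2 : ∑ k ∈ Finset.range (N + 1),
            (1 - s (n + 1 + k)) * r (n + 1 + N - (n + 1 + k)) ≤ -((N + 1 : ℝ) * (δ / M)) := by
          calc _ ≤ ∑ k ∈ Finset.range (N + 1), (-(δ / M)) := Finset.sum_le_sum fun k _ => by
                have h5 : s (n + 1) ≤ s (n + 1 + k) := hmono (by omega)
                have h6 := hM (n + 1 + N - (n + 1 + k))
                rw [← div_le_iff₀' hM0] at h6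
                have h7 : δ * (1 / M) ≤ (s (n + 1 + k) - 1) * r (n + 1 + N - (n + 1 + k)) := by
                  apply mul_le_mul _ h6 (by positivity) (by linarith)
                  linarith
                rw [mul_one_div] at h7
                linarith
            _ = _ := by simp
        linarith
      obtain ⟨N, hN⟩ := exists_nat_gt ((n + 1 : ℝ) / (δ / M))
      have h8 : 0 < δ / M := by positivity
      rw [div_lt_iff₀ h8] at hN
      have h9 := hlow N
      rw [hkey] at h9
      linarith
  -- Since `1 ≤ M * r`, the identity `hkey` bounds the sum of the tails by `M`. Hence the tails
  -- vanish in the limit, and summation by parts (`hpart`) bounds the mean.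
  have htail : ∀ n, ∑ k ∈ Finset.range n, (1 - s k) ≤ M := fun n => by
    rcases n with _ | n
    · simpa using hM0.le
    · have h3 : ∑ k ∈ Finset.range (n + 1), (1 - s k) ≤
          ∑ k ∈ Finset.range (n + 1), M * ((1 - s k) * r (n - k)) :=
        Finset.sum_le_sum fun k _ => by nlinarith [hM (n - k), hs1 k]
      rwa [← Finset.mul_sum, hkey, mul_one] at h3
  have hts : Summable fun k => 1 - s k :=
    summable_of_sum_range_le (fun k => by linarith [hs1 k]) htail
  have hsum1 : HasSum f 1 := by
    rw [hasSum_iff_tendsto_nat_of_nonneg hf]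
    have := (tendsto_const_nhds (x := (1 : ℝ))).sub hts.tendsto_atTop_zero
    simpa using this
  refine ⟨hsum1, ?_⟩
  have hpart : ∀ n : ℕ, ∑ k ∈ Finset.range n, ((k + 1 : ℕ) : ℝ) * f k =
      ∑ k ∈ Finset.range n, (1 - s k) - n * (1 - s n) := fun n => by
    induction n with
    | zero => simp
    | succ n ih =>
      rw [Finset.sum_range_succ, ih, Finset.sum_range_succ]
      simp only [hs, Finset.sum_range_succ]
      push_cast
      ring
  have hms : Summable fun k : ℕ => ((k + 1 : ℕ) : ℝ) * f k := by
    refine summable_of_sum_range_le (c := M) (fun k => mul_nonneg (by positivity) (hf k))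
      fun n => ?_
    rw [hpart]
    have : 0 ≤ (n : ℝ) * (1 - s n) := mul_nonneg (by positivity) (by linarith [hs1 n])
    linarith [htail n]
  refine ⟨_, hms.hasSum, ?_⟩
  refine hasSum_le (fun k => ?_) hsum1 hms.hasSum
  have : (1 : ℝ) ≤ ((k + 1 : ℕ) : ℝ) := by exact_mod_cast Nat.le_add_left 1 k
  nlinarith [hf k]

/-- Both renewal statements for an almost multiplicative sequence `a` with the renewal
equation `a = u * a` and a delayed sequence `e * a`. -/
theorem exists_renewal_rate {a u e : ℕ → ℝ} {M : ℝ} (ha0 : a 0 = 1) (hpos : ∀ n, 0 < a n)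
    (hle : ∀ n, a n ≤ 1) (hsup : ∀ m n, a m * a n ≤ a (m + n))
    (hsub : ∀ m n, a (m + n) ≤ M * a m * a n) (hu : ∀ n, 0 ≤ u n)
    (hren : ∀ n, a (n + 1) = ∑ k ∈ Finset.range (n + 1), u (k + 1) * a (n - k))
    (he : ∀ n, 0 ≤ e n) (he0 : 0 < e 0)
    (hdel : ∀ n, ∑ k ∈ Finset.range (n + 1), e k * a (n - k) ≤ M * a n) :
    ∃ q μ ψ : ℝ, (0 < q ∧ q ≤ 1) ∧ HasSum (fun k : ℕ => u (k + 1) / q ^ (k + 1)) 1 ∧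
      (HasSum (fun k : ℕ => ((k + 1 : ℕ) : ℝ) * (u (k + 1) / q ^ (k + 1))) μ ∧ 1 ≤ μ) ∧
      (HasSum (fun k : ℕ => e k / q ^ k) ψ ∧ 0 < ψ) := by
  obtain ⟨q, hq0, hq1, h1, h2⟩ := exists_geometric_bounds hpos hle hsup hsub
  -- The geometric bounds start at index one; at index zero they follow from `a 0 = 1` and `1 ≤ M`.
  have hM1 : 1 ≤ M := by have := hsub 0 0; simp only [ha0, add_zero] at this; linarith
  have hr1 : ∀ n, a n / q ^ n ≤ 1 := fun n => by
    rw [div_le_one (by positivity)]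
    rcases n with _ | n
    · simp [ha0]
    · exact h1 _ (by omega)
  have hr2 : ∀ n, 1 ≤ M * (a n / q ^ n) := fun n => by
    rw [← mul_div_assoc, one_le_div (by positivity)]
    rcases n with _ | n
    · simpa [ha0] using hM1
    · exact h2 _ (by omega)
  obtain ⟨h3, μ, h4, h5⟩ := hasSum_of_renewal (r := fun n => a n / q ^ n)
    (f := fun k => u (k + 1) / q ^ (k + 1)) (M := M) (by simp [ha0]) hr2 (by linarith)
    (fun n => div_nonneg (hu _) (by positivity)) (fun n => by
      rw [hren, Finset.sum_div]
      refine Finset.sum_congr rfl fun k hk => ?_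
      rw [div_mul_div_comm, ← pow_add]
      congr 2
      have := Finset.mem_range.1 hk
      omega) hr1
  have hes : Summable fun k => e k / q ^ k := by
    have hnn : ∀ k, 0 ≤ e k / q ^ k := fun k => div_nonneg (he k) (by positivity)
    -- One factor `M` comes from inserting `1 ≤ M * (a (n - k) / q ^ (n - k))` into each term, the
    -- other from `hdel`.
    refine summable_of_sum_range_le (c := M * M) hnn fun n => ?_
    refine (Finset.sum_le_sum_of_subset_of_nonneg (Finset.range_mono (Nat.le_succ n))
      fun k _ _ => hnn k).trans ?_
    calc ∑ k ∈ Finset.range (n + 1), e k / q ^ k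
        ≤ ∑ k ∈ Finset.range (n + 1), M * (e k * a (n - k) / q ^ n) := by
          refine Finset.sum_le_sum fun k hk => ?_
          have hk' := Finset.mem_range.1 hk
          have : M * (e k * a (n - k) / q ^ n) = (e k / q ^ k) * (M * (a (n - k) / q ^ (n - k))) := by
            rw [show q ^ n = q ^ k * q ^ (n - k) by rw [← pow_add]; congr 1; omega]
            field_simp
          rw [this]
          exact le_mul_of_one_le_right (hnn k) (hr2 _)
      _ = M * ((∑ k ∈ Finset.range (n + 1), e k * a (n - k)) / q ^ n) := by
          rw [← Finset.mul_sum, Finset.sum_div]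
      _ ≤ M * (M * a n / q ^ n) := by gcongr; exact hdel n
      _ = M * (M * (a n / q ^ n)) := by ring
      _ ≤ M * (M * 1) := by gcongr; exact hr1 n
      _ = M * M := by ring
  refine ⟨q, μ, _, ⟨hq0, hq1⟩, h3, ⟨h4, h5⟩, hes.hasSum, ?_⟩
  exact hes.tsum_pos (fun k => div_nonneg (he k) (by positivity)) 0 (by simpa using he0)

end Renewal

/-! ### A Littlewood–Offord bound for random walks on torsion-free groups -/

section Spread

/-! ### Central binomial coefficients. -/

theorem centralBinom_sq_mul_le (n : ℕ) : n.centralBinom ^ 2 * (2 * n + 1) ≤ 16 ^ n := by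
  induction n with
  | zero => simp
  | succ n ih =>
    have h := Nat.succ_mul_centralBinom_succ n
    have h2 : (n + 1) ^ 2 * ((n + 1).centralBinom ^ 2 * (2 * (n + 1) + 1)) ≤
        (n + 1) ^ 2 * 16 ^ (n + 1) := by
      calc (n + 1) ^ 2 * ((n + 1).centralBinom ^ 2 * (2 * (n + 1) + 1))
          = ((n + 1) * (n + 1).centralBinom) ^ 2 * (2 * n + 3) := by ring
        _ = (n.centralBinom ^ 2 * (2 * n + 1)) * (4 * ((2 * n + 1) * (2 * n + 3))) := by
            rw [h]; ring
        _ ≤ 16 ^ n * (4 * (4 * (n + 1) ^ 2)) := by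
            exact Nat.mul_le_mul ih (Nat.mul_le_mul_left 4 (by nlinarith))
        _ = _ := by ring
    exact Nat.le_of_mul_le_mul_left h2 (by positivity)

theorem choose_half_sq_mul_le (m : ℕ) : m.choose (m / 2) ^ 2 * (m + 1) ≤ 4 ^ m := by
  rcases Nat.even_or_odd' m with ⟨n, rfl | rfl⟩
  · have := centralBinom_sq_mul_le n
    rw [Nat.centralBinom] at this
    rw [Nat.mul_div_cancel_left n two_pos, pow_mul]
    simpa using this
  -- The odd case reduces to the even one, as the central coefficient of `2n + 2` is twice the
  -- middle one of `2n + 1`.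
  · have h := centralBinom_sq_mul_le (n + 1)
    have h1 : (n + 1).centralBinom = 2 * (2 * n + 1).choose n := by
      rw [Nat.centralBinom, show 2 * (n + 1) = (2 * n + 1) + 1 by ring, Nat.choose_succ_succ,
        Nat.choose_symm_half]
      ring
    have h2 : (2 * n + 1) / 2 = n := by omega
    rw [h2]
    rw [h1] at h
    have h3 : 4 * ((2 * n + 1).choose n ^ 2 * (2 * n + 1 + 1)) ≤ 4 * 4 ^ (2 * n + 1) := by
      calc 4 * ((2 * n + 1).choose n ^ 2 * (2 * n + 1 + 1))
          ≤ (2 * (2 * n + 1).choose n) ^ 2 * (2 * (n + 1) + 1) := by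
            rw [mul_pow, mul_assoc]
            gcongr
            · norm_num
            · omega
        _ ≤ 16 ^ (n + 1) := h
        _ = _ := by
            rw [show (16 : ℕ) = 4 ^ 2 by norm_num, ← pow_mul]
            ring
    exact Nat.le_of_mul_le_mul_left h3 (by norm_num)

/-- The inequality of arithmetic and geometric means replaces `1 / √(m + 1)` by an expression affine
in `1 / (m + 1)`. This can be averaged over a binomial `m` by hand, with the free parameter `s`
chosen at the end. -/
theorem choose_half_le (m : ℕ) {s : ℝ} (hs : 0 < s) :
    (m.choose (m / 2) : ℝ) ≤ 2 ^ m * ((s + 1 / (s * (m + 1))) / 2) := by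
  have h : ((m.choose (m / 2) : ℝ)) ^ 2 * (m + 1) ≤ 4 ^ m := by
    exact_mod_cast choose_half_sq_mul_le m
  refine le_of_sq_le_sq ?_ (by positivity)
  have h1 : 1 / ((m : ℝ) + 1) ≤ ((s + 1 / (s * (m + 1))) / 2) ^ 2 := by
    have : ((s + 1 / (s * (m + 1))) / 2) ^ 2 - 1 / ((m : ℝ) + 1) =
        ((s - 1 / (s * (m + 1))) / 2) ^ 2 := by
      field_simp
      ring
    nlinarith [sq_nonneg ((s - 1 / (s * (m + 1))) / 2)]
  calc ((m.choose (m / 2) : ℝ)) ^ 2 ≤ 4 ^ m * (1 / ((m : ℝ) + 1)) := by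
        rw [mul_one_div, le_div_iff₀ (by positivity)]
        exact h
    _ ≤ 4 ^ m * ((s + 1 / (s * (m + 1))) / 2) ^ 2 := by gcongr
    _ = _ := by
        rw [mul_pow, ← pow_mul, mul_comm m 2, pow_mul]
        norm_num

/-- Absorbing `1 / (m + 1)` raises both entries of the binomial coefficient and leaves an incomplete
expansion of `(x + y) ^ (b + 1)`. -/
theorem sum_binomial_div_succ_le {x y : ℝ} (hx : 0 < x) (hy : 0 ≤ y) (hxy : x + y = 1) (b : ℕ) :
    ∑ m ∈ Finset.range (b + 1), x ^ m * y ^ (b - m) * (b.choose m : ℝ) * (1 / ((m : ℝ) + 1)) ≤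
      1 / ((b + 1) * x) := by
  rw [le_div_iff₀ (by positivity), Finset.sum_mul]
  calc ∑ m ∈ Finset.range (b + 1),
        x ^ m * y ^ (b - m) * (b.choose m : ℝ) * (1 / ((m : ℝ) + 1)) * ((b + 1) * x)
      = ∑ m ∈ Finset.range (b + 1),
          x ^ (m + 1) * y ^ (b + 1 - (m + 1)) * ((b + 1).choose (m + 1) : ℝ) := by
        refine Finset.sum_congr rfl fun m _ => ?_
        have h : ((b : ℝ) + 1) * (b.choose m : ℝ) = ((b + 1).choose (m + 1) : ℝ) * (m + 1) := by
          exact_mod_cast Nat.add_one_mul_choose_eq b m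
        rw [Nat.add_sub_add_right]
        field_simp
        linear_combination (x ^ (m + 1) * y ^ (b - m)) * h
    _ ≤ ∑ m ∈ Finset.range (b + 1 + 1),
          x ^ m * y ^ (b + 1 - m) * ((b + 1).choose m : ℝ) := by
        rw [Finset.sum_range_succ' _ (b + 1)]
        simp only [le_add_iff_nonneg_right]
        positivity
    _ = 1 := by rw [← add_pow, hxy, one_pow]

/-! ### Transition operators and concentration of a random walk. -/

variable {A : Type*} [AddCommGroup A]

/-- The transition operator of the random walk with step distribution `p`. -/
def stepOp (p : A → ℝ≥0∞) : Module.End ℝ≥0∞ (A → ℝ≥0∞) where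
  toFun f x := ∑' v, p v * f (x + v)
  map_add' f g := by
    ext x
    simp only [Pi.add_apply, mul_add, ENNReal.tsum_add]
  map_smul' c f := by
    ext x
    simp only [Pi.smul_apply, smul_eq_mul, RingHom.id_apply, ← ENNReal.tsum_mul_left]
    refine tsum_congr fun v => ?_
    ring

/-- The operator of translation by `u`. -/
def shiftOp (u : A) : Module.End ℝ≥0∞ (A → ℝ≥0∞) where
  toFun f x := f (x + u)
  map_add' _ _ := rfl
  map_smul' _ _ := rfl

theorem stepOp_apply (p : A → ℝ≥0∞) (f : A → ℝ≥0∞) (x : A) :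
    stepOp p f x = ∑' v, p v * f (x + v) := rfl

theorem shiftOp_apply (u : A) (f : A → ℝ≥0∞) (x : A) : shiftOp u f x = f (x + u) := rfl

theorem commute_shiftOp (u v : A) : Commute (shiftOp u) (shiftOp v) := by
  refine LinearMap.ext fun f => funext fun x => ?_
  simp only [Module.End.mul_apply, shiftOp_apply]
  rw [add_right_comm]

/-- This is what permits the binomial theorem once a step law is split into two parts. -/
theorem commute_shiftOp_stepOp (u : A) (p : A → ℝ≥0∞) : Commute (shiftOp u) (stepOp p) := by
  refine LinearMap.ext fun f => funext fun x => ?_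
  simp only [Module.End.mul_apply, shiftOp_apply, stepOp_apply]
  refine tsum_congr fun v => ?_
  rw [add_right_comm]

theorem shiftOp_pow_apply (u : A) (n : ℕ) (f : A → ℝ≥0∞) (x : A) :
    (shiftOp u ^ n) f x = f (x + n • u) := by
  induction n generalizing x with
  | zero => simp
  | succ n ih =>
    rw [pow_succ', Module.End.mul_apply, shiftOp_apply, ih, succ_nsmul, add_assoc, add_comm u]

theorem stepOp_pow_le (p : A → ℝ≥0∞) (n : ℕ) {f : A → ℝ≥0∞} {C : ℝ≥0∞} (hf : ∀ x, f x ≤ C)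
    (x : A) : (stepOp p ^ n) f x ≤ (∑' v, p v) ^ n * C := by
  induction n generalizing x with
  | zero => simpa using hf x
  | succ n ih =>
    rw [pow_succ', Module.End.mul_apply, stepOp_apply]
    calc ∑' v, p v * (stepOp p ^ n) f (x + v) ≤ ∑' v, p v * ((∑' v, p v) ^ n * C) :=
          ENNReal.tsum_le_tsum fun v => by gcongr; exact ih _
      _ = _ := by rw [ENNReal.tsum_mul_right, pow_succ', mul_assoc]

theorem stepOp_pow_one {p : A → ℝ≥0∞} (hp : ∑' v, p v = 1) (n : ℕ) (x : A) :
    (stepOp p ^ n) 1 x = 1 := by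
  induction n generalizing x with
  | zero => rfl
  | succ n ih =>
    rw [pow_succ', Module.End.mul_apply, stepOp_apply]
    simp [ih, hp]

-- Words in `u` and `u'` of length `m` with different numbers of `u` end at different sites, because
-- `u - u'` has infinite order. So at most one binomial coefficient survives.
open Classical in
theorem shiftOp_add_pow_single_le [IsAddTorsionFree A] {u u' : A} (huu : u ≠ u') (m : ℕ)
    (y x : A) :
    ((shiftOp u + shiftOp u') ^ m) (Pi.single y 1) x ≤ (m.choose (m / 2) : ℝ≥0∞) := by
  rw [(commute_shiftOp u u').add_pow]
  have h1 : (∑ j ∈ Finset.range (m + 1), shiftOp u ^ j * shiftOp u' ^ (m - j) *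
      (m.choose j : Module.End ℝ≥0∞ (A → ℝ≥0∞))) (Pi.single y 1) x =
      ∑ j ∈ Finset.range (m + 1),
        (m.choose j : ℝ≥0∞) * (if x + j • u + (m - j) • u' = y then 1 else 0) := by
    rw [LinearMap.sum_apply, Finset.sum_apply]
    refine Finset.sum_congr rfl fun j _ => ?_
    rw [← (Nat.cast_commute (m.choose j) _).eq, ← nsmul_eq_mul, LinearMap.smul_apply,
      Pi.smul_apply, Module.End.mul_apply, shiftOp_pow_apply, shiftOp_pow_apply, nsmul_eq_mul,
      Pi.single_apply]
  rw [h1]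
  by_cases hex : ∃ j ∈ Finset.range (m + 1), x + j • u + (m - j) • u' = y
  · obtain ⟨j, hj, hjy⟩ := hex
    rw [Finset.sum_eq_single_of_mem j hj]
    · rw [if_pos hjy, mul_one]
      exact_mod_cast Nat.choose_le_middle j m
    · intro i hi hij
      rw [if_neg, mul_zero]
      intro hiy
      have hi' := Nat.lt_succ_iff.1 (Finset.mem_range.1 hi)
      have hj' := Nat.lt_succ_iff.1 (Finset.mem_range.1 hj)
      rw [← hjy, add_assoc, add_assoc, add_right_inj] at hiy
      have h2 : ((i : ℤ) - j) • (u - u') = 0 := by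
        rw [← natCast_zsmul, ← natCast_zsmul, ← natCast_zsmul, ← natCast_zsmul,
          Nat.cast_sub hi', Nat.cast_sub hj'] at hiy
        rw [sub_smul, smul_sub, smul_sub]
        simp only [sub_smul] at hiy
        have := sub_eq_zero.2 hiy
        rw [← this]
        abel
      rcases smul_eq_zero.1 h2 with h3 | h3
      · exact hij (by omega)
      · exact huu (sub_eq_zero.1 h3)
  · push Not at hex
    rw [Finset.sum_eq_zero]
    · exact zero_le
    · intro j hj
      rw [if_neg (hex j hj), mul_zero]

open Classical in
/-- A random walk with two different possible steps is unlikely to be in a given small set. -/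
theorem stepOp_pow_indicator_le [IsAddTorsionFree A] {p : A → ℝ≥0∞} (hp : ∑' v, p v = 1)
    {u u' : A} (huu : u ≠ u') (hu : p u ≠ 0) (hu' : p u' ≠ 0) :
    ∃ C : ℕ, ∀ (F : Finset A) (x : A),
      (stepOp p ^ (C * (F.card + 1) ^ 2)) (fun y => if y ∈ F then 1 else 0) x ≤ 2⁻¹ := by
  -- The step law is split as `e (δ_u + δ_u') + ρ`. The number of steps drawn from the first part is
  -- binomial with parameter `2ε`, and given that number the two-step bound applies.
  set e : ℝ≥0∞ := min (p u) (p u') with he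
  have hpu : p u + p u' ≤ 1 := by
    rw [← hp, ← Finset.sum_pair huu]
    exact ENNReal.sum_le_tsum _
  have he2 : 2 * e ≤ 1 := by
    rw [two_mul]
    exact (add_le_add (min_le_left _ _) (min_le_right _ _)).trans hpu
  have he0 : e ≠ 0 := by
    rw [he]
    rcases min_choice (p u) (p u') with h | h <;> rw [h] <;> assumption
  have het : e ≠ ⊤ := by
    intro h
    rw [h] at he2
    simp at he2
  set ε : ℝ := e.toReal with hε
  have hε0 : 0 < ε := ENNReal.toReal_pos he0 het
  have heε : e = ENNReal.ofReal ε := (ENNReal.ofReal_toReal het).symm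
  have hε2 : 2 * ε ≤ 1 := by
    have := ENNReal.toReal_mono ENNReal.one_ne_top he2
    simpa using this
  set ρ : A → ℝ≥0∞ := fun v => p v - ((if v = u then e else 0) + (if v = u' then e else 0)) with hρ
  have hpρ : ∀ v, p v = (if v = u then e else 0) + (if v = u' then e else 0) + ρ v := fun v => by
    rw [hρ]
    simp only
    rw [add_tsub_cancel_of_le]
    by_cases h1 : v = u
    · have h2 : v ≠ u' := by rw [h1]; exact huu
      rw [if_pos h1, if_neg h2, add_zero, h1]
      exact min_le_left _ _
    · rw [if_neg h1, zero_add]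
      split_ifs with h2
      · rw [h2]; exact min_le_right _ _
      · exact zero_le
  have hρs : ∑' v, ρ v = ENNReal.ofReal (1 - 2 * ε) := by
    have h1 : (∑' v, p v) = e + e + ∑' v, ρ v := by
      rw [tsum_congr hpρ, ENNReal.tsum_add, ENNReal.tsum_add, tsum_ite_eq, tsum_ite_eq]
    rw [hp] at h1
    rw [ENNReal.ofReal_sub _ (by positivity), ENNReal.ofReal_one, ENNReal.ofReal_mul (by norm_num),
      ← heε, ENNReal.ofReal_ofNat]
    refine ENNReal.eq_sub_of_add_eq (ENNReal.mul_ne_top (by norm_num) het) ?_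
    rw [h1, two_mul, add_comm]
  have hop : stepOp p = e • (shiftOp u + shiftOp u') + stepOp ρ := by
    refine LinearMap.ext fun f => funext fun x => ?_
    simp only [stepOp_apply, LinearMap.add_apply, LinearMap.smul_apply, Pi.add_apply,
      Pi.smul_apply, shiftOp_apply, smul_eq_mul]
    have h1 : ∀ v, p v * f (x + v) = (if v = u then e * f (x + u) else 0) +
        (if v = u' then e * f (x + u') else 0) + ρ v * f (x + v) := fun v => by
      rw [hpρ v, add_mul, add_mul]
      congr 2
      · split_ifs with h
        · rw [h]
        · rw [zero_mul]
      · split_ifs with h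
        · rw [h]
        · rw [zero_mul]
    rw [tsum_congr h1, ENNReal.tsum_add, ENNReal.tsum_add, tsum_ite_eq, tsum_ite_eq, mul_add]
  have hcomm : Commute (e • (shiftOp u + shiftOp u')) (stepOp ρ) :=
    ((commute_shiftOp_stepOp u ρ).add_left (commute_shiftOp_stepOp u' ρ)).smul_left e
  have hsingle : ∀ (b : ℕ) (s : ℝ), 0 < s → ∀ y x,
      (stepOp p ^ b) (Pi.single y 1) x ≤
        ENNReal.ofReal ((s + 1 / (s * ((b + 1) * (2 * ε)))) / 2) := fun b s hs y x => by
    rw [hop, hcomm.add_pow, LinearMap.sum_apply, Finset.sum_apply]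
    calc ∑ m ∈ Finset.range (b + 1), ((e • (shiftOp u + shiftOp u')) ^ m * stepOp ρ ^ (b - m) *
          (b.choose m : Module.End ℝ≥0∞ (A → ℝ≥0∞))) (Pi.single y 1) x
        ≤ ∑ m ∈ Finset.range (b + 1), ENNReal.ofReal ((2 * ε) ^ m * (1 - 2 * ε) ^ (b - m) *
            (b.choose m : ℝ) * ((s + 1 / (s * (m + 1))) / 2)) := by
          refine Finset.sum_le_sum fun m _ => ?_
          rw [← (Nat.cast_commute (b.choose m) _).eq, ← nsmul_eq_mul, LinearMap.smul_apply,
            Pi.smul_apply, nsmul_eq_mul, (hcomm.pow_pow m (b - m)).eq, Module.End.mul_apply,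
            smul_pow, LinearMap.smul_apply, map_smul, Pi.smul_apply, smul_eq_mul]
          calc (b.choose m : ℝ≥0∞) * (e ^ m * (stepOp ρ ^ (b - m))
                (((shiftOp u + shiftOp u') ^ m) (Pi.single y 1)) x)
              ≤ (b.choose m : ℝ≥0∞) * (e ^ m * ((ENNReal.ofReal (1 - 2 * ε)) ^ (b - m) *
                  (m.choose (m / 2) : ℝ≥0∞))) := by
                gcongr
                rw [← hρs]
                exact stepOp_pow_le ρ _ (shiftOp_add_pow_single_le huu m y) x
            _ = ENNReal.ofReal ((b.choose m : ℝ) * (ε ^ m * ((1 - 2 * ε) ^ (b - m) *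
                  (m.choose (m / 2) : ℝ)))) := by
                have h12 : 0 ≤ 1 - 2 * ε := by linarith
                rw [ENNReal.ofReal_mul (by positivity), ENNReal.ofReal_mul (by positivity),
                  ENNReal.ofReal_mul (by positivity), ENNReal.ofReal_pow hε0.le,
                  ENNReal.ofReal_pow h12, heε, ENNReal.ofReal_natCast, ENNReal.ofReal_natCast]
            _ ≤ _ := by
                have h12 : 0 ≤ 1 - 2 * ε := by linarith
                refine ENNReal.ofReal_le_ofReal ?_
                calc (b.choose m : ℝ) * (ε ^ m * ((1 - 2 * ε) ^ (b - m) *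
                      (m.choose (m / 2) : ℝ)))
                    ≤ (b.choose m : ℝ) * (ε ^ m * ((1 - 2 * ε) ^ (b - m) *
                      (2 ^ m * ((s + 1 / (s * (m + 1))) / 2)))) := by
                      gcongr
                      exact choose_half_le m hs
                  _ = _ := by rw [mul_pow]; ring
      _ = ENNReal.ofReal (∑ m ∈ Finset.range (b + 1), (2 * ε) ^ m * (1 - 2 * ε) ^ (b - m) *
            (b.choose m : ℝ) * ((s + 1 / (s * (m + 1))) / 2)) := by
          have h12 : 0 ≤ 1 - 2 * ε := by linarith
          rw [ENNReal.ofReal_sum_of_nonneg]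
          intro m _
          positivity
      _ ≤ _ := by
          refine ENNReal.ofReal_le_ofReal ?_
          have h12 : 0 ≤ 1 - 2 * ε := by linarith
          have h3 := sum_binomial_div_succ_le (x := 2 * ε) (y := 1 - 2 * ε) (by positivity) h12
            (by ring) b
          have h4 : ∑ m ∈ Finset.range (b + 1),
              (2 * ε) ^ m * (1 - 2 * ε) ^ (b - m) * (b.choose m : ℝ) = 1 := by
            rw [← add_pow]
            simp
          calc ∑ m ∈ Finset.range (b + 1), (2 * ε) ^ m * (1 - 2 * ε) ^ (b - m) *
                (b.choose m : ℝ) * ((s + 1 / (s * (m + 1))) / 2)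
              = s / 2 * (∑ m ∈ Finset.range (b + 1),
                  (2 * ε) ^ m * (1 - 2 * ε) ^ (b - m) * (b.choose m : ℝ)) +
                1 / (2 * s) * (∑ m ∈ Finset.range (b + 1), (2 * ε) ^ m * (1 - 2 * ε) ^ (b - m) *
                  (b.choose m : ℝ) * (1 / ((m : ℝ) + 1))) := by
                rw [Finset.mul_sum, Finset.mul_sum, ← Finset.sum_add_distrib]
                refine Finset.sum_congr rfl fun m _ => ?_
                field_simp
            _ ≤ s / 2 * 1 + 1 / (2 * s) * (1 / ((b + 1) * (2 * ε))) := by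
                rw [h4]
                gcongr
            _ = _ := by field_simp
  -- For `k` sites take `s = 1 / (2 (k + 1))`. This choice of `C` makes the second summand in
  -- `hsingle` at most `s` as well, so each site has probability at most `1 / (2 (k + 1))` and all
  -- of them together at most one half.
  obtain ⟨C, hC⟩ := exists_nat_gt (2 / ε)
  refine ⟨C, fun F x => ?_⟩
  have hF : (fun y => if y ∈ F then (1 : ℝ≥0∞) else 0) = ∑ y ∈ F, Pi.single y 1 := by
    ext z
    simp [Finset.sum_apply, Pi.single_apply]
  rw [hF, map_sum, Finset.sum_apply]
  clear hF
  obtain ⟨k, hk⟩ : ∃ k, F.card = k := ⟨_, rfl⟩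
  rw [hk]
  set b := C * (k + 1) ^ 2 with hb
  calc ∑ y ∈ F, (stepOp p ^ b) (Pi.single y 1) x
      ≤ ∑ y ∈ F, ENNReal.ofReal ((1 / (2 * (k + 1)) +
          1 / (1 / (2 * (k + 1)) * ((b + 1) * (2 * ε)))) / 2) :=
        Finset.sum_le_sum fun y _ => hsingle b _ (by positivity) y x
    _ = ENNReal.ofReal (k * ((1 / (2 * (k + 1)) +
          1 / (1 / (2 * (k + 1)) * ((b + 1) * (2 * ε)))) / 2)) := by
        rw [Finset.sum_const, hk, nsmul_eq_mul, ENNReal.ofReal_mul (by positivity),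
          ENNReal.ofReal_natCast]
    _ ≤ ENNReal.ofReal 2⁻¹ := by
        refine ENNReal.ofReal_le_ofReal ?_
        have hC' : 2 < C * ε := by rwa [div_lt_iff₀ hε0] at hC
        have hb1 : 2 * ((k : ℝ) + 1) ^ 2 ≤ (b + 1) * ε := by
          rw [hb]
          push_cast
          nlinarith [sq_nonneg ((k : ℝ) + 1)]
        have h5 : 1 / (1 / (2 * ((k : ℝ) + 1)) * ((b + 1) * (2 * ε))) ≤
            1 / (2 * (k + 1)) := by
          rw [show 1 / (2 * ((k : ℝ) + 1)) * ((b + 1) * (2 * ε)) =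
            ((b + 1) * ε) / (k + 1) by field_simp, one_div_div,
            div_le_div_iff₀ (by positivity) (by positivity)]
          nlinarith
        calc (k : ℝ) * ((1 / (2 * (k + 1)) +
              1 / (1 / (2 * (k + 1)) * ((b + 1) * (2 * ε)))) / 2)
            ≤ k * ((1 / (2 * (k + 1)) + 1 / (2 * (k + 1))) / 2) := by gcongr
          _ = (k : ℝ) / (2 * (k + 1)) := by field_simp; ring
          _ ≤ 2⁻¹ := by
              rw [div_le_iff₀ (by positivity)]
              linarith
    _ = 2⁻¹ := by
        rw [ENNReal.ofReal_inv_of_pos (by norm_num), ENNReal.ofReal_ofNat]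

end Spread

/-! ### The expected lifetime of a random walk weighted by its local times -/

section Lifetime

variable {A : Type*}

open Classical in
/-- The number of elements of a multiset with multiplicity greater than `h`. -/
def numMulti (h : ℕ) (c : Multiset A) : ℕ :=
  (c.toFinset.filter fun x => h < c.count x).card

open Classical in
theorem numMulti_mono (h : ℕ) {c c' : Multiset A} (hc : c ≤ c') : numMulti h c ≤ numMulti h c' := by
  refine Finset.card_le_card fun x hx => ?_
  simp only [Finset.mem_filter, Multiset.mem_toFinset] at hx ⊢
  exact ⟨Multiset.mem_of_le hc hx.1, hx.2.trans_le (Multiset.count_le_of_le x hc)⟩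

open Classical in
theorem numMulti_lt (h : ℕ) {c c' : Multiset A} (hc : c ≤ c') {y : A} (hy : c.count y ≤ h)
    (hy' : h < c'.count y) : numMulti h c < numMulti h c' := by
  refine Finset.card_lt_card ((Finset.ssubset_iff_of_subset fun x hx => ?_).2 ⟨y, ?_, ?_⟩)
  · simp only [Finset.mem_filter, Multiset.mem_toFinset] at hx ⊢
    exact ⟨Multiset.mem_of_le hc hx.1, hx.2.trans_le (Multiset.count_le_of_le x hc)⟩
  · simp only [Finset.mem_filter, Multiset.mem_toFinset]
    exact ⟨Multiset.count_pos.1 (by omega), hy'⟩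
  · simp only [Finset.mem_filter, not_and, not_lt]
    exact fun _ => hy

variable [AddCommGroup A]

/-- The multiset of the states visited after the start by the path with initial state `x` and
list of increments `l`. -/
def visited : A → List A → Multiset A
  | _, [] => 0
  | x, v :: l => (x + v) ::ₘ visited (x + v) l

/-- The sum over the times `0, …, N` of the expected weight `w` of the multiset of states visited
so far, where `c` is the multiset of states visited before and `x` is the current state. -/
def lifetime (p : A → ℝ≥0∞) (w : Multiset A → ℝ≥0∞) : ℕ → Multiset A → A → ℝ≥0∞
  | 0, c, _ => w c
  | N + 1, c, x => w c + ∑' v, p v * lifetime p w N ((x + v) ::ₘ c) (x + v)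

theorem lifetime_mono {p : A → ℝ≥0∞} {w w' : Multiset A → ℝ≥0∞} (h : ∀ c, w c ≤ w' c) (N : ℕ)
    (c : Multiset A) (x : A) : lifetime p w N c x ≤ lifetime p w' N c x := by
  induction N generalizing c x with
  | zero => exact h c
  | succ N ih =>
    exact add_le_add (h c) (ENNReal.tsum_le_tsum fun v => by gcongr; exact ih _ _)

/-- A defect of mass in `p` acts as killing at every step, so no decay of `w` is needed. This serves
the case in which the level may be left for good. -/
theorem lifetime_le_geometric {p : A → ℝ≥0∞} {w : Multiset A → ℝ≥0∞} (hw : ∀ c, w c ≤ 1) (N : ℕ)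
    (c : Multiset A) (x : A) :
    lifetime p w N c x ≤ ∑ k ∈ Finset.range (N + 1), (∑' v, p v) ^ k := by
  induction N generalizing c x with
  | zero => simpa [lifetime] using hw c
  | succ N ih =>
    rw [Finset.sum_range_succ', lifetime, add_comm]
    refine add_le_add ?_ (by simpa using hw c)
    calc ∑' v, p v * lifetime p w N ((x + v) ::ₘ c) (x + v)
        ≤ ∑' v, p v * ∑ k ∈ Finset.range (N + 1), (∑' v, p v) ^ k :=
          ENNReal.tsum_le_tsum fun v => by gcongr; exact ih _ _
      _ = _ := by
          rw [ENNReal.tsum_mul_right, Finset.mul_sum]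
          exact Finset.sum_congr rfl fun k _ => (pow_succ' _ _).symm

/-- The walk never moves, so only the multiplicity of one site grows. For the environment weight
this becomes a sum of tails of the limit at that site. -/
theorem lifetime_le_of_const {p : A → ℝ≥0∞} {w : Multiset A → ℝ≥0∞} (hp : ∀ v, v ≠ 0 → p v = 0)
    (hp0 : p 0 ≤ 1) (N : ℕ) (c : Multiset A) (x : A) :
    lifetime p w N c x ≤ ∑ k ∈ Finset.range (N + 1), w (c + Multiset.replicate k x) := by
  induction N generalizing c x with
  | zero => simp [lifetime]
  | succ N ih =>
    rw [Finset.sum_range_succ', lifetime, add_comm]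
    refine add_le_add ?_ (by simp)
    rw [tsum_eq_single 0 fun v hv => by rw [hp v hv, zero_mul], add_zero]
    calc p 0 * lifetime p w N (x ::ₘ c) x ≤ 1 * lifetime p w N (x ::ₘ c) x := by gcongr
      _ ≤ _ := by
          rw [one_mul]
          refine (ih _ _).trans (Finset.sum_le_sum fun k _ => le_of_eq ?_)
          rw [Multiset.replicate_succ, Multiset.cons_add, Multiset.add_cons]

/-! ### Creating a new site of high multiplicity. -/

theorem visited_append (x : A) (l l' : List A) :
    visited x (l ++ l') = visited x l + visited (x + l.sum) l' := by
  induction l generalizing x with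
  | nil => simp [visited]
  | cons v l ih => simp [visited, ih, add_assoc]

/-- The expectation of `g` after `b` steps of the random walk, as a function of the multiset of
visited states and of the current state. -/
def expectAfter (p : A → ℝ≥0∞) (g : Multiset A → ℝ≥0∞) : ℕ → Multiset A → A → ℝ≥0∞
  | 0, c, _ => g c
  | b + 1, c, x => ∑' v, p v * expectAfter p g b ((x + v) ::ₘ c) (x + v)

theorem expectAfter_add (p : A → ℝ≥0∞) (g g' : Multiset A → ℝ≥0∞) (b : ℕ) (c : Multiset A)
    (x : A) : expectAfter p (fun c => g c + g' c) b c x =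
      expectAfter p g b c x + expectAfter p g' b c x := by
  induction b generalizing c x with
  | zero => rfl
  | succ b ih => simp only [expectAfter, ih, mul_add, ENNReal.tsum_add]

theorem expectAfter_mul (p : A → ℝ≥0∞) (a : ℝ≥0∞) (g : Multiset A → ℝ≥0∞) (b : ℕ)
    (c : Multiset A) (x : A) : expectAfter p (fun c => a * g c) b c x =
      a * expectAfter p g b c x := by
  induction b generalizing c x with
  | zero => rfl
  | succ b ih =>
    simp only [expectAfter, ih, ← ENNReal.tsum_mul_left]
    exact tsum_congr fun v => by ring

theorem expectAfter_one {p : A → ℝ≥0∞} (hp : ∑' v, p v = 1) (b : ℕ) (c : Multiset A) (x : A) :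
    expectAfter p (fun _ => 1) b c x = 1 := by
  induction b generalizing c x with
  | zero => rfl
  | succ b ih => simp only [expectAfter, ih, mul_one, hp]

theorem prod_mul_le_expectAfter (p : A → ℝ≥0∞) (g : Multiset A → ℝ≥0∞) (l : List A)
    (c : Multiset A) (x : A) :
    (l.map p).prod * g (c + visited x l) ≤ expectAfter p g l.length c x := by
  induction l generalizing c x with
  | nil => simp [visited, expectAfter]
  | cons v l ih =>
    rw [List.length_cons, expectAfter, List.map_cons, List.prod_cons, mul_assoc]
    refine le_trans ?_ (ENNReal.le_tsum v)
    gcongr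
    refine le_trans (le_of_eq ?_) (ih _ _)
    rw [visited, Multiset.add_cons, Multiset.cons_add]

-- Each passage through the closed loop `l` ends at `x` again.
open Classical in
theorem le_count_visited_flatten {l : List A} (hl : l ≠ []) (hsum : l.sum = 0) (x : A) (n : ℕ) :
    n ≤ (visited x (List.replicate n l).flatten).count x := by
  have hmem : ∀ (l : List A) (x : A), l ≠ [] → x + l.sum ∈ visited x l := by
    intro l
    induction l with
    | nil => intro x h; exact absurd rfl h
    | cons v l ih =>
      intro x _
      rw [visited, Multiset.mem_cons, List.sum_cons, ← add_assoc]
      by_cases h : l = []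
      · left; simp [h]
      · right; exact ih _ h
  induction n with
  | zero => simp
  | succ n ih =>
    rw [List.replicate_succ, List.flatten_cons, visited_append, hsum, add_zero,
      Multiset.count_add]
    have h1 := hmem l x hl
    rw [hsum, add_zero, ← Multiset.one_le_count_iff_mem] at h1
    omega

-- After `b` steps, `b` quadratic in the number of sites with multiplicity above `h`, the walk is
-- off these sites with probability at least one half. It then follows `l` for `h + 1` rounds with
-- the fixed probability `θ`, which lifts the multiplicity of its current site above `h`. Only the
-- number of steps depends on `c`; the constants `C` and `δ` do not.
open Classical in
theorem exists_expectAfter_ge [IsAddTorsionFree A] {p : A → ℝ≥0∞} (hp : ∑' v, p v = 1) {u u' : A}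
    (huu : u ≠ u') (hu : p u ≠ 0) (hu' : p u' ≠ 0) {l : List A} (hl : l ≠ []) (hsum : l.sum = 0)
    (hpl : ∀ v ∈ l, p v ≠ 0) (h : ℕ) :
    ∃ (C : ℕ) (δ : ℝ≥0∞), δ ≠ 0 ∧ ∀ c x, δ ≤ expectAfter p
      (fun c' => if numMulti h c < numMulti h c' then 1 else 0) (C * (numMulti h c + 1) ^ 2) c x := by
  obtain ⟨C, hC⟩ := stepOp_pow_indicator_le hp huu hu hu'
  set L := (List.replicate (h + 1) l).flatten with hL
  set θ := (L.map p).prod with hθ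
  have hθ0 : θ ≠ 0 := by
    rw [hθ, Ne, List.prod_eq_zero_iff, List.mem_map]
    rintro ⟨v, hv, hv0⟩
    rw [hL, List.mem_flatten] at hv
    obtain ⟨l', hl', hv'⟩ := hv
    rw [(List.mem_replicate.1 hl').2] at hv'
    exact hpl v hv' hv0
  -- The reference multiset `c₀` stays frozen while `c` grows along the path, so the set of sites to
  -- avoid does not change during the induction.
  have hmono : ∀ (b : ℕ) (c₀ c : Multiset A), c₀ ≤ c → ∀ x,
      (stepOp p ^ b) (fun y => θ * (if c₀.count y ≤ h then 1 else 0)) x ≤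
      expectAfter p (fun c' => if numMulti h c₀ < numMulti h c' then 1 else 0)
        (b + L.length) c x := by
    intro b c₀
    induction b with
    | zero =>
      intro c hc x
      rw [pow_zero, zero_add]
      refine le_trans ?_ (prod_mul_le_expectAfter p _ L c x)
      simp only [Module.End.one_apply]
      rw [← hθ]
      gcongr
      split_ifs with h1 h2
      · exact le_rfl
      · refine absurd (numMulti_lt h (hc.trans (Multiset.le_add_right _ _)) h1 ?_) h2
        rw [Multiset.count_add]
        have := le_count_visited_flatten hl hsum x (h + 1)
        rw [← hL] at this
        omega
      · exact zero_le
      · exact zero_le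
    | succ b ih =>
      intro c hc x
      rw [pow_succ', Module.End.mul_apply, stepOp_apply,
        show b + 1 + L.length = (b + L.length) + 1 by ring, expectAfter]
      refine ENNReal.tsum_le_tsum fun v => ?_
      gcongr
      exact ih _ (hc.trans (Multiset.le_cons_self _ _)) _
  -- Waiting longer does not lower the probability, since sites of high multiplicity are never lost.
  -- This allows rounding the time up to a multiple of the square, with `C + L.length` as the
  -- factor.
  have hext : ∀ (k b : ℕ) (c₀ c : Multiset A) (x : A),
      expectAfter p (fun c' => if numMulti h c₀ < numMulti h c' then 1 else 0) b c x ≤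
      expectAfter p (fun c' => if numMulti h c₀ < numMulti h c' then 1 else 0) (b + k) c x := by
    intro k b c₀
    have hbase : ∀ (k : ℕ) (c : Multiset A) (x : A), numMulti h c₀ < numMulti h c →
        expectAfter p (fun c' => if numMulti h c₀ < numMulti h c' then 1 else 0) k c x = 1 := by
      intro k
      induction k with
      | zero => intro c x hc; simp [expectAfter, hc]
      | succ k ih =>
        intro c x hc
        have h1 : ∀ v, expectAfter p (fun c' => if numMulti h c₀ < numMulti h c' then 1 else 0) k
            ((x + v) ::ₘ c) (x + v) = 1 := fun v =>
          ih _ _ (hc.trans_le (numMulti_mono h (Multiset.le_cons_self _ _)))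
        simp only [expectAfter, h1, mul_one, hp]
    induction b with
    | zero =>
      intro c x
      rw [zero_add, expectAfter]
      split_ifs with hc
      · exact (hbase k c x hc).ge
      · exact zero_le
    | succ b ih =>
      intro c x
      rw [show b + 1 + k = (b + k) + 1 by ring, expectAfter, expectAfter]
      exact ENNReal.tsum_le_tsum fun v => by gcongr; exact ih _ _
  refine ⟨C + L.length, θ * 2⁻¹, by simp [hθ0], fun c x => ?_⟩
  set F := c.toFinset.filter fun x => h < c.count x with hF
  have hcard : numMulti h c = F.card := rfl
  have h1 := hC F x
  set b := C * (F.card + 1) ^ 2 with hb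
  have h2 : (stepOp p ^ b) (fun y => θ * (if c.count y ≤ h then 1 else 0)) x ≥ θ * 2⁻¹ := by
    have e1 : (fun y => θ * (if c.count y ≤ h then (1 : ℝ≥0∞) else 0)) =
        θ • (fun y => if c.count y ≤ h then (1 : ℝ≥0∞) else 0) := rfl
    rw [e1, map_smul, Pi.smul_apply, smul_eq_mul]
    gcongr
    have e2 : (fun y => if c.count y ≤ h then (1 : ℝ≥0∞) else 0) +
        (fun y => if y ∈ F then (1 : ℝ≥0∞) else 0) = 1 := by
      ext y
      simp only [Pi.add_apply, Pi.one_apply, hF, Finset.mem_filter, Multiset.mem_toFinset]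
      by_cases hy : c.count y ≤ h
      · simp [hy]
      · rw [if_neg hy, if_pos, zero_add]
        exact ⟨Multiset.count_pos.1 (by omega), by omega⟩
    have e3 := stepOp_pow_one hp b x
    rw [← e2, map_add, Pi.add_apply] at e3
    have e4 : (1 : ℝ≥0∞) ≤ (stepOp p ^ b) (fun y => if c.count y ≤ h then (1 : ℝ≥0∞) else 0) x +
        2⁻¹ := e3.symm.le.trans (by gcongr)
    rw [← ENNReal.one_sub_inv_two]
    exact tsub_le_iff_right.2 e4
  refine h2.trans (((hmono b c c le_rfl x)).trans ?_)
  have h3 : (C + L.length) * (numMulti h c + 1) ^ 2 =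
      (b + L.length) + L.length * ((F.card + 1) ^ 2 - 1) := by
    rw [hcard, hb]
    have : 1 ≤ (F.card + 1) ^ 2 := Nat.one_le_pow _ _ (by omega)
    obtain ⟨t, ht⟩ := Nat.exists_eq_add_of_le this
    rw [ht]
    simp only [add_tsub_cancel_left]
    ring
  rw [h3]
  exact hext _ _ _ _ _

open Classical in
/-- If the weight decays exponentially in the number of states visited often, then the expected
lifetime of a nondegenerate random walk that can return to its initial state is bounded. -/
theorem lifetime_bounded_of_returning [IsAddTorsionFree A] {p : A → ℝ≥0∞} (hp : ∑' v, p v = 1)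
    {u u' : A} (huu : u ≠ u') (hu : p u ≠ 0) (hu' : p u' ≠ 0) {l : List A} (hl : l ≠ [])
    (hsum : l.sum = 0) (hpl : ∀ v ∈ l, p v ≠ 0) (h : ℕ) {γ : ℝ≥0∞} (hγ : γ < 1) :
    ∃ B : ℝ≥0∞, B ≠ ⊤ ∧ ∀ N c x, lifetime p (fun c => γ ^ numMulti h c) N c x ≤ B := by
  obtain ⟨C, δ, hδ0, hδ⟩ := exists_expectAfter_ge hp huu hu hu' hl hsum hpl h
  have hδ1 : δ ≤ 1 := by
    have : ∀ (b : ℕ) (c : Multiset A) (x : A), expectAfter p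
        (fun c' => if numMulti h (0 : Multiset A) < numMulti h c' then 1 else 0) b c x ≤
        expectAfter p (fun _ => 1) b c x := by
      intro b
      induction b with
      | zero => intro c x; simp only [expectAfter]; split_ifs <;> simp
      | succ b ih =>
        intro c x
        exact ENNReal.tsum_le_tsum fun v => by gcongr; exact ih _ _
    exact ((hδ 0 0).trans (this _ 0 0)).trans (expectAfter_one hp _ 0 0).le
  have hδt : δ ≠ ⊤ := ne_top_of_le_ne_top ENNReal.one_ne_top hδ1
  have hγpow : ∀ {i j : ℕ}, i ≤ j → γ ^ j ≤ γ ^ i := fun hij => pow_le_pow_right_of_le_one' hγ.le hij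
  set b : ℕ → ℕ := fun i => C * (i + 1) ^ 2 with hb
  set w : Multiset A → ℝ≥0∞ := fun c => γ ^ numMulti h c with hw
  -- A crude bound that makes the truncated suprema below finite and lets them vanish as `i` grows.
  have hsup : ∀ (N i : ℕ) (c : Multiset A) (x : A), i ≤ numMulti h c →
      lifetime p w N c x ≤ (N + 1) * γ ^ i := by
    intro N i
    induction N with
    | zero => intro c x hc; simpa [lifetime] using hγpow hc
    | succ N ih =>
      intro c x hc
      rw [lifetime, add_comm (_ : ℝ≥0∞) 1, add_mul, one_mul]
      refine add_le_add (hγpow hc) ?_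
      calc ∑' v, p v * lifetime p w N ((x + v) ::ₘ c) (x + v)
          ≤ ∑' v, p v * (((N + 1 : ℕ) : ℝ≥0∞) * γ ^ i) := ENNReal.tsum_le_tsum fun v => by
            gcongr
            push_cast
            exact ih _ _ (hc.trans (numMulti_mono h (Multiset.le_cons_self _ _)))
        _ = _ := by rw [ENNReal.tsum_mul_right, hp, one_mul]
  refine ⟨∑' i : ℕ, (b i : ℝ≥0∞) * γ ^ i * δ⁻¹, ?_, fun N₀ c x => ?_⟩
  · rw [ENNReal.tsum_mul_right]
    refine ENNReal.mul_ne_top ?_ (ENNReal.inv_ne_top.2 hδ0)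
    have hγt : γ ≠ ⊤ := hγ.ne_top
    have hg : γ.toReal < 1 := by
      have := (ENNReal.toReal_lt_toReal hγt ENNReal.one_ne_top).2 hγ
      simpa using this
    have hs : Summable fun i : ℕ => (b i : ℝ) * γ.toReal ^ i := by
      have hn : ‖γ.toReal‖ < 1 := by rwa [Real.norm_of_nonneg ENNReal.toReal_nonneg]
      have s0 := summable_pow_mul_geometric_of_norm_lt_one 0 hn
      have s1 := summable_pow_mul_geometric_of_norm_lt_one 1 hn
      have s2 := summable_pow_mul_geometric_of_norm_lt_one 2 hn
      refine (((s2.mul_left (C : ℝ)).add (s1.mul_left (2 * C : ℝ))).add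
        (s0.mul_left (C : ℝ))).congr fun i => ?_
      simp only [hb]
      push_cast
      ring
    have h2 : ∀ i : ℕ, (b i : ℝ≥0∞) * γ ^ i = ENNReal.ofReal ((b i : ℝ) * γ.toReal ^ i) := fun i => by
      rw [ENNReal.ofReal_mul (by positivity), ENNReal.ofReal_natCast,
        ENNReal.ofReal_pow ENNReal.toReal_nonneg, ENNReal.ofReal_toReal hγt]
    rw [tsum_congr h2]
    exact hs.tsum_ofReal_ne_top
  -- The supremum over states with at least `i` sites of high multiplicity. The horizon `N₀` makes
  -- it finite, so that it can be cancelled in `hrec`; the final bound does not depend on `N₀`.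
  set a : ℕ → ℝ≥0∞ := fun i => ⨆ (N : ℕ) (_ : N ≤ N₀) (c : Multiset A) (_ : i ≤ numMulti h c)
    (x : A), lifetime p w N c x with ha
  have hle : ∀ {i N : ℕ} {c : Multiset A} {x : A}, N ≤ N₀ → i ≤ numMulti h c →
      lifetime p w N c x ≤ a i := fun {i N c x} hN hc =>
    le_iSup_of_le N (le_iSup_of_le hN (le_iSup_of_le c (le_iSup_of_le hc (le_iSup_of_le x le_rfl))))
  have ha_le : ∀ i, a i ≤ (N₀ + 1) * γ ^ i := fun i =>
    iSup_le fun N => iSup_le fun hN => iSup_le fun c => iSup_le fun hc => iSup_le fun x =>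
      (hsup N i c x hc).trans (by gcongr)
  have hat : ∀ i, a i ≠ ⊤ := fun i => ne_top_of_le_ne_top
    (ENNReal.mul_ne_top (by simp) (ENNReal.pow_ne_top hγ.ne_top)) (ha_le i)
  have hanti : ∀ i, a (i + 1) ≤ a i := fun i =>
    iSup_le fun N => iSup_le fun hN => iSup_le fun c => iSup_le fun hc => iSup_le fun x =>
      hle hN (by omega)
  -- Markov property after `k` steps: each of the first `k` times costs at most `γ ^ i`, and the
  -- remainder is bounded by `a i`, or by `a (i + 1)` if a new site has been created.
  have hmark : ∀ (i k N : ℕ) (c : Multiset A) (x : A), N ≤ N₀ → i ≤ numMulti h c →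
      lifetime p w N c x ≤ k * γ ^ i +
        expectAfter p (fun c' => if i < numMulti h c' then a (i + 1) else a i) k c x := by
    intro i k
    induction k with
    | zero =>
      intro N c x hN hc
      simp only [Nat.cast_zero, zero_mul, zero_add, expectAfter]
      split_ifs with h1
      · exact hle hN h1
      · exact hle hN hc
    | succ k ih =>
      intro N c x hN hc
      rcases N with _ | N
      · rw [lifetime]
        refine le_trans (hγpow hc) (le_add_right ?_)
        push_cast
        rw [add_mul, one_mul]
        exact le_add_self
      · rw [lifetime, expectAfter]
        calc w c + ∑' v, p v * lifetime p w N ((x + v) ::ₘ c) (x + v)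
            ≤ γ ^ i + ∑' v, p v * (k * γ ^ i + expectAfter p
              (fun c' => if i < numMulti h c' then a (i + 1) else a i) k
                ((x + v) ::ₘ c) (x + v)) := by
              refine add_le_add (hγpow hc) (ENNReal.tsum_le_tsum fun v => ?_)
              gcongr
              exact ih _ _ _ (by omega) (hc.trans (numMulti_mono h (Multiset.le_cons_self _ _)))
          _ = _ := by
              simp only [mul_add, ENNReal.tsum_add]
              rw [ENNReal.tsum_mul_right, hp]
              push_cast
              ring
  -- With more than `i` sites, `a (i + 1)` already bounds the lifetime. With exactly `i`, a new site
  -- appears within `b i` steps with probability at least `δ`, and solving the resulting inequality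
  -- for `a i` gives the recursion.
  have hrec : ∀ i, a i ≤ (b i : ℝ≥0∞) * γ ^ i * δ⁻¹ + a (i + 1) := fun i => by
    have h1 : a i ≤ max (a (i + 1)) ((b i : ℝ≥0∞) * γ ^ i + (δ * a (i + 1) + (1 - δ) * a i)) := by
      refine iSup_le fun N => iSup_le fun hN => iSup_le fun c => iSup_le fun hc => iSup_le fun x => ?_
      rcases hc.lt_or_eq with hc' | hc'
      · exact le_max_of_le_left (hle hN hc')
      · refine le_max_of_le_right ((hmark i (b i) N c x hN hc).trans ?_)
        gcongr
        have e1 : (fun c' : Multiset A => if i < numMulti h c' then a (i + 1) else a i) = fun c' =>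
            a (i + 1) * (if i < numMulti h c' then 1 else 0) +
              a i * (if i < numMulti h c' then 0 else 1) := by
          ext c'
          split_ifs <;> simp
        have e2 := expectAfter_one hp (b i) c x
        have e3 : (fun _ : Multiset A => (1 : ℝ≥0∞)) = fun c' =>
            (if i < numMulti h c' then 1 else 0) + (if i < numMulti h c' then 0 else 1) := by
          ext c'
          split_ifs <;> simp
        rw [e3, expectAfter_add] at e2
        rw [e1, expectAfter_add, expectAfter_mul, expectAfter_mul]
        have e4 := hδ c x
        rw [← hc'] at e4
        change δ ≤ expectAfter p _ (b i) c x at e4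
        set s := expectAfter p (fun c' => if i < numMulti h c' then 1 else 0) (b i) c x
        set f := expectAfter p (fun c' => if i < numMulti h c' then 0 else 1) (b i) c x
        obtain ⟨s', hs'⟩ := exists_add_of_le e4
        have e5 : s' + f = 1 - δ := by
          refine ENNReal.eq_sub_of_add_eq hδt ?_
          rw [← e2, hs']
          ring
        calc a (i + 1) * s + a i * f = δ * a (i + 1) + (s' * a (i + 1) + f * a i) := by
              rw [hs']; ring
          _ ≤ δ * a (i + 1) + (s' * a i + f * a i) := by gcongr; exact hanti i
          _ = _ := by rw [← add_mul, e5]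
    rcases le_max_iff.1 h1 with h2 | h2
    · exact h2.trans le_add_self
    · have h3 : δ * a i + (1 - δ) * a i ≤ (b i : ℝ≥0∞) * γ ^ i + δ * a (i + 1) + (1 - δ) * a i := by
        rw [← add_mul, add_tsub_cancel_of_le hδ1, one_mul, add_assoc]
        exact h2
      have h4 := (ENNReal.add_le_add_iff_right
        (ENNReal.mul_ne_top (by simp) (hat i))).1 h3
      calc a i = δ⁻¹ * (δ * a i) := by
            rw [← mul_assoc, ENNReal.inv_mul_cancel hδ0 hδt, one_mul]
        _ ≤ δ⁻¹ * ((b i : ℝ≥0∞) * γ ^ i + δ * a (i + 1)) := by gcongr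
        _ = _ := by
            rw [mul_add, ← mul_assoc δ⁻¹ δ, ENNReal.inv_mul_cancel hδ0 hδt, one_mul, mul_comm δ⁻¹]
  have hiter : ∀ n, a 0 ≤ ∑ i ∈ Finset.range n, (b i : ℝ≥0∞) * γ ^ i * δ⁻¹ + a n := fun n => by
    induction n with
    | zero => simp
    | succ n ih =>
      rw [Finset.sum_range_succ, add_assoc]
      exact ih.trans (by gcongr; exact hrec n)
  have hlim : Filter.Tendsto (fun n : ℕ => ∑' i : ℕ, (b i : ℝ≥0∞) * γ ^ i * δ⁻¹ +
      ((N₀ : ℝ≥0∞) + 1) * γ ^ n) Filter.atTop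
      (nhds (∑' i : ℕ, (b i : ℝ≥0∞) * γ ^ i * δ⁻¹ + ((N₀ : ℝ≥0∞) + 1) * 0)) :=
    (ENNReal.Tendsto.const_mul (ENNReal.tendsto_pow_atTop_nhds_zero_of_lt_one hγ)
      (Or.inr (by simp))).const_add _
  rw [mul_zero, add_zero] at hlim
  refine (hle le_rfl (Nat.zero_le _)).trans (ge_of_tendsto' hlim fun n => (hiter n).trans ?_)
  exact add_le_add (ENNReal.sum_le_tsum _) (ha_le n)

end Lifetime

/-! ### Separating levels of a path -/

namespace SitePath

variable {d : ℕ}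

/-! ### First times and survival. -/

theorem coe_lt_sInf_image {S : Set ℕ} {K : ℕ} :
    (K : ℕ∞) < sInf ((fun t : ℕ => (t : ℕ∞)) '' S) ↔ ∀ t ∈ S, K < t := by
  rw [← ENat.add_one_le_iff (ENat.natCast_ne_top K), le_sInf_iff]
  simp only [Set.mem_image, forall_exists_index, and_imp, forall_apply_eq_imp_iff₂]
  refine forall₂_congr fun t _ => ?_
  rw [ENat.add_one_le_iff (ENat.natCast_ne_top K), Nat.cast_lt]

theorem sInf_image_le_coe {S : Set ℕ} {K : ℕ} :
    sInf ((fun t : ℕ => (t : ℕ∞)) '' S) ≤ K ↔ ∃ t ∈ S, t ≤ K := by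
  rw [← not_lt, coe_lt_sInf_image]
  push Not
  rfl

theorem sInf_image_eq_coe {S : Set ℕ} {K : ℕ} :
    sInf ((fun t : ℕ => (t : ℕ∞)) '' S) = K ↔ K ∈ S ∧ ∀ t < K, t ∉ S := by
  constructor
  · intro h
    obtain ⟨t, ht, htK⟩ := sInf_image_le_coe.1 h.le
    have h2 : ∀ t < K, t ∉ S := fun t htK ht => by
      have : (t : ℕ∞) < sInf ((fun t : ℕ => (t : ℕ∞)) '' S) := by rw [h]; exact_mod_cast htK
      exact lt_irrefl _ (coe_lt_sInf_image.1 this t ht)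
    rcases htK.lt_or_eq with h3 | rfl
    · exact absurd ht (h2 t h3)
    · exact ⟨ht, h2⟩
  · rintro ⟨h1, h2⟩
    refine le_antisymm (sInf_image_le_coe.2 ⟨K, h1, le_rfl⟩) ?_
    refine le_sInf ?_
    rintro _ ⟨t, ht, rfl⟩
    by_contra h
    push Not at h
    exact h2 t (by exact_mod_cast h) ht

theorem sInf_image_lt_top {S : Set ℕ} :
    sInf ((fun t : ℕ => (t : ℕ∞)) '' S) < ⊤ ↔ ∃ t, t ∈ S := by
  constructor
  · intro h
    obtain ⟨K, hK⟩ := ENat.ne_top_iff_exists.1 h.ne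
    exact ⟨K, (sInf_image_eq_coe.1 hK.symm).1⟩
  · rintro ⟨t, ht⟩
    exact (sInf_image_le_coe.2 ⟨t, ht, le_rfl⟩).trans_lt (ENat.natCast_lt_top t)

theorem visits_succ (y : ℕ → Site d) (t : ℕ) (x : Site d) :
    visits y (t + 1) x = visits y t x + if y (t + 1) = x then 1 else 0 := by
  rw [visits, visits, Finset.range_add_one, Finset.filter_insert]
  split_ifs with h
  · rw [Finset.card_insert_of_notMem (by simp)]
  · rfl

/-- A limit is first exceeded at a visit of the site concerned, and counts never decrease. So
survival until `K` depends only on the total counts at `K`, not on the order of the visits. -/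
theorem coe_lt_death_iff {y : ℕ → Site d} {h : Site d → ℕ∞} {K : ℕ} :
    (K : ℕ∞) < death y h ↔ ∀ j ≤ K, (visits y K (y j) : ℕ∞) ≤ h (y j) := by
  rw [death, coe_lt_sInf_image]
  have h1 : (∀ t ∈ {t : ℕ | h (y t) < (visits y t (y t) : ℕ∞)}, K < t) ↔
      ∀ t ≤ K, (visits y t (y t) : ℕ∞) ≤ h (y t) := by
    refine forall_congr' fun t => ?_
    simp only [Set.mem_ofPred_eq]
    rw [← not_imp_not, not_lt, not_lt]
  rw [h1]
  clear h1
  induction K with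
  | zero => simp
  | succ K ih =>
    have h2 : (∀ t ≤ K + 1, (visits y t (y t) : ℕ∞) ≤ h (y t)) ↔
        (∀ t ≤ K, (visits y t (y t) : ℕ∞) ≤ h (y t)) ∧
          (visits y (K + 1) (y (K + 1)) : ℕ∞) ≤ h (y (K + 1)) := by
      constructor
      · exact fun H => ⟨fun t ht => H t (by omega), H _ le_rfl⟩
      · rintro ⟨H1, H2⟩ t ht
        rcases Nat.lt_or_eq_of_le ht with h3 | rfl
        · exact H1 t (by omega)
        · exact H2
    refine h2.trans ((and_congr ih Iff.rfl).trans ?_)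
    constructor
    · rintro ⟨H1, H2⟩ j hj
      by_cases hy : y (K + 1) = y j
      · rw [← hy]; exact H2
      · rw [visits_succ, if_neg hy, add_zero]
        refine H1 j ?_
        rcases Nat.lt_or_eq_of_le hj with h3 | rfl
        · omega
        · exact absurd rfl hy
    · intro H
      refine ⟨fun j hj => le_trans ?_ (H j (by omega)), H _ le_rfl⟩
      rw [visits_succ]
      exact_mod_cast Nat.le_add_right _ _

/-! ### First visits and shifted paths. -/

/-- The path after time `K`, relative to its state at that time. -/
def shift (K : ℕ) (y : ℕ → Site d) (t : ℕ) : Site d := y (K + t) - y K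

@[simp] theorem shift_zero (K : ℕ) (y : ℕ → Site d) : shift K y 0 = 0 := by simp [shift]

variable [NeZero d]

theorem hit_eq_coe {n : ℕ} {y : ℕ → Site d} {K : ℕ} :
    hit n y = K ↔ (n : ℤ) ≤ y K 0 ∧ ∀ t < K, y t 0 < (n : ℤ) := by
  rw [hit, sInf_image_eq_coe]
  simp

theorem hit_lt_top {n : ℕ} {y : ℕ → Site d} : hit n y < ⊤ ↔ ∃ t, (n : ℤ) ≤ y t 0 := by
  rw [hit, sInf_image_lt_top]
  rfl

theorem exists_hit_eq {n : ℕ} {y : ℕ → Site d} (h : hit n y < ⊤) : ∃ K : ℕ, hit n y = K := by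
  obtain ⟨K, hK⟩ := ENat.ne_top_iff_exists.1 h.ne
  exact ⟨K, hK.symm⟩

/-- The path `y` reaches the level `j` at time `K` for the first time, without jumping over it. -/
def FirstAt (j K : ℕ) (y : ℕ → Site d) : Prop := (∀ t < K, y t 0 < (j : ℤ)) ∧ y K 0 = (j : ℤ)

theorem FirstAt.hit_eq {j K : ℕ} {y : ℕ → Site d} (h : FirstAt j K y) : hit j y = K :=
  hit_eq_coe.2 ⟨h.2.ge, h.1⟩

/-- Once `n` is reached, all relevant times are natural numbers; this form is the one that can be
shifted and restricted. -/
theorem isSep_iff {n : ℕ} {y : ℕ → Site d} {N : ℕ} (hN : hit n y = N) {k : ℕ} :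
    IsSep n y k ↔ k ≤ n ∧ ∃ T ≤ N, FirstAt k T y ∧ ∀ t, T < t → t < N → (k : ℤ) ≤ y t 0 := by
  constructor
  · rintro ⟨h1, h2, h3, h4, h5⟩
    refine ⟨h1, ?_⟩
    have hN' := hit_eq_coe.1 hN
    have h6 : hit k y < ⊤ := hit_lt_top.2 ⟨N, le_trans (by exact_mod_cast h1) hN'.1⟩
    obtain ⟨T, hT⟩ := exists_hit_eq h6
    rw [hT, ENat.toNat_natCast] at h4
    refine ⟨T, ?_, ⟨fun t ht => h3 t (by rw [hT]; exact_mod_cast ht), h4⟩, fun t ht htN => ?_⟩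
    · by_contra hcon
      push Not at hcon
      have := (hit_eq_coe.1 hT).2 N hcon
      have h7 : (k : ℤ) ≤ n := by exact_mod_cast h1
      linarith [hN'.1]
    · exact h5 t (by rw [hT]; exact_mod_cast ht) (by rw [hN]; exact_mod_cast htN)
  · rintro ⟨h1, T, -, hT, h2⟩
    refine ⟨h1, by rw [hN]; exact ENat.natCast_lt_top N, fun t ht => ?_, ?_, fun t ht htN => ?_⟩
    · rw [hT.hit_eq] at ht
      exact hT.1 t (by exact_mod_cast ht)
    · rw [hT.hit_eq, ENat.toNat_natCast]; exact hT.2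
    · rw [hT.hit_eq] at ht
      rw [hN] at htN
      exact h2 t (by exact_mod_cast ht) (by exact_mod_cast htN)

/-- The path `y` reaches the level `n` at time `N`, and does not leave the half-space before. -/
def StaysUntil (n N : ℕ) (y : ℕ → Site d) : Prop := hit n y = N ∧ ∀ t ≤ N, 0 ≤ y t 0

theorem hit_shift {j K : ℕ} {y : ℕ → Site d} (h : FirstAt j K y) {i k : ℕ} :
    hit (j + i) y = ((K + k : ℕ) : ℕ∞) ↔ hit i (shift K y) = k := by
  rw [hit_eq_coe, hit_eq_coe]
  simp only [shift, Pi.sub_apply, h.2]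
  constructor
  · rintro ⟨h1, h2⟩
    push_cast at h1 h2
    refine ⟨by linarith, fun t ht => ?_⟩
    have := h2 (K + t) (by omega)
    linarith
  · rintro ⟨h1, h2⟩
    push_cast
    refine ⟨by linarith, fun t ht => ?_⟩
    rcases Nat.lt_or_ge t K with h3 | h3
    · have := h.1 t h3
      have h4 : (0 : ℤ) ≤ i := by positivity
      linarith
    · obtain ⟨s, rfl⟩ := Nat.exists_eq_add_of_le h3
      have := h2 s (by omega)
      linarith

theorem exists_hit_shift {j K : ℕ} {y : ℕ → Site d} (h : FirstAt j K y) {i N : ℕ}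
    (hN : hit (j + i) y = N) : ∃ k, N = K + k := by
  refine Nat.exists_eq_add_of_le ?_
  by_contra hcon
  push Not at hcon
  have h1 := h.1 N hcon
  have h2 := (hit_eq_coe.1 hN).1
  push_cast at h2
  have h4 : (0 : ℤ) ≤ i := by positivity
  linarith

/-- A level is separating iff the path has not been there before, and stays in the half-space
above that level from then on. -/
theorem isSep_add_iff {j i : ℕ} {y : ℕ → Site d} {N : ℕ} (hN : hit (j + i) y = N) :
    IsSep (j + i) y j ↔ ∃ K k, N = K + k ∧ FirstAt j K y ∧ StaysUntil i k (shift K y) := by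
  rw [isSep_iff hN]
  constructor
  · rintro ⟨-, K, hKN, hK, h2⟩
    obtain ⟨k, rfl⟩ := Nat.exists_eq_add_of_le hKN
    have hk := (hit_shift hK).1 hN
    refine ⟨K, k, rfl, hK, hk, fun t ht => ?_⟩
    rcases Nat.lt_or_eq_of_le ht with h3 | rfl
    · rcases Nat.eq_zero_or_pos t with rfl | h4
      · simp
      · have := h2 (K + t) (by omega) (by omega)
        simp only [shift, Pi.sub_apply, hK.2]
        linarith
    · exact le_trans (by positivity) (hit_eq_coe.1 hk).1
  · rintro ⟨K, k, rfl, hK, hk, h2⟩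
    refine ⟨by omega, K, by omega, hK, fun t ht htN => ?_⟩
    obtain ⟨s, rfl⟩ := Nat.exists_eq_add_of_le ht.le
    have := h2 s (by omega)
    simp only [shift, Pi.sub_apply, hK.2] at this
    linarith

theorem IsSep.hit_lt_top {n k : ℕ} {y : ℕ → Site d} (h : IsSep n y k) : hit n y < ⊤ := h.2.1

theorem IsSep.exists_firstAt {n k : ℕ} {y : ℕ → Site d} (h : IsSep n y k) :
    ∃ T, FirstAt k T y := by
  obtain ⟨N, hN⟩ := exists_hit_eq h.hit_lt_top
  obtain ⟨-, T, -, hT, -⟩ := (isSep_iff hN).1 h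
  exact ⟨T, hT⟩

/-- Below a separating level, the separating levels are those of the path up to that level. -/
theorem isSep_restrict {n j k : ℕ} {y : ℕ → Site d} (hj : IsSep n y j) (hk : k ≤ j) :
    IsSep n y k ↔ IsSep j y k := by
  obtain ⟨N, hN⟩ := exists_hit_eq hj.hit_lt_top
  obtain ⟨hjn, S, hSN, hS, h1⟩ := (isSep_iff hN).1 hj
  have hk' : (k : ℤ) ≤ j := by exact_mod_cast hk
  rw [isSep_iff hN, isSep_iff hS.hit_eq]
  constructor
  · rintro ⟨h2, T, hTN, hT, h3⟩
    refine ⟨hk, T, ?_, hT, fun t ht htS => h3 t ht (by omega)⟩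
    by_contra hcon
    push Not at hcon
    have := hT.1 S hcon
    linarith [hS.2]
  · rintro ⟨-, T, hTS, hT, h3⟩
    refine ⟨hk.trans hjn, T, hTS.trans hSN, hT, fun t ht htN => ?_⟩
    rcases lt_trichotomy t S with h4 | rfl | h4
    · exact h3 t ht h4
    · linarith [hS.2]
    · linarith [h1 t h4 htN]

/-- Above a separating level, the separating levels are those of the shifted path. -/
theorem isSep_shift {j i K r : ℕ} {y : ℕ → Site d} (hK : FirstAt j K y) :
    IsSep (j + i) y (j + r) ↔ IsSep i (shift K y) r := by
  by_cases htop : hit (j + i) y < ⊤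
  · obtain ⟨N, hN⟩ := exists_hit_eq htop
    obtain ⟨k, rfl⟩ := exists_hit_shift hK hN
    have hk := (hit_shift hK).1 hN
    have hf : ∀ T, FirstAt (j + r) (K + T) y ↔ FirstAt r T (shift K y) := fun T => by
      simp only [FirstAt, shift, Pi.sub_apply, hK.2]
      push_cast
      constructor
      · rintro ⟨h1, h2⟩
        exact ⟨fun t ht => by linarith [h1 (K + t) (by omega)], by linarith⟩
      · rintro ⟨h1, h2⟩
        refine ⟨fun t ht => ?_, by linarith⟩
        rcases Nat.lt_or_ge t K with h3 | h3
        · have h4 : (0 : ℤ) ≤ r := by positivity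
          linarith [hK.1 t h3]
        · obtain ⟨s, rfl⟩ := Nat.exists_eq_add_of_le h3
          linarith [h1 s (by omega)]
    rw [isSep_iff hN, isSep_iff hk]
    refine and_congr (by omega) ?_
    constructor
    · rintro ⟨T, hTN, hT, h1⟩
      obtain ⟨s, rfl⟩ := exists_hit_shift hK (i := r) hT.hit_eq
      refine ⟨s, by omega, (hf s).1 hT, fun t ht htk => ?_⟩
      have := h1 (K + t) (by omega) (by omega)
      simp only [shift, Pi.sub_apply, hK.2]
      push_cast at this
      linarith
    · rintro ⟨s, hsk, hs, h1⟩
      refine ⟨K + s, by omega, (hf s).2 hs, fun t ht htk => ?_⟩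
      obtain ⟨u, rfl⟩ := Nat.exists_eq_add_of_le (show K ≤ t by omega)
      have := h1 u (by omega) (by omega)
      simp only [shift, Pi.sub_apply, hK.2] at this
      push_cast
      linarith
  · constructor
    · intro h; exact absurd h.hit_lt_top htop
    · intro h
      obtain ⟨k, hk⟩ := exists_hit_eq h.hit_lt_top
      exact absurd (by rw [(hit_shift hK).2 hk]; exact ENat.natCast_lt_top _) htop

/-! ### Initial blocks and blocks. -/

/-- The level `n` is the only `n`-separating level. -/
def IsInit (n : ℕ) (y : ℕ → Site d) : Prop := IsSep n y n ∧ ∀ i < n, ¬ IsSep n y i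

/-- The levels `0` and `n` are the only `n`-separating levels, and they are different. -/
def IsBlock (n : ℕ) (y : ℕ → Site d) : Prop :=
  0 < n ∧ IsSep n y 0 ∧ IsSep n y n ∧ ∀ i, 0 < i → i < n → ¬ IsSep n y i

/-- Whether a level is separating is decided before `n` is passed. Hence the block events are
countable unions over finite trajectories. -/
theorem IsSep.congr {n k N : ℕ} {y y' : ℕ → Site d} (hN : hit n y = N)
    (h : ∀ t ≤ N, y t = y' t) (hs : IsSep n y k) : IsSep n y' k := by
  have hN' : hit n y' = N := by
    rw [hit_eq_coe] at hN ⊢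
    rw [← h N le_rfl]
    exact ⟨hN.1, fun t ht => by rw [← h t ht.le]; exact hN.2 t ht⟩
  rw [isSep_iff hN] at hs
  rw [isSep_iff hN']
  obtain ⟨h1, T, hTN, hT, h2⟩ := hs
  refine ⟨h1, T, hTN, ⟨fun t ht => ?_, ?_⟩, fun t ht htN => ?_⟩
  · rw [← h t (by omega)]; exact hT.1 t ht
  · rw [← h T hTN]; exact hT.2
  · rw [← h t htN.le]; exact h2 t ht htN

theorem hit_congr {n N : ℕ} {y y' : ℕ → Site d} (h : ∀ t ≤ N, y t = y' t) (hN : hit n y = N) :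
    hit n y' = N := by
  rw [hit_eq_coe] at hN ⊢
  rw [← h N le_rfl]
  exact ⟨hN.1, fun t ht => by rw [← h t ht.le]; exact hN.2 t ht⟩

theorem isSep_congr {n k N : ℕ} {y y' : ℕ → Site d} (hN : hit n y = N)
    (h : ∀ t ≤ N, y t = y' t) : IsSep n y k ↔ IsSep n y' k :=
  ⟨fun hs => hs.congr hN h, fun hs => hs.congr (hit_congr h hN) fun t ht => (h t ht).symm⟩

theorem IsInit.congr {n N : ℕ} {y y' : ℕ → Site d} (hN : hit n y = N)
    (h : ∀ t ≤ N, y t = y' t) (hs : IsInit n y) : IsInit n y' :=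
  ⟨hs.1.congr hN h, fun i hi => by rw [← isSep_congr hN h]; exact hs.2 i hi⟩

theorem IsBlock.congr {n N : ℕ} {y y' : ℕ → Site d} (hN : hit n y = N)
    (h : ∀ t ≤ N, y t = y' t) (hs : IsBlock n y) : IsBlock n y' :=
  ⟨hs.1, hs.2.1.congr hN h, hs.2.2.1.congr hN h, fun i hi hin => by
    rw [← isSep_congr hN h]; exact hs.2.2.2 i hi hin⟩

theorem FirstAt.congr {n N : ℕ} {y y' : ℕ → Site d} (h : ∀ t ≤ N, y t = y' t)
    (hs : FirstAt n N y) : FirstAt n N y' :=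
  ⟨fun t ht => by rw [← h t ht.le]; exact hs.1 t ht, by rw [← h N le_rfl]; exact hs.2⟩

theorem StaysUntil.congr {n N : ℕ} {y y' : ℕ → Site d} (h : ∀ t ≤ N, y t = y' t)
    (hs : StaysUntil n N y) : StaysUntil n N y' :=
  ⟨hit_congr h hs.1, fun t ht => by rw [← h t ht]; exact hs.2 t ht⟩

/-- A path from the origin meets level `0` at time `0`, so the separation of this level says that
the half-space is not left. -/
theorem IsBlock.staysUntil {n N : ℕ} {y : ℕ → Site d} (hy : y 0 = 0) (hN : hit n y = N)
    (hs : IsBlock n y) : StaysUntil n N y := by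
  refine ⟨hN, fun t ht => ?_⟩
  have h1 := hs.2.1
  rw [← Nat.zero_add n] at h1 hN
  obtain ⟨K, k, rfl, hK, hk⟩ := (isSep_add_iff hN).1 h1
  have hK0 : K = 0 := by
    by_contra hne
    have := hK.1 0 (Nat.pos_of_ne_zero hne)
    rw [hy] at this
    simp at this
  subst hK0
  have := hk.2 t (by omega)
  simpa [shift, hy] using this

theorem IsInit.firstAt {n N : ℕ} {y : ℕ → Site d} (hN : hit n y = N) (hs : IsInit n y) :
    FirstAt n N y := by
  obtain ⟨T, hT⟩ := hs.1.exists_firstAt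
  have := hT.hit_eq
  rw [hN] at this
  have : N = T := by exact_mod_cast this
  rwa [this]

/-! ### Skip-free paths and the counting functionals. -/

/-- A path that starts at a nonpositive height and whose height is skip-free upwards. -/
def SkipFree (y : ℕ → Site d) : Prop := y 0 0 ≤ 0 ∧ ∀ t, y (t + 1) 0 ≤ y t 0 + 1

theorem SkipFree.firstAt {y : ℕ → Site d} (h : SkipFree y) {n N : ℕ} (hN : hit n y = N) :
    FirstAt n N y := by
  rw [hit_eq_coe] at hN
  refine ⟨hN.2, le_antisymm ?_ hN.1⟩
  rcases N with _ | N
  · exact h.1.trans (by positivity)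
  · have h1 := hN.2 N (by omega)
    have h2 := h.2 N
    omega

theorem SkipFree.isSep_self {y : ℕ → Site d} (h : SkipFree y) {n : ℕ} (hn : hit n y < ⊤) :
    IsSep n y n := by
  obtain ⟨N, hN⟩ := exists_hit_eq hn
  exact (isSep_iff hN).2 ⟨le_rfl, N, le_rfl, h.firstAt hN, fun t ht htN => by omega⟩

-- Skip-freeness makes `n` itself separating, so if there is only one separating level it is `n`.
open Classical in
theorem eta_eq_zero_iff {y : ℕ → Site d} (h : SkipFree y) {n : ℕ} (hn : hit n y < ⊤) :
    eta n y = 0 ↔ IsInit n y := by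
  have hself := h.isSep_self hn
  have hmem : n ∈ (Finset.range (n + 1)).filter fun k => IsSep n y k := by simp [hself]
  rw [eta, sub_eq_zero]
  constructor
  · intro h1
    have h2 : ((Finset.range (n + 1)).filter fun k => IsSep n y k).card = 1 := by exact_mod_cast h1
    obtain ⟨a, ha⟩ := Finset.card_eq_one.1 h2
    refine ⟨hself, fun i hi hs => ?_⟩
    have h3 : i ∈ (Finset.range (n + 1)).filter fun k => IsSep n y k := by
      simp only [Finset.mem_filter, Finset.mem_range]
      exact ⟨by omega, hs⟩
    rw [ha, Finset.mem_singleton] at h3 hmem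
    omega
  · intro h1
    have h2 : (Finset.range (n + 1)).filter (fun k => IsSep n y k) = {n} := by
      ext i
      simp only [Finset.mem_filter, Finset.mem_range, Finset.mem_singleton]
      constructor
      · rintro ⟨h3, h4⟩
        by_contra h5
        exact h1.2 i (by omega) h4
      · rintro rfl
        exact ⟨by omega, hself⟩
    rw [h2]
    simp

-- Skip-freeness is not needed here: below `n` only level `0` is separating, so the second
-- separating level has to be `n`.
open Classical in
theorem eta_kappa_iff {n : ℕ} {y : ℕ → Site d} :
    (1 ≤ eta n y ∧ kappa n y = ((0 : ℕ) : WithBot ℕ)) ↔ IsBlock n y := by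
  have hk : kappa n y = ((0 : ℕ) : WithBot ℕ) ↔
      0 < n ∧ IsSep n y 0 ∧ ∀ i, 0 < i → i < n → ¬ IsSep n y i := by
    rw [kappa]
    constructor
    · intro h
      have h1 := Finset.mem_of_max h
      simp only [Finset.mem_filter, Finset.mem_range] at h1
      refine ⟨h1.1, h1.2, fun i hi hin hs => ?_⟩
      have h2 := Finset.le_max (s := (Finset.range n).filter fun k => IsSep n y k) (a := i)
        (by simp [hin, hs])
      rw [h] at h2
      have h3 : i ≤ 0 := WithBot.coe_le_coe.1 h2
      omega
    · rintro ⟨h1, h2, h3⟩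
      refine le_antisymm (Finset.max_le fun i hi => ?_) (Finset.le_max (by simp [h1, h2]))
      simp only [Finset.mem_filter, Finset.mem_range] at hi
      by_contra h4
      have h5 : 0 < i := by
        by_contra h6
        have h7 : i = 0 := by omega
        subst h7
        exact h4 le_rfl
      exact h3 i h5 hi.1 hi.2
  rw [hk]
  constructor
  · rintro ⟨h1, h2, h3, h4⟩
    refine ⟨h2, h3, ?_, h4⟩
    by_contra h5
    have h6 : (Finset.range (n + 1)).filter (fun k => IsSep n y k) ⊆ {0} := fun i hi => by
      simp only [Finset.mem_filter, Finset.mem_range] at hi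
      rw [Finset.mem_singleton]
      by_contra h7
      rcases Nat.lt_or_eq_of_le (Nat.lt_succ_iff.1 hi.1) with h8 | h8
      · exact h4 i (by omega) h8 hi.2
      · subst h8; exact h5 hi.2
    have h7 := Finset.card_le_card h6
    rw [Finset.card_singleton] at h7
    rw [eta] at h1
    omega
  · rintro ⟨h1, h2, h3, h4⟩
    refine ⟨?_, h1, h2, h4⟩
    have h6 : ({0, n} : Finset ℕ) ⊆ (Finset.range (n + 1)).filter (fun k => IsSep n y k) := by
      intro i hi
      simp only [Finset.mem_insert, Finset.mem_singleton] at hi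
      simp only [Finset.mem_filter, Finset.mem_range]
      rcases hi with rfl | rfl
      · exact ⟨by omega, h2⟩
      · exact ⟨by omega, h3⟩
    have h7 := Finset.card_le_card h6
    rw [Finset.card_pair (by omega)] at h7
    rw [eta]
    omega

theorem kappaStar_eq_zero_iff {n : ℕ} {y : ℕ → Site d} {h : Site d → ℕ∞} :
    kappaStar n y h = ((0 : ℕ) : WithBot ℕ) ↔ hit n y < death y h ∧ IsBlock n y := by
  rw [← eta_kappa_iff, kappaStar, etaStar]
  by_cases h1 : hit n y < death y h
  · simp only [h1, if_true, true_and]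
    by_cases h2 : 1 ≤ eta n y
    · simp [h2]
    · simp [h2]
  · simp [h1]

theorem etaStar_eq_zero_iff {y : ℕ → Site d} (hy : SkipFree y) {n : ℕ} {h : Site d → ℕ∞} :
    etaStar n y h = 0 ↔ hit n y < death y h ∧ IsInit n y := by
  rw [etaStar]
  by_cases h1 : hit n y < death y h
  · rw [if_pos h1, eta_eq_zero_iff hy h1.lt_top]
    simp [h1]
  · simp [h1]

end SitePath

/-! ### Decomposition of a path into blocks -/

namespace SitePath

variable {d : ℕ} [NeZero d]

theorem firstAt_shift {j r K T : ℕ} {y : ℕ → Site d} (hK : FirstAt j K y) :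
    FirstAt (j + r) (K + T) y ↔ FirstAt r T (shift K y) := by
  simp only [FirstAt, shift, Pi.sub_apply, hK.2]
  push_cast
  constructor
  · rintro ⟨h1, h2⟩
    exact ⟨fun t ht => by linarith [h1 (K + t) (by omega)], by linarith⟩
  · rintro ⟨h1, h2⟩
    refine ⟨fun t ht => ?_, by linarith⟩
    rcases Nat.lt_or_ge t K with h3 | h3
    · have h4 : (0 : ℤ) ≤ r := by positivity
      linarith [hK.1 t h3]
    · obtain ⟨s, rfl⟩ := Nat.exists_eq_add_of_le h3
      linarith [h1 s (by omega)]

theorem FirstAt.lt {j j' K K' : ℕ} {y : ℕ → Site d} (h : FirstAt j K y) (h' : FirstAt j' K' y)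
    (hj : j < j') : K < K' := by
  by_contra hcon
  push Not at hcon
  have hj' : (j : ℤ) < j' := by exact_mod_cast hj
  rcases Nat.lt_or_eq_of_le hcon with h1 | rfl
  · linarith [h.1 _ h1, h'.2]
  · linarith [h.2, h'.2]

theorem IsBlock.firstAt {n N : ℕ} {y : ℕ → Site d} (hN : hit n y = N) (hs : IsBlock n y) :
    FirstAt n N y := by
  obtain ⟨T, hT⟩ := hs.2.2.1.exists_firstAt
  have := hT.hit_eq
  rw [hN] at this
  have : N = T := by exact_mod_cast this
  rwa [this]

/-- The path `y` consists of an initial part up to level `L 0` and time `K 0`, and of `m` blocks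
that end at the levels `L i` and the times `K i`. -/
def IsChain (m : ℕ) (L K : ℕ → ℕ) (y : ℕ → Site d) : Prop :=
  hit (L 0) y = K 0 ∧ IsInit (L 0) y ∧
    ∀ i < m, hit (L (i + 1) - L i) (shift (K i) y) = (K (i + 1) - K i : ℕ) ∧
      IsBlock (L (i + 1) - L i) (shift (K i) y)

variable {m : ℕ} {L K : ℕ → ℕ} {y : ℕ → Site d}

theorem IsChain.firstAt (h : IsChain m L K y) (hLK : ∀ i < m, L i < L (i + 1) ∧ K i < K (i + 1)) :
    ∀ i ≤ m, FirstAt (L i) (K i) y := by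
  intro i
  induction i with
  | zero => exact fun _ => h.2.1.firstAt h.1
  | succ i ih =>
    intro hi
    obtain ⟨h1, h2⟩ := h.2.2 i (by omega)
    have h3 := (firstAt_shift (ih (by omega))).2 (h2.firstAt h1)
    obtain ⟨h4, h5⟩ := hLK i (by omega)
    rwa [show L i + (L (i + 1) - L i) = L (i + 1) by omega,
      show K i + (K (i + 1) - K i) = K (i + 1) by omega] at h3

/-- Induction on the last block: levels up to `L m` are decided by the path up to `K m`
(`isSep_restrict`), higher ones by the path shifted by `K m` (`isSep_shift`). -/
theorem IsChain.isSep_iff (h : IsChain m L K y)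
    (hLK : ∀ i < m, L i < L (i + 1) ∧ K i < K (i + 1)) {k : ℕ} :
    IsSep (L m) y k ↔ ∃ i ≤ m, k = L i := by
  induction m generalizing k with
  | zero =>
    constructor
    · intro hk
      refine ⟨0, le_rfl, ?_⟩
      by_contra hne
      exact h.2.1.2 k (by have := hk.1; omega) hk
    · rintro ⟨i, hi, rfl⟩
      obtain rfl : i = 0 := by omega
      exact h.2.1.1
  | succ m ih =>
    have hm : IsChain m L K y := ⟨h.1, h.2.1, fun i hi => h.2.2 i (by omega)⟩
    have hF := h.firstAt hLK m (by omega)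
    obtain ⟨hb1, hb2⟩ := h.2.2 m (by omega)
    obtain ⟨h4, h5⟩ := hLK m (by omega)
    have hL : L (m + 1) = L m + (L (m + 1) - L m) := by omega
    have hsep : IsSep (L (m + 1)) y (L m) := by
      have := (isSep_shift (i := L (m + 1) - L m) (r := 0) hF).2 hb2.2.1
      rwa [add_zero, ← hL] at this
    rcases Nat.le_total k (L m) with hk | hk
    · rw [isSep_restrict hsep hk, ih hm fun i hi => hLK i (by omega)]
      constructor
      · rintro ⟨i, hi, rfl⟩; exact ⟨i, by omega, rfl⟩
      · rintro ⟨i, hi, rfl⟩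
        rcases Nat.lt_or_eq_of_le hi with h6 | rfl
        · exact ⟨i, by omega, rfl⟩
        · omega
    · obtain ⟨r, rfl⟩ := Nat.exists_eq_add_of_le hk
      rw [hL, isSep_shift hF]
      constructor
      · intro hr
        rcases Nat.eq_zero_or_pos r with rfl | hr0
        · exact ⟨m, by omega, rfl⟩
        · refine ⟨m + 1, le_rfl, ?_⟩
          by_contra hne
          exact hb2.2.2.2 r hr0 (by have := hr.1; omega) hr
      · rintro ⟨i, hi, hir⟩
        rcases Nat.lt_or_eq_of_le hi with h6 | rfl
        · have h7 : L i ≤ L m := by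
            have := (ih hm (fun i hi => hLK i (by omega))).2 ⟨i, by omega, rfl⟩
            exact this.1
          obtain rfl : r = 0 := by omega
          exact hb2.2.1
        · obtain rfl : r = L (m + 1) - L m := by omega
          exact hb2.2.2.1

theorem strictMonoOn_of_lt_succ {L : ℕ → ℕ} {m : ℕ} (hL : ∀ i < m, L i < L (i + 1)) {i j : ℕ}
    (hij : i < j) (hj : j ≤ m) : L i < L j := by
  induction j with
  | zero => omega
  | succ j ih =>
    have h1 := hL j (by omega)
    rcases Nat.lt_or_eq_of_le (Nat.lt_succ_iff.1 hij) with h2 | rfl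
    · exact (ih h2 (by omega)).trans h1
    · exact h1

/-- The numbers below `L i` with the property are `L 0, …, L (i - 1)`, so `L i` comes at position
`i`. -/
theorem nth_eq_of_forall_iff {p : ℕ → Prop} {L : ℕ → ℕ} {m : ℕ}
    (hL : ∀ i < m, L i < L (i + 1)) (hp : ∀ k, p k ↔ ∃ i ≤ m, k = L i) {i : ℕ} (hi : i ≤ m) :
    Nat.nth p i = L i := by
  classical
  have himage : Set.ofPred p = ((Finset.range (m + 1)).image L : Finset ℕ) := by
    ext k
    simp only [Set.mem_ofPred_eq, Finset.coe_image, Set.mem_image, Finset.mem_coe,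
      Finset.mem_range, hp k]
    constructor
    · rintro ⟨j, hj, rfl⟩; exact ⟨j, by omega, rfl⟩
    · rintro ⟨j, hj, rfl⟩; exact ⟨j, by omega, rfl⟩
  have hcount : Nat.count p (L i) = i := by
    rw [Nat.count_eq_card_filter_range]
    have h1 : (Finset.range (L i)).filter p = (Finset.range i).image L := by
      ext k
      simp only [Finset.mem_filter, Finset.mem_range, Finset.mem_image, hp k]
      constructor
      · rintro ⟨h1, j, hj, rfl⟩
        refine ⟨j, ?_, rfl⟩
        by_contra hcon
        rcases Nat.lt_or_eq_of_le (not_lt.1 hcon) with h2 | rfl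
        · have := strictMonoOn_of_lt_succ hL h2 hj
          omega
        · omega
      · rintro ⟨j, hj, rfl⟩
        exact ⟨strictMonoOn_of_lt_succ hL hj hi, j, by omega, rfl⟩
    rw [h1, Finset.card_image_of_injOn, Finset.card_range]
    intro a ha b hb hab
    simp only [Finset.coe_range, Set.mem_Iio] at ha hb
    rcases lt_trichotomy a b with h2 | h2 | h2
    · have := strictMonoOn_of_lt_succ hL h2 (by omega); omega
    · exact h2
    · have := strictMonoOn_of_lt_succ hL h2 (by omega); omega
  have := Nat.nth_count (p := p) ((hp (L i)).2 ⟨i, hi, rfl⟩)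
  rwa [hcount] at this

theorem sepTime_eq (n i : ℕ) {T : ℕ} (h : FirstAt (nu n y i) T y) : sepTime n y i = T := by
  rw [sepTime, h.hit_eq, ENat.toNat_natCast]

-- The dictionary between the functionals in the theorem and chains of blocks. Heights and durations
-- are truncated differences; they determine the levels and times one after the other because both
-- are strictly increasing.
open Classical in
theorem isChain_iff (hLK : ∀ i < m, L i < L (i + 1) ∧ K i < K (i + 1)) :
    (hit (L m) y < ⊤ ∧ eta (L m) y = m ∧ nu (L m) y 0 = L 0 ∧ hit (nu (L m) y 0) y = K 0 ∧
      ∀ i < m, blockHeight (L m) y i = L (i + 1) - L i ∧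
        blockDuration (L m) y i = K (i + 1) - K i) ↔ IsChain m L K y := by
  have hL : ∀ i < m, L i < L (i + 1) := fun i hi => (hLK i hi).1
  constructor
  · rintro ⟨htop, heta, hnu0, hK0, hbl⟩
    set p := IsSep (L m) y with hp
    have hfilter : (Set.ofPred p) = ((Finset.range (L m + 1)).filter fun k => p k : Finset ℕ) := by
      ext k
      simp only [Set.mem_ofPred_eq, Finset.coe_filter, Finset.mem_range]
      exact ⟨fun h => ⟨Nat.lt_succ_of_le h.1, h⟩, fun h => h.2⟩
    have hf : (Set.ofPred p).Finite := by rw [hfilter]; exact Finset.finite_toSet _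
    have hcard : hf.toFinset.card = m + 1 := by
      have h1 : hf.toFinset = (Finset.range (L m + 1)).filter fun k => p k := by
        ext k
        rw [Set.Finite.mem_toFinset, hfilter, Finset.mem_coe]
      rw [h1]
      have h2 : (((Finset.range (L m + 1)).filter fun k => p k).card : ℤ) - 1 = m := heta
      omega
    have hnuL : ∀ i ≤ m, nu (L m) y i = L i := by
      intro i
      induction i with
      | zero => exact fun _ => hnu0
      | succ i ih =>
        intro hi
        have h1 := (hbl i (by omega)).1
        have h2 : nu (L m) y i < nu (L m) y (i + 1) :=
          Nat.nth_lt_nth_of_lt_card hf (Nat.lt_succ_self i) (by omega)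
        rw [blockHeight, ih (by omega)] at h1
        rw [ih (by omega)] at h2
        have := hL i (by omega)
        omega
    have hsep : ∀ k, IsSep (L m) y k ↔ ∃ i ≤ m, k = L i := fun k => by
      constructor
      · intro hk
        obtain ⟨i, hi, hik⟩ := Nat.exists_lt_card_finite_nth_eq hf hk
        exact ⟨i, by omega, by rw [← hnuL i (by omega)]; exact hik.symm⟩
      · rintro ⟨i, hi, rfl⟩
        rw [← hnuL i hi]
        exact Nat.nth_mem_of_lt_card hf (by omega)
    have hfirst : ∀ i ≤ m, FirstAt (L i) (K i) y := by
      have hex : ∀ i ≤ m, ∃ T, FirstAt (L i) T y := fun i hi =>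
        ((hsep _).2 ⟨i, hi, rfl⟩).exists_firstAt
      intro i
      induction i with
      | zero =>
        intro _
        obtain ⟨T, hT⟩ := hex 0 (Nat.zero_le _)
        have h1 := hT.hit_eq
        rw [hnu0, h1] at hK0
        have : T = K 0 := by exact_mod_cast hK0
        rwa [← this]
      | succ i ih =>
        intro hi
        obtain ⟨T, hT⟩ := hex (i + 1) hi
        have h1 := (hbl i (by omega)).2
        have h2 := ih (by omega)
        rw [blockDuration, sepTime_eq (L m) (i + 1) (by rwa [hnuL _ hi]),
          sepTime_eq (L m) i (by rwa [hnuL _ (by omega)])] at h1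
        have h3 := h2.lt hT (hL i (by omega))
        have h4 := (hLK i (by omega)).2
        have : T = K (i + 1) := by omega
        rwa [← this]
    have hinj : ∀ i ≤ m, ∀ j ≤ m, L i ≤ L j → i ≤ j := fun i hi j hj hij => by
      by_contra hcon
      have := strictMonoOn_of_lt_succ hL (not_le.1 hcon) hi
      omega
    refine ⟨(hfirst 0 (Nat.zero_le _)).hit_eq, ⟨?_, fun i hi hs => ?_⟩, fun i hi => ?_⟩
    · exact (isSep_restrict ((hsep _).2 ⟨0, Nat.zero_le _, rfl⟩) le_rfl).1
        ((hsep _).2 ⟨0, Nat.zero_le _, rfl⟩)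
    · rw [← isSep_restrict ((hsep _).2 ⟨0, Nat.zero_le _, rfl⟩) hi.le, hsep] at hs
      obtain ⟨j, hj, rfl⟩ := hs
      rcases Nat.eq_zero_or_pos j with rfl | hj0
      · omega
      · have := strictMonoOn_of_lt_succ hL hj0 hj
        omega
    · have hFi := hfirst i hi.le
      have hLi := hLK i hi
      have hLm : L i + (L m - L i) = L m := by
        have := ((hsep (L i)).2 ⟨i, hi.le, rfl⟩).1
        omega
      have hs1 : ∀ r, IsSep (L m - L i) (shift (K i) y) r ↔ ∃ j ≤ m, L i + r = L j := fun r => by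
        rw [← isSep_shift hFi, hLm, hsep]
      have hend : IsSep (L m - L i) (shift (K i) y) (L (i + 1) - L i) :=
        (hs1 _).2 ⟨i + 1, hi, by omega⟩
      have hs2 : ∀ r ≤ L (i + 1) - L i, IsSep (L (i + 1) - L i) (shift (K i) y) r ↔
          ∃ j ≤ m, L i + r = L j := fun r hr => by
        rw [← isSep_restrict hend hr, hs1]
      refine ⟨?_, by omega, (hs2 _ (by omega)).2 ⟨i, hi.le, by omega⟩,
        (hs2 _ le_rfl).2 ⟨i + 1, hi, by omega⟩, fun r hr0 hr hs => ?_⟩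
      · refine ((firstAt_shift hFi).1 ?_).hit_eq
        rw [show L i + (L (i + 1) - L i) = L (i + 1) by omega,
          show K i + (K (i + 1) - K i) = K (i + 1) by omega]
        exact hfirst _ hi
      · obtain ⟨j, hj, hjr⟩ := (hs2 r hr.le).1 hs
        have h1 : i < j := by
          by_contra hcon
          rcases Nat.lt_or_eq_of_le (not_lt.1 hcon) with h2 | rfl
          · have := strictMonoOn_of_lt_succ hL h2 hi.le
            omega
          · omega
        have h2 := hinj (i + 1) hi j hj
        rcases Nat.lt_or_eq_of_le h1 with h3 | h3
        · have := strictMonoOn_of_lt_succ hL h3 hj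
          simp only [Nat.succ_eq_add_one] at this
          omega
        · rw [← h3] at hjr
          simp only [Nat.succ_eq_add_one] at hjr
          omega
  · intro h
    have hsep := fun k => h.isSep_iff hLK (k := k)
    have hnuL : ∀ i ≤ m, nu (L m) y i = L i := fun i hi => nth_eq_of_forall_iff hL hsep hi
    have hfirst := h.firstAt hLK
    have htime : ∀ i ≤ m, sepTime (L m) y i = K i := fun i hi =>
      sepTime_eq _ _ (by rw [hnuL i hi]; exact hfirst i hi)
    refine ⟨((hsep _).2 ⟨m, le_rfl, rfl⟩).hit_lt_top, ?_, hnuL 0 (Nat.zero_le _), ?_,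
      fun i hi => ⟨?_, ?_⟩⟩
    · rw [eta]
      have h1 : (Finset.range (L m + 1)).filter (fun k => IsSep (L m) y k) =
          (Finset.range (m + 1)).image L := by
        ext k
        simp only [Finset.mem_filter, Finset.mem_range, Finset.mem_image]
        constructor
        · rintro ⟨-, hk⟩
          obtain ⟨i, hi, rfl⟩ := (hsep k).1 hk
          exact ⟨i, by omega, rfl⟩
        · rintro ⟨i, hi, rfl⟩
          have := (hsep (L i)).2 ⟨i, by omega, rfl⟩
          exact ⟨Nat.lt_succ_of_le this.1, this⟩
      rw [h1, Finset.card_image_of_injOn, Finset.card_range]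
      · push_cast; ring
      · intro a ha b hb hab
        simp only [Finset.coe_range, Set.mem_Iio] at ha hb
        rcases lt_trichotomy a b with h2 | h2 | h2
        · have := strictMonoOn_of_lt_succ hL h2 (by omega); omega
        · exact h2
        · have := strictMonoOn_of_lt_succ hL h2 (by omega); omega
    · rw [hnuL 0 (Nat.zero_le _)]; exact h.1
    · rw [blockHeight, hnuL _ hi, hnuL _ hi.le]
    · rw [blockDuration, htime _ hi, htime _ hi.le]

end SitePath

/-! ### The probabilities of finite paths -/



namespace SitePath

variable {d : ℕ}

/-- The path with initial state `z` and list of increments `l`, constant after the end of `l`. -/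
def listPath (z : Site d) (l : List (Site d)) (t : ℕ) : Site d := z + (l.take t).sum

theorem listPath_zero (z : Site d) (l : List (Site d)) : listPath z l 0 = z := by simp [listPath]

theorem listPath_cons (z v : Site d) (l : List (Site d)) (t : ℕ) :
    listPath z (v :: l) (t + 1) = listPath (z + v) l t := by simp [listPath, add_assoc]

theorem listPath_length (z : Site d) (l : List (Site d)) :
    listPath z l l.length = z + l.sum := by simp [listPath]

theorem listPath_append_left (z : Site d) (l l' : List (Site d)) {t : ℕ} (ht : t ≤ l.length) :
    listPath z (l ++ l') t = listPath z l t := by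
  rw [listPath, listPath, List.take_append_of_le_length ht]

theorem listPath_append_right (z : Site d) (l l' : List (Site d)) (t : ℕ) :
    listPath z (l ++ l') (l.length + t) = listPath (z + l.sum) l' t := by
  rw [listPath, listPath, List.take_length_add_append, List.sum_append, add_assoc]

theorem listPath_eq_add (z : Site d) (l : List (Site d)) (t : ℕ) :
    listPath z l t = z + listPath 0 l t := by simp [listPath]

theorem shift_listPath_append (z : Site d) (l l' : List (Site d)) :
    shift l.length (listPath z (l ++ l')) = listPath 0 l' := by
  ext1 t
  rw [shift, listPath_append_right, listPath_append_left _ _ _ le_rfl, listPath_length,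
    listPath_eq_add, add_sub_cancel_left]

/-- The multiset of the states visited by the finite path with initial state `z` and list of
increments `l`. -/
def trace (z : Site d) (l : List (Site d)) : Multiset (Site d) := z ::ₘ visited z l

theorem visited_eq_map (z : Site d) (l : List (Site d)) :
    visited z l = (Multiset.range l.length).map fun t => listPath z l (t + 1) := by
  induction l generalizing z with
  | nil => simp [visited]
  | cons v l ih =>
    rw [visited, ih, List.length_cons]
    have h : Multiset.range (l.length + 1) = 0 ::ₘ (Multiset.range l.length).map Nat.succ := by
      simp only [Multiset.range, List.range_succ_eq_map]
      rfl
    rw [h, Multiset.map_cons, Multiset.map_map]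
    simp only [Function.comp_def, listPath_cons, listPath_zero]

theorem trace_eq_map (z : Site d) (l : List (Site d)) :
    trace z l = (Multiset.range (l.length + 1)).map (listPath z l) := by
  have h : Multiset.range (l.length + 1) = 0 ::ₘ (Multiset.range l.length).map Nat.succ := by
    simp only [Multiset.range, List.range_succ_eq_map]
    rfl
  rw [trace, visited_eq_map, h, Multiset.map_cons, Multiset.map_map, listPath_zero]
  rfl

theorem mem_trace {z x : Site d} {l : List (Site d)} :
    x ∈ trace z l ↔ ∃ t ≤ l.length, listPath z l t = x := by
  rw [trace_eq_map, Multiset.mem_map]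
  simp only [Multiset.mem_range, Nat.lt_succ_iff]

theorem mem_visited {z x : Site d} {l : List (Site d)} :
    x ∈ visited z l ↔ ∃ t < l.length, listPath z l (t + 1) = x := by
  rw [visited_eq_map, Multiset.mem_map]
  simp only [Multiset.mem_range]

theorem visits_eq_count {y : ℕ → Site d} {z : Site d} {l : List (Site d)}
    (h : ∀ t ≤ l.length, y t = listPath z l t) (x : Site d) :
    visits y l.length x = (trace z l).count x := by
  rw [trace_eq_map, Multiset.count_map, visits, Finset.card_def, Finset.filter_val,
    Finset.range_val]
  congr 1
  refine Multiset.filter_congr fun t ht => ?_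
  rw [h t (Nat.lt_succ_iff.1 (Multiset.mem_range.1 ht)), eq_comm]

theorem visited_map (z e : Site d) (l : List (Site d)) :
    visited (e + z) l = (visited z l).map (e + ·) := by
  induction l generalizing z with
  | nil => simp [visited]
  | cons v l ih => simp [visited, ← ih, add_assoc]

theorem trace_map (e : Site d) (l : List (Site d)) : trace e l = (trace 0 l).map (e + ·) := by
  have := visited_map 0 e l
  rw [add_zero] at this
  simp [trace, this]

theorem trace_append (z : Site d) (l l' : List (Site d)) :
    trace z (l ++ l') = trace z l + visited (z + l.sum) l' := by
  rw [trace, trace, visited_append, Multiset.cons_add]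

end SitePath

/-! ### Weights of finite trajectories. -/

namespace ConstrainedWalk

variable {d : ℕ} {Ω : Type*}

theorem path_zero (W : ConstrainedWalk d Ω) (ω : Ω) : W.path ω 0 = W.S₀ ω := by simp [path]

theorem path_succ (W : ConstrainedWalk d Ω) (ω : Ω) (t : ℕ) :
    W.path ω (t + 1) = W.path ω t + W.ξ t ω := by
  rw [path, path, Finset.sum_range_succ, add_assoc]

/-- The event that the path of the walk begins with the finite path with initial state `z` and
list of increments `l`. -/
def startsWith (W : ConstrainedWalk d Ω) (z : Site d) (l : List (Site d)) : Set Ω :=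
  {ω | W.S₀ ω = z ∧ ∀ t (ht : t < l.length), W.ξ t ω = l[t]}

theorem path_eq_of_startsWith {W : ConstrainedWalk d Ω} {z : Site d} {l : List (Site d)} {ω : Ω}
    (h : ω ∈ W.startsWith z l) {t : ℕ} (ht : t ≤ l.length) : W.path ω t = listPath z l t := by
  induction t with
  | zero => rw [path_zero, listPath_zero, h.1]
  | succ t ih =>
    rw [path_succ, ih (by omega), h.2 t (by omega), listPath, listPath, add_assoc,
      ← List.sum_take_succ]

/-- The list of the increments at the times `K, …, K + k - 1`. -/
def increments (W : ConstrainedWalk d Ω) (ω : Ω) (K k : ℕ) : List (Site d) :=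
  (List.range k).map fun t => W.ξ (K + t) ω

theorem length_increments (W : ConstrainedWalk d Ω) (ω : Ω) (K k : ℕ) :
    (W.increments ω K k).length = k := by simp [increments]

theorem mem_startsWith_increments (W : ConstrainedWalk d Ω) (ω : Ω) (k : ℕ) :
    ω ∈ W.startsWith (W.S₀ ω) (W.increments ω 0 k) :=
  ⟨rfl, fun t ht => by simp [increments]⟩

theorem eq_increments_of_startsWith {W : ConstrainedWalk d Ω} {z : Site d} {l : List (Site d)}
    {ω : Ω} (h : ω ∈ W.startsWith z l) : l = W.increments ω 0 l.length := by
  refine List.ext_getElem (by simp [increments]) fun t ht _ => ?_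
  rw [← h.2 t ht]
  simp [increments]

theorem lt_death_iff {W : ConstrainedWalk d Ω} {z : Site d} {l : List (Site d)} {ω : Ω}
    (h : ω ∈ W.startsWith z l) :
    (l.length : ℕ∞) < death (W.path ω) (W.env ω) ↔
      ∀ x ∈ trace z l, ((trace z l).count x : ℕ∞) ≤ W.H x ω := by
  have h1 := fun t (ht : t ≤ l.length) => path_eq_of_startsWith h ht
  rw [coe_lt_death_iff]
  simp only [visits_eq_count h1, mem_trace, env]
  constructor
  · rintro H x ⟨t, ht, rfl⟩
    have := H t ht
    rwa [h1 t ht] at this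
  · intro H t ht
    rw [h1 t ht]
    exact H _ ⟨t, ht, rfl⟩

variable [NeZero d] [MeasurableSpace Ω] {W : ConstrainedWalk d Ω} {P : Measure Ω}

/-- The distribution of an increment. -/
def stepLaw (W : ConstrainedWalk d Ω) (P : Measure Ω) (v : Site d) : ℝ≥0∞ := P {ω | W.ξ 0 ω = v}

/-- The probability that at least `k` visits to a given site of nonnegative height are allowed. -/
def limitTail (W : ConstrainedWalk d Ω) (P : Measure Ω) (k : ℕ) : ℝ≥0∞ :=
  P {ω | (k : ℕ∞) ≤ W.H 0 ω}

/-- The probability that the environment in the half-space of nonnegative heights allows the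
visits of the multiset `c`. -/
def envWeight (W : ConstrainedWalk d Ω) (P : Measure Ω) (c : Multiset (Site d)) : ℝ≥0∞ :=
  ∏ x ∈ c.toFinset, W.limitTail P (c.count x)

/-- The probability that the initial state is `z` and that the environment allows the visits of
the multiset `c`. -/
def startWeight (W : ConstrainedWalk d Ω) (P : Measure Ω) (z : Site d)
    (c : Multiset (Site d)) : ℝ≥0∞ :=
  P {ω | W.S₀ ω = z ∧ ∀ x ∈ c, (c.count x : ℕ∞) ≤ W.H x ω}

/-- The probability that the walk follows a given finite path, without dying. -/
def pathWeight (W : ConstrainedWalk d Ω) (P : Measure Ω) (z : Site d) (l : List (Site d)) :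
    ℝ≥0∞ :=
  P (W.startsWith z l ∩ {ω | (l.length : ℕ∞) < death (W.path ω) (W.env ω)})

theorem measurableSet_startsWith (h1 : W.A1 P) (h2 : W.A2 P) (z : Site d) (l : List (Site d)) :
    MeasurableSet (W.startsWith z l) := by
  have : W.startsWith z l = {ω | W.S₀ ω = z} ∩
      ⋂ t : ℕ, ⋂ ht : t < l.length, {ω | W.ξ t ω = l[t]} := by
    ext ω
    simp [startsWith]
  rw [this]
  refine (h2.meas_init (measurableSet_singleton z)).inter
    (MeasurableSet.iInter fun t => MeasurableSet.iInter fun ht => ?_)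
  exact h1.meas t (measurableSet_singleton _)

theorem startsWith_inter_alive (z : Site d) (l : List (Site d)) :
    W.startsWith z l ∩ {ω | (l.length : ℕ∞) < death (W.path ω) (W.env ω)} =
      {ω | W.S₀ ω = z ∧ ∀ x ∈ (trace z l).filter (fun x => ¬ 0 ≤ x 0),
        (((trace z l).filter fun x => ¬ 0 ≤ x 0).count x : ℕ∞) ≤ W.H x ω} ∩
      {ω | ∀ t (ht : t < l.length), W.ξ t ω = l[t]} ∩
      {ω | ∀ x ∈ (trace z l).filter (fun x => 0 ≤ x 0),
        (((trace z l).filter fun x => 0 ≤ x 0).count x : ℕ∞) ≤ W.H x ω} := by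
  ext ω
  constructor
  · rintro ⟨h, h'⟩
    have h3 := (lt_death_iff h).1 h'
    refine ⟨⟨⟨h.1, fun x hx => ?_⟩, h.2⟩, fun x hx => ?_⟩
    · rw [Multiset.mem_filter] at hx
      rw [Multiset.count_filter_of_pos (p := fun x : Site d => ¬ 0 ≤ x 0) hx.2]
      exact h3 x hx.1
    · rw [Multiset.mem_filter] at hx
      rw [Multiset.count_filter_of_pos (p := fun x : Site d => 0 ≤ x 0) hx.2]
      exact h3 x hx.1
  · rintro ⟨⟨⟨h, h'⟩, h''⟩, h3⟩
    have hs : ω ∈ W.startsWith z l := ⟨h, h''⟩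
    refine ⟨hs, (lt_death_iff hs).2 fun x hx => ?_⟩
    by_cases h0 : 0 ≤ x 0
    · have := h3 x (Multiset.mem_filter.2 ⟨hx, h0⟩)
      rwa [Multiset.count_filter_of_pos (p := fun x : Site d => 0 ≤ x 0) h0] at this
    · have := h' x (Multiset.mem_filter.2 ⟨hx, h0⟩)
      rwa [Multiset.count_filter_of_pos (p := fun x : Site d => ¬ 0 ≤ x 0) h0] at this

theorem measure_increments_eq (h1 : W.A1 P) (l : List (Site d)) :
    P {ω | ∀ t (ht : t < l.length), W.ξ t ω = l[t]} = (l.map (W.stepLaw P)).prod := by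
  have h := h1.indep.measure_inter_preimage_eq_mul (Finset.range l.length)
    (sets := fun t => {v | ∀ ht : t < l.length, v = l[t]}) (fun t _ => .of_discrete)
  have e1 : (⋂ i ∈ Finset.range l.length, W.ξ i ⁻¹' {v | ∀ ht : i < l.length, v = l[i]}) =
      {ω | ∀ t (ht : t < l.length), W.ξ t ω = l[t]} := by
    ext ω
    simp only [Finset.mem_range, Set.mem_iInter, Set.mem_preimage, Set.mem_ofPred_eq]
    exact ⟨fun H t ht => H t ht ht, fun H t ht _ => H t ht⟩
  rw [← e1, h, Finset.prod_range, ← Fin.prod_univ_fun_getElem]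
  refine Finset.prod_congr rfl fun t _ => ?_
  rw [stepLaw]
  have h2 := (h1.ident t).measure_mem_eq (s := {l[(t : ℕ)]}) .of_discrete
  have e2 : W.ξ t ⁻¹' {v | ∀ ht : (t : ℕ) < l.length, v = l[(t : ℕ)]} =
      W.ξ t ⁻¹' {l[(t : ℕ)]} := by
    ext ω
    simp
  rw [e2, h2]
  rfl

theorem measure_env_eq (h3 : W.A3 P) (c : Multiset (Site d)) (hc : ∀ x ∈ c, 0 ≤ x 0) :
    P {ω | ∀ x ∈ c, (c.count x : ℕ∞) ≤ W.H x ω} = W.envWeight P c := by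
  have h := h3.indep.measure_inter_preimage_eq_mul (c.toFinset.subtype fun x : Site d => 0 ≤ x 0)
    (sets := fun x => {k | (c.count x.1 : ℕ∞) ≤ k}) (fun t _ => .of_discrete)
  have e1 : (⋂ x ∈ (c.toFinset.subtype fun x : Site d => 0 ≤ x 0),
      W.H x.1 ⁻¹' {k | (c.count x.1 : ℕ∞) ≤ k}) =
      {ω | ∀ x ∈ c, (c.count x : ℕ∞) ≤ W.H x ω} := by
    ext ω
    simp only [Finset.mem_subtype, Multiset.mem_toFinset, Set.mem_iInter, Set.mem_preimage,
      Set.mem_ofPred_eq]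
    exact ⟨fun H x hx => H ⟨x, hc x hx⟩ hx, fun H x hx => H x.1 hx⟩
  rw [← e1, h, envWeight]
  rw [Finset.prod_subtype_of_mem (fun x => P (W.H x ⁻¹' {k | (c.count x : ℕ∞) ≤ k}))
    (fun x hx => hc x (Multiset.mem_toFinset.1 hx))]
  refine Finset.prod_congr rfl fun x hx => ?_
  exact (h3.ident x (hc x (Multiset.mem_toFinset.1 hx))).measure_mem_eq .of_discrete

/-- Following the trajectory alive is a condition on three groups of data: the start with the limits
below height `0`, the increments, and the limits at nonnegative heights. These groups are
independent by A2. -/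
theorem pathWeight_eq (h1 : W.A1 P) (h2 : W.A2 P) (h3 : W.A3 P) (z : Site d)
    (l : List (Site d)) : W.pathWeight P z l =
      W.startWeight P z ((trace z l).filter fun x => ¬ 0 ≤ x 0) * (l.map (W.stepLaw P)).prod *
        W.envWeight P ((trace z l).filter fun x => 0 ≤ x 0) := by
  rw [pathWeight, startsWith_inter_alive]
  set c := (trace z l).filter fun x => ¬ 0 ≤ x 0 with hc
  set c' := (trace z l).filter fun x => 0 ≤ x 0 with hc'
  set E₁ := {ω | W.S₀ ω = z ∧ ∀ x ∈ c, (c.count x : ℕ∞) ≤ W.H x ω} with hE₁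
  set E₂ := {ω | ∀ t (ht : t < l.length), W.ξ t ω = l[t]} with hE₂
  set E₃ := {ω | ∀ x ∈ c', (c'.count x : ℕ∞) ≤ W.H x ω} with hE₃
  have hH : ∀ (m : MeasurableSpace Ω) (x : Site d) (k : ℕ),
      MeasurableSpace.comap (W.H x) inferInstance ≤ m →
      MeasurableSet[m] {ω | (k : ℕ∞) ≤ W.H x ω} := fun m x k hm =>
    hm _ ⟨{j | (k : ℕ∞) ≤ j}, .of_discrete, rfl⟩
  have h := h2.indep.meas_iInter (s := ![E₁, E₂, E₃]) (by
    intro i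
    fin_cases i
    · change MeasurableSet[MeasurableSpace.comap W.S₀ inferInstance ⊔
        ⨆ x : {x : Site d // ¬ 0 ≤ x 0}, MeasurableSpace.comap (W.H x) inferInstance] E₁
      have e : E₁ = W.S₀ ⁻¹' {z} ∩ ⋂ x ∈ c.toFinset, {ω | (c.count x : ℕ∞) ≤ W.H x ω} := by
        ext ω; simp [hE₁]
      rw [e]
      refine MeasurableSet.inter ?_ (Finset.measurableSet_biInter _ fun x hx => hH _ _ _ ?_)
      · exact (le_sup_left : _ ≤ MeasurableSpace.comap W.S₀ inferInstance ⊔ _) _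
          ⟨{z}, .of_discrete, rfl⟩
      · have hx0 : ¬ 0 ≤ x 0 := (Multiset.mem_filter.1 (Multiset.mem_toFinset.1 hx)).2
        exact le_sup_of_le_right (le_iSup (fun x : {x : Site d // ¬ 0 ≤ x 0} =>
          MeasurableSpace.comap (W.H x) inferInstance) ⟨x, hx0⟩)
    · change MeasurableSet[⨆ j, MeasurableSpace.comap (W.ξ j) inferInstance] E₂
      have e : E₂ = ⋂ t : ℕ, ⋂ ht : t < l.length, W.ξ t ⁻¹' {l[t]} := by
        ext ω; simp [hE₂]
      rw [e]
      refine MeasurableSet.iInter fun t => MeasurableSet.iInter fun ht => ?_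
      exact (le_iSup (fun j => MeasurableSpace.comap (W.ξ j) inferInstance) t) _
        ⟨{l[t]}, .of_discrete, rfl⟩
    · change MeasurableSet[⨆ x : {x : Site d // 0 ≤ x 0},
        MeasurableSpace.comap (W.H x) inferInstance] E₃
      have e : E₃ = ⋂ x ∈ c'.toFinset, {ω | (c'.count x : ℕ∞) ≤ W.H x ω} := by
        ext ω; simp [hE₃]
      rw [e]
      refine Finset.measurableSet_biInter _ fun x hx => hH _ _ _ ?_
      have hx0 : 0 ≤ x 0 := (Multiset.mem_filter.1 (Multiset.mem_toFinset.1 hx)).2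
      exact le_iSup (fun x : {x : Site d // 0 ≤ x 0} =>
          MeasurableSpace.comap (W.H x) inferInstance) ⟨x, hx0⟩)
  have e : (⋂ i, (![E₁, E₂, E₃] : Fin 3 → Set Ω) i) = E₁ ∩ E₂ ∩ E₃ := by
    ext ω
    simp [Fin.forall_fin_succ, and_assoc]
  rw [e, Fin.prod_univ_three] at h
  rw [h]
  change P E₁ * P E₂ * P E₃ = _
  rw [hE₂, measure_increments_eq h1, hE₃,
    measure_env_eq h3 c' fun x hx => (Multiset.mem_filter.1 hx).2]
  rfl

variable [IsProbabilityMeasure P]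

theorem limitTail_le_one (k : ℕ) : W.limitTail P k ≤ 1 := prob_le_one

theorem limitTail_anti {k k' : ℕ} (h : k ≤ k') : W.limitTail P k' ≤ W.limitTail P k :=
  measure_mono fun ω hω => le_trans (by exact_mod_cast h) (show (k' : ℕ∞) ≤ W.H 0 ω from hω)

theorem limitTail_zero : W.limitTail P 0 = 1 := by simp [limitTail]

theorem limitTail_one (h3 : W.A3 P) : W.limitTail P 1 = 1 := by
  have e : {ω | ((1 : ℕ) : ℕ∞) ≤ W.H 0 ω} =ᵐ[P] Set.univ :=
    Filter.eventuallyEq_univ.2 (by simpa using! h3.one_le)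
  rw [limitTail, measure_congr e, measure_univ]

theorem envWeight_le_one (c : Multiset (Site d)) : W.envWeight P c ≤ 1 :=
  Finset.prod_le_one' fun _ _ => limitTail_le_one _

/-- The weight of a multiset as a product over any finite set that contains it. -/
theorem envWeight_eq_prod {c : Multiset (Site d)} {s : Finset (Site d)} (hs : c.toFinset ⊆ s) :
    W.envWeight P c = ∏ x ∈ s, W.limitTail P (c.count x) := by
  refine Finset.prod_subset hs fun x _ hx => ?_
  rw [Multiset.count_eq_zero.2 (fun h => hx (Multiset.mem_toFinset.2 h)), limitTail_zero]

theorem envWeight_anti {c c' : Multiset (Site d)} (h : c ≤ c') :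
    W.envWeight P c' ≤ W.envWeight P c := by
  rw [envWeight_eq_prod (c := c) (s := c'.toFinset)
    (Multiset.toFinset_subset.2 (Multiset.subset_of_le h)), envWeight]
  exact Finset.prod_le_prod' fun x _ => limitTail_anti (Multiset.count_le_of_le x h)

/-- Disjoint sets of sites carry independent limits. -/
theorem envWeight_add {c c' : Multiset (Site d)} (h : ∀ x ∈ c, x ∉ c') :
    W.envWeight P (c + c') = W.envWeight P c * W.envWeight P c' := by
  rw [envWeight, Multiset.toFinset_add, Finset.prod_union]
  · congr 1
    · refine Finset.prod_congr rfl fun x hx => ?_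
      rw [Multiset.count_add, Multiset.count_eq_zero.2 (h x (Multiset.mem_toFinset.1 hx)), add_zero]
    · refine Finset.prod_congr rfl fun x hx => ?_
      rw [Multiset.count_add, Multiset.count_eq_zero.2 (fun h' => h x h' (Multiset.mem_toFinset.1 hx)),
        zero_add]
  · rw [Finset.disjoint_left]
    intro x hx
    simp only [Multiset.mem_toFinset] at hx ⊢
    exact h x hx

theorem envWeight_map (c : Multiset (Site d)) (e : Site d) :
    W.envWeight P (c.map (e + ·)) = W.envWeight P c := by
  rw [envWeight, Multiset.toFinset_map, Finset.prod_image (fun x _ y _ h => add_left_cancel h)]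
  refine Finset.prod_congr rfl fun x _ => ?_
  rw [Multiset.count_map_eq_count' _ _ (add_right_injective e)]

/-- A first visit is free, so the site at a cut may be charged to both pieces. -/
theorem envWeight_singleton (h3 : W.A3 P) (x : Site d) : W.envWeight P {x} = 1 := by
  simp [envWeight, limitTail_one h3]


/-! ### The walk under P_0. -/

theorem zeroEnv_a1 (h1 : W.A1 P) : W.zeroEnv.A1 P :=
  ⟨h1.meas, h1.indep, h1.ident, h1.skip_free, h1.up⟩

theorem zeroEnv_H {x : Site d} (hx : 0 ≤ x 0) : W.zeroEnv.H x = W.H x := by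
  ext1 ω
  simp [zeroEnv, hx]

theorem zeroEnv_H_of_not {x : Site d} (hx : ¬ 0 ≤ x 0) : W.zeroEnv.H x = fun _ => 0 := by
  ext1 ω
  simp only [zeroEnv, if_neg hx]

theorem zeroEnv_a3 (h3 : W.A3 P) : W.zeroEnv.A3 P := by
  have h0 : W.zeroEnv.H 0 = W.H 0 := zeroEnv_H le_rfl
  refine ⟨?_, fun x hx => ?_, ?_⟩
  · have : (fun x : {x : Site d // 0 ≤ x 0} => W.zeroEnv.H x) = fun x => W.H x.1 :=
      funext fun x => zeroEnv_H x.2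
    rw [this]
    exact h3.indep
  · rw [h0, zeroEnv_H hx]
    exact h3.ident x hx
  · rw [h0]
    exact h3.one_le

/-- The new start and the limits at negative heights are constant and generate trivial σ-algebras,
so independence is inherited. With its two neighbours this lets every estimate for the walk be
applied under P_0 too. -/
theorem zeroEnv_a2 (h2 : W.A2 P) (h3 : W.A3 P) : W.zeroEnv.A2 P := by
  refine ⟨measurable_const, fun x => ?_, ?_, ?_, ?_⟩
  · by_cases hx : 0 ≤ x 0
    · rw [zeroEnv_H hx]; exact h2.meas_env x
    · rw [zeroEnv_H_of_not hx]; exact measurable_const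
  · have hle : ∀ i : Fin 3, (![MeasurableSpace.comap W.zeroEnv.S₀ inferInstance ⊔
        ⨆ x : {x : Site d // ¬ 0 ≤ x 0}, MeasurableSpace.comap (W.zeroEnv.H x) inferInstance,
        ⨆ j, MeasurableSpace.comap (W.zeroEnv.ξ j) inferInstance,
        ⨆ x : {x : Site d // 0 ≤ x 0}, MeasurableSpace.comap (W.zeroEnv.H x) inferInstance] :
          Fin 3 → MeasurableSpace Ω) i ≤
        (![MeasurableSpace.comap W.S₀ inferInstance ⊔
        ⨆ x : {x : Site d // ¬ 0 ≤ x 0}, MeasurableSpace.comap (W.H x) inferInstance,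
        ⨆ j, MeasurableSpace.comap (W.ξ j) inferInstance,
        ⨆ x : {x : Site d // 0 ≤ x 0}, MeasurableSpace.comap (W.H x) inferInstance] :
          Fin 3 → MeasurableSpace Ω) i := by
      intro i
      fin_cases i
      · refine sup_le ?_ (iSup_le fun x => ?_)
        · have : W.zeroEnv.S₀ = fun _ => 0 := rfl
          rw [this, MeasurableSpace.comap_const]
          exact bot_le
        · rw [zeroEnv_H_of_not x.2, MeasurableSpace.comap_const]
          exact bot_le
      · exact le_rfl
      · refine iSup_mono fun x => ?_
        rw [zeroEnv_H x.2]
    rw [iIndep_iff]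
    intro s f hf
    exact (iIndep_iff _ _).1 h2.indep s fun i hi => hle i _ (hf i hi)
  · exact Filter.Eventually.of_forall fun ω => le_rfl
  · have e : {ω | hit 0 (W.zeroEnv.path ω) < death (W.zeroEnv.path ω) (W.zeroEnv.env ω)}
        =ᵐ[P] Set.univ := by
      refine Filter.eventuallyEq_univ.2 ?_
      filter_upwards [h3.one_le] with ω hω
      have h0 : hit 0 (W.zeroEnv.path ω) = ((0 : ℕ) : ℕ∞) := by
        rw [hit_eq_coe]
        simp [path_zero, zeroEnv]
      have h0' : W.zeroEnv.H 0 ω = W.H 0 ω := by rw [zeroEnv_H le_rfl]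
      rw [h0, coe_lt_death_iff]
      intro j hj
      obtain rfl : j = 0 := by omega
      have hp : W.zeroEnv.path ω 0 = 0 := by rw [path_zero]; rfl
      rw [hp, env, h0', visits]
      simpa [Finset.filter_singleton, hp] using hω
    rw [measure_congr e, measure_univ]
    exact one_pos

theorem limitTail_zeroEnv (k : ℕ) : W.zeroEnv.limitTail P k = W.limitTail P k := by
  rw [limitTail, limitTail, zeroEnv_H le_rfl]

theorem envWeight_zeroEnv (c : Multiset (Site d)) : W.zeroEnv.envWeight P c = W.envWeight P c := by
  simp only [envWeight, limitTail_zeroEnv]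

theorem pathWeight_zeroEnv (h1 : W.A1 P) (h2 : W.A2 P) (h3 : W.A3 P) {l : List (Site d)}
    (hl : ∀ x ∈ trace 0 l, 0 ≤ x 0) : W.zeroEnv.pathWeight P 0 l =
      (l.map (W.stepLaw P)).prod * W.envWeight P (trace 0 l) := by
  rw [pathWeight_eq (zeroEnv_a1 h1) (zeroEnv_a2 h2 h3) (zeroEnv_a3 h3), envWeight_zeroEnv,
    Multiset.filter_eq_self.2 hl, Multiset.filter_eq_nil.2 fun x hx => not_not.2 (hl x hx)]
  have : W.zeroEnv.startWeight P 0 0 = 1 := by simp [startWeight, zeroEnv]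
  rw [this, one_mul]
  rfl

theorem trace_eq_add (z : Site d) (l : List (Site d)) :
    trace z l = (Multiset.range l.length).map (listPath z l) + {z + l.sum} := by
  rw [trace_eq_map, Multiset.range_succ, Multiset.map_cons, listPath_length,
    ← Multiset.singleton_add, add_comm]

theorem trace_append_eq_add (z : Site d) (l l' : List (Site d)) : trace z (l ++ l') =
    (Multiset.range l.length).map (listPath z l) + trace (z + l.sum) l' := by
  rw [trace_append, trace_eq_add, trace, add_assoc, Multiset.singleton_add]

theorem filter_nonneg {c : Multiset (Site d)} (hc : ∀ x ∈ c, 0 ≤ x 0) :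
    c.filter (fun x => 0 ≤ x 0) = c := Multiset.filter_eq_self.2 hc

theorem filter_not_nonneg {c : Multiset (Site d)} (hc : ∀ x ∈ c, 0 ≤ x 0) :
    c.filter (fun x => ¬ 0 ≤ x 0) = 0 := Multiset.filter_eq_nil.2 fun x hx => not_not.2 (hc x hx)

/-- After the first visit of a level, a path that does not go below that level sees a new
environment. -/
theorem pathWeight_append (h1 : W.A1 P) (h2 : W.A2 P) (h3 : W.A3 P) {z : Site d}
    {l l' : List (Site d)} {j : ℕ} (hl : FirstAt j l.length (listPath z l))
    (hl' : ∀ t ≤ l'.length, 0 ≤ listPath 0 l' t 0) :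
    W.pathWeight P z (l ++ l') = W.pathWeight P z l * W.zeroEnv.pathWeight P 0 l' := by
  -- The sites of `l` without the last one. The last site is counted with `l'`, and in the factor of
  -- `l` it has weight one.
  set pre := (Multiset.range l.length).map (listPath z l) with hpre
  have hpre' : ∀ x ∈ pre, x 0 < j := by
    intro x hx
    rw [hpre, Multiset.mem_map] at hx
    obtain ⟨t, ht, rfl⟩ := hx
    exact hl.1 t (Multiset.mem_range.1 ht)
  have he : (z + l.sum) 0 = (j : ℤ) := by rw [← listPath_length]; exact hl.2
  have hj : (0 : ℤ) ≤ j := by positivity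
  have htr0 : ∀ x ∈ trace 0 l', 0 ≤ x 0 := by
    intro x hx
    obtain ⟨t, ht, rfl⟩ := mem_trace.1 hx
    exact hl' t ht
  have htr : ∀ x ∈ trace (z + l.sum) l', (j : ℤ) ≤ x 0 := by
    intro x hx
    rw [trace_map, Multiset.mem_map] at hx
    obtain ⟨a, ha, rfl⟩ := hx
    rw [Pi.add_apply, he]
    linarith [htr0 a ha]
  have hsing : ∀ x ∈ ({z + l.sum} : Multiset (Site d)), (j : ℤ) ≤ x 0 := by
    intro x hx
    rw [Multiset.mem_singleton.1 hx, he]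
  -- Before the first visit of `j` all sites are strictly below `j`, so the two pieces use different
  -- parts of the environment.
  have hdisj : ∀ c : Multiset (Site d), (∀ x ∈ c, (j : ℤ) ≤ x 0) →
      ∀ x ∈ pre.filter (fun x : Site d => 0 ≤ x 0), x ∉ c := by
    intro c hc x hx hx'
    have := hpre' x (Multiset.mem_filter.1 hx).1
    linarith [hc x hx']
  rw [pathWeight_eq h1 h2 h3, pathWeight_eq h1 h2 h3, pathWeight_zeroEnv h1 h2 h3 htr0,
    trace_append_eq_add, trace_eq_add z l, ← hpre, Multiset.filter_add, Multiset.filter_add,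
    Multiset.filter_add, Multiset.filter_add,
    filter_not_nonneg fun x hx => hj.trans (htr x hx),
    filter_not_nonneg fun x hx => hj.trans (hsing x hx),
    filter_nonneg fun x hx => hj.trans (htr x hx),
    filter_nonneg fun x hx => hj.trans (hsing x hx),
    envWeight_add (hdisj _ htr), envWeight_add (hdisj _ hsing), envWeight_singleton h3,
    trace_map (z + l.sum), envWeight_map, List.map_append, List.prod_append]
  ring

/-- The weight of a path that is cut at the first visit of a level and at a later visit of that
level, after which it stays above that level. -/
theorem pathWeight_append_le (h1 : W.A1 P) (h2 : W.A2 P) (h3 : W.A3 P) {z : Site d}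
    {l l₀ l' : List (Site d)} {j : ℕ} (hl : FirstAt j l.length (listPath z l))
    (hl₀ : l₀.sum 0 = 0) (hl' : ∀ t < l'.length, 0 < listPath 0 l' (t + 1) 0) :
    W.pathWeight P z (l ++ (l₀ ++ l')) ≤ W.pathWeight P z l *
      ((l₀.map (W.stepLaw P)).prod * W.envWeight P ((trace 0 l₀).filter fun x => x 0 = 0)) *
      W.zeroEnv.pathWeight P 0 l' := by
  set pre := (Multiset.range l.length).map (listPath z l) with hpre
  have hpre' : ∀ x ∈ pre, x 0 < j := by
    intro x hx
    rw [hpre, Multiset.mem_map] at hx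
    obtain ⟨t, ht, rfl⟩ := hx
    exact hl.1 t (Multiset.mem_range.1 ht)
  have he : (z + l.sum) 0 = (j : ℤ) := by rw [← listPath_length]; exact hl.2
  have hj : (0 : ℤ) ≤ j := by positivity
  have hv0 : ∀ x ∈ visited 0 l', 0 < x 0 := by
    intro x hx
    obtain ⟨t, ht, rfl⟩ := mem_visited.1 hx
    exact hl' t ht
  have htr0 : ∀ x ∈ trace 0 l', 0 ≤ x 0 := by
    intro x hx
    rcases Multiset.mem_cons.1 hx with rfl | hx
    · exact le_rfl
    · exact (hv0 x hx).le
  have hvis : visited (z + l.sum + l₀.sum) l' = (visited 0 l').map (z + l.sum + l₀.sum + ·) := by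
    rw [← visited_map, add_zero]
  have hv : ∀ x ∈ visited (z + l.sum + l₀.sum) l', (j : ℤ) < x 0 := by
    intro x hx
    rw [hvis, Multiset.mem_map] at hx
    obtain ⟨a, ha, rfl⟩ := hx
    rw [Pi.add_apply, Pi.add_apply, he, hl₀]
    linarith [hv0 a ha]
  have hmid : (trace (z + l.sum) l₀).filter (fun x => x 0 = (j : ℤ)) =
      ((trace 0 l₀).filter fun x => x 0 = 0).map (z + l.sum + ·) := by
    rw [trace_map, Multiset.filter_map]
    congr 1
    refine Multiset.filter_congr fun x _ => ?_
    simp only [Function.comp_apply, Pi.add_apply] at he ⊢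
    rw [he]
    omega
  have hsing : ∀ x ∈ ({z + l.sum} : Multiset (Site d)), (j : ℤ) ≤ x 0 := by
    intro x hx
    rw [Multiset.mem_singleton.1 hx, he]
  have hdisj : ∀ c : Multiset (Site d), (∀ x ∈ c, (j : ℤ) ≤ x 0) →
      ∀ x ∈ pre.filter (fun x : Site d => 0 ≤ x 0), x ∉ c := by
    intro c hc x hx hx'
    have := hpre' x (Multiset.mem_filter.1 hx).1
    linarith [hc x hx']
  have hzero : W.envWeight P (trace 0 l') = W.envWeight P (visited (z + l.sum + l₀.sum) l') := by
    rw [trace, ← Multiset.singleton_add, envWeight_add, envWeight_singleton h3, one_mul, hvis,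
      envWeight_map]
    intro x hx hx'
    rw [Multiset.mem_singleton.1 hx] at hx'
    exact lt_irrefl _ (hv0 0 hx')
  have htot : trace z (l ++ (l₀ ++ l')) =
      pre + (trace (z + l.sum) l₀ + visited (z + l.sum + l₀.sum) l') := by
    rw [trace_append_eq_add, trace_append]
  -- Of the middle piece only the visits at height `j` are kept: these sites are disjoint from those
  -- below `j` used before and those above `j` used afterwards. Forgetting other visits can only
  -- increase the weight.
  have hbig : pre.filter (fun x => 0 ≤ x 0) +
      ((trace (z + l.sum) l₀).filter (fun x => x 0 = (j : ℤ)) +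
        visited (z + l.sum + l₀.sum) l') ≤
      (trace z (l ++ (l₀ ++ l'))).filter fun x => 0 ≤ x 0 := by
    rw [htot, Multiset.filter_add, Multiset.filter_add,
      filter_nonneg fun x hx => hj.trans (hv x hx).le]
    gcongr
    refine Multiset.monotone_filter_right _ fun x hx => ?_
    rw [hx]
    exact hj
  rw [pathWeight_eq h1 h2 h3, pathWeight_eq h1 h2 h3, pathWeight_zeroEnv h1 h2 h3 htr0, hzero]
  calc W.startWeight P z ((trace z (l ++ (l₀ ++ l'))).filter fun x => ¬ 0 ≤ x 0) *
        ((l ++ (l₀ ++ l')).map (W.stepLaw P)).prod *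
        W.envWeight P ((trace z (l ++ (l₀ ++ l'))).filter fun x => 0 ≤ x 0)
      ≤ W.startWeight P z ((trace z l).filter fun x => ¬ 0 ≤ x 0) *
        ((l ++ (l₀ ++ l')).map (W.stepLaw P)).prod *
        W.envWeight P (pre.filter (fun x => 0 ≤ x 0) +
          ((trace (z + l.sum) l₀).filter (fun x => x 0 = (j : ℤ)) +
            visited (z + l.sum + l₀.sum) l')) := by
        gcongr
        · refine measure_mono fun ω hω => ⟨hω.1, fun x hx => ?_⟩
          have hle : (trace z l).filter (fun x => ¬ 0 ≤ x 0) ≤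
              (trace z (l ++ (l₀ ++ l'))).filter fun x => ¬ 0 ≤ x 0 := by
            refine Multiset.filter_le_filter _ ?_
            rw [trace_append]
            exact Multiset.le_add_right _ _
          refine le_trans ?_ (hω.2 x (Multiset.mem_of_le hle hx))
          exact_mod_cast Multiset.count_le_of_le x hle
        · exact envWeight_anti hbig
    _ = _ := by
        rw [envWeight_add (hdisj _ ?_), envWeight_add ?_, hmid, envWeight_map, trace_eq_add z l,
          ← hpre, Multiset.filter_add _ pre {z + l.sum}, Multiset.filter_add _ pre {z + l.sum},
          filter_nonneg fun x hx => hj.trans (hsing x hx),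
          envWeight_add (hdisj _ hsing), envWeight_singleton h3, List.map_append, List.map_append,
          List.prod_append, List.prod_append]
        · ring
        · intro x hx hx'
          have := (Multiset.mem_filter.1 hx).2
          linarith [hv x hx']
        · intro x hx
          rcases Multiset.mem_add.1 hx with hx | hx
          · exact (Multiset.mem_filter.1 hx).2.ge
          · exact (hv x hx).le

end ConstrainedWalk

/-! ### Events that are determined by the path up to a stopping time -/

namespace SitePath

variable {d : ℕ}

/-- `Φ K y` says that a certain stopping time of the path `y` is `K`, and that the path up to that
time has a certain property. -/
structure IsStopping (Φ : ℕ → (ℕ → Site d) → Prop) : Prop where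
  congr : ∀ {K : ℕ} {y y' : ℕ → Site d}, (∀ t ≤ K, y t = y' t) → Φ K y → Φ K y'
  unique : ∀ {K K' : ℕ} {y : ℕ → Site d}, Φ K y → Φ K' y → K = K'

theorem shift_congr {K k : ℕ} {y y' : ℕ → Site d} (h : ∀ t ≤ K + k, y t = y' t) :
    ∀ t ≤ k, shift K y t = shift K y' t := fun t ht => by
  rw [shift, shift, h _ (by omega), h _ (by omega)]

theorem IsStopping.concat {Φ Ψ : ℕ → (ℕ → Site d) → Prop} (hΦ : IsStopping Φ)
    (hΨ : IsStopping Ψ) :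
    IsStopping fun N y => ∃ K k, N = K + k ∧ Φ K y ∧ Ψ k (shift K y) := by
  constructor
  · rintro N y y' h ⟨K, k, rfl, hK, hk⟩
    exact ⟨K, k, rfl, hΦ.congr (fun t ht => h t (by omega)) hK, hΨ.congr (shift_congr h) hk⟩
  · rintro N N' y ⟨K, k, rfl, hK, hk⟩ ⟨K', k', rfl, hK', hk'⟩
    obtain rfl := hΦ.unique hK hK'
    rw [hΨ.unique hk hk']

end SitePath

namespace ConstrainedWalk

variable {d : ℕ} {Ω : Type*}

/-- The event that the stopping time in `Φ` is before death, with the property of the path in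
`Φ`. -/
def pathEvent (W : ConstrainedWalk d Ω) (Φ : ℕ → (ℕ → Site d) → Prop) : Set Ω :=
  {ω | ∃ K : ℕ, Φ K (W.path ω) ∧ (K : ℕ∞) < death (W.path ω) (W.env ω)}

variable [NeZero d] [MeasurableSpace Ω] {W : ConstrainedWalk d Ω} {P : Measure Ω}
  {Φ Ψ : ℕ → (ℕ → Site d) → Prop}

theorem measurableSet_alive (h1 : W.A1 P) (h2 : W.A2 P) (z : Site d) (l : List (Site d)) :
    MeasurableSet
      (W.startsWith z l ∩ {ω | (l.length : ℕ∞) < death (W.path ω) (W.env ω)}) := by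
  have : W.startsWith z l ∩ {ω | (l.length : ℕ∞) < death (W.path ω) (W.env ω)} =
      W.startsWith z l ∩ ⋂ x ∈ (trace z l).toFinset,
        {ω | ((trace z l).count x : ℕ∞) ≤ W.H x ω} := by
    ext ω
    refine and_congr_right fun h => ?_
    rw [Set.mem_ofPred_eq, lt_death_iff h]
    simp
  rw [this]
  refine (measurableSet_startsWith h1 h2 z l).inter (Finset.measurableSet_biInter _ fun x _ => ?_)
  exact h2.meas_env x (.of_discrete (s := {k | ((trace z l).count x : ℕ∞) ≤ k}))

open Classical in
theorem pathEvent_eq_iUnion (hΦ : IsStopping Φ) : W.pathEvent Φ =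
    ⋃ i : Site d × List (Site d), if Φ i.2.length (listPath i.1 i.2) then
      W.startsWith i.1 i.2 ∩ {ω | (i.2.length : ℕ∞) < death (W.path ω) (W.env ω)} else ∅ := by
  ext ω
  rw [Set.mem_iUnion]
  constructor
  · rintro ⟨K, hK, hd⟩
    refine ⟨(W.S₀ ω, W.increments ω 0 K), ?_⟩
    have hs := mem_startsWith_increments W ω K
    have hlen := length_increments W ω 0 K
    rw [if_pos]
    · refine ⟨hs, ?_⟩
      rw [Set.mem_ofPred_eq, hlen]
      exact hd
    · simp only [hlen]
      exact hΦ.congr (fun t ht => path_eq_of_startsWith hs (by omega)) hK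
  · rintro ⟨⟨z, l⟩, h⟩
    split_ifs at h with hΦl
    · exact ⟨l.length, hΦ.congr (fun t ht => (path_eq_of_startsWith h.1 ht).symm) hΦl, h.2⟩
    · exact absurd h (Set.notMem_empty _)

theorem measurableSet_pathEvent (h1 : W.A1 P) (h2 : W.A2 P) (hΦ : IsStopping Φ) :
    MeasurableSet (W.pathEvent Φ) := by
  classical
  rw [pathEvent_eq_iUnion hΦ]
  refine MeasurableSet.iUnion fun i => ?_
  split_ifs
  · exact measurableSet_alive h1 h2 _ _
  · exact .empty

-- The stopping time and the path up to it determine the finite trajectory, so the event is a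
-- disjoint countable union.
open Classical in
theorem measure_pathEvent (h1 : W.A1 P) (h2 : W.A2 P) (hΦ : IsStopping Φ) :
    P (W.pathEvent Φ) = ∑' i : Site d × List (Site d),
      if Φ i.2.length (listPath i.1 i.2) then W.pathWeight P i.1 i.2 else 0 := by
  rw [pathEvent_eq_iUnion hΦ, measure_iUnion]
  · refine tsum_congr fun i => ?_
    split_ifs
    · rfl
    · exact measure_empty
  · rintro ⟨z, l⟩ ⟨z', l'⟩ hne
    rw [Function.onFun, Set.disjoint_left]
    intro ω h h'
    split_ifs at h h' with hl hl'
    · have e := hΦ.unique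
        (hΦ.congr (fun t ht => (path_eq_of_startsWith h.1 ht).symm) hl)
        (hΦ.congr (fun t ht => (path_eq_of_startsWith h'.1 ht).symm) hl')
      refine hne (Prod.ext (h.1.1.symm.trans h'.1.1) ?_)
      have e1 := eq_increments_of_startsWith h.1
      have e2 := eq_increments_of_startsWith h'.1
      simp only at e e1 e2 ⊢
      rw [e1, e2, e]
    all_goals simp_all
  · intro i
    split_ifs
    · exact measurableSet_alive h1 h2 _ _
    · exact .empty

theorem pathWeight_zeroEnv_of_ne {z : Site d} (hz : z ≠ 0) (l : List (Site d)) :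
    W.zeroEnv.pathWeight P z l = 0 := by
  have : W.zeroEnv.startsWith z l = ∅ := by
    ext ω
    simp only [startsWith, zeroEnv, Set.mem_ofPred_eq, Set.mem_empty_iff_false, iff_false, not_and]
    intro h
    exact absurd h.symm hz
  rw [pathWeight, this, Set.empty_inter, measure_empty]

variable [IsProbabilityMeasure P]

open Classical in
theorem measure_pathEvent_zeroEnv (h1 : W.A1 P) (h2 : W.A2 P) (h3 : W.A3 P) (hΨ : IsStopping Ψ) :
    P (W.zeroEnv.pathEvent Ψ) = ∑' l : List (Site d),
      if Ψ l.length (listPath 0 l) then W.zeroEnv.pathWeight P 0 l else 0 := by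
  rw [measure_pathEvent (zeroEnv_a1 h1) (zeroEnv_a2 h2 h3) hΨ,
    ENNReal.tsum_prod (f := fun (z : Site d) (l : List (Site d)) =>
      if Ψ l.length (listPath z l) then W.zeroEnv.pathWeight P z l else 0), tsum_eq_single 0]
  intro z hz
  simp [pathWeight_zeroEnv_of_ne hz]

open Classical in
/-- Independence of the parts of the path before and after the first visit of a level, if the
path does not go below that level later. -/
theorem measure_pathEvent_shift (h1 : W.A1 P) (h2 : W.A2 P) (h3 : W.A3 P) (hΦ : IsStopping Φ)
    (hΨ : IsStopping Ψ) {j : ℕ} (hj : ∀ K y, Φ K y → FirstAt j K y)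
    (hpos : ∀ k x, x 0 = 0 → Ψ k x → ∀ t ≤ k, 0 ≤ x t 0) :
    P (W.pathEvent fun N y => ∃ K k, N = K + k ∧ Φ K y ∧ Ψ k (shift K y)) =
      P (W.pathEvent Φ) * P (W.zeroEnv.pathEvent Ψ) := by
  rw [measure_pathEvent h1 h2 (hΦ.concat hΨ), measure_pathEvent h1 h2 hΦ,
    measure_pathEvent_zeroEnv h1 h2 h3 hΨ, ← ENNReal.tsum_mul_right]
  simp_rw [← ENNReal.tsum_mul_left]
  rw [← ENNReal.tsum_prod (f := fun (i : Site d × List (Site d)) (l' : List (Site d)) =>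
    (if Φ i.2.length (listPath i.1 i.2) then W.pathWeight P i.1 i.2 else 0) *
      if Ψ l'.length (listPath 0 l') then W.zeroEnv.pathWeight P 0 l' else 0)]
  set g : (Site d × List (Site d)) × List (Site d) → ℝ≥0∞ := fun i =>
    (if Φ i.1.2.length (listPath i.1.1 i.1.2) then W.pathWeight P i.1.1 i.1.2 else 0) *
      if Ψ i.2.length (listPath 0 i.2) then W.zeroEnv.pathWeight P 0 i.2 else 0 with hg
  change _ = ∑' i, g i
  set f : Site d × List (Site d) → ℝ≥0∞ := fun i =>
    if ∃ K k, i.2.length = K + k ∧ Φ K (listPath i.1 i.2) ∧ Ψ k (shift K (listPath i.1 i.2))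
      then W.pathWeight P i.1 i.2 else 0 with hf
  change ∑' i, f i = _
  have hcond : ∀ {i : (Site d × List (Site d)) × List (Site d)}, g i ≠ 0 →
      Φ i.1.2.length (listPath i.1.1 i.1.2) ∧ Ψ i.2.length (listPath 0 i.2) := by
    intro i hi
    by_contra hcon
    refine hi ?_
    simp only [hg]
    by_cases hc : Φ i.1.2.length (listPath i.1.1 i.1.2)
    · rw [if_neg (c := Ψ _ _) fun h => hcon ⟨hc, h⟩, mul_zero]
    · rw [if_neg hc, zero_mul]
  have happ : ∀ {z : Site d} {l l' : List (Site d)}, Φ l.length (listPath z l) →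
      Ψ l'.length (listPath 0 l') →
      Φ l.length (listPath z (l ++ l')) ∧ Ψ l'.length (shift l.length (listPath z (l ++ l'))) := by
    intro z l l' h h'
    rw [shift_listPath_append]
    exact ⟨hΦ.congr (fun t ht => (listPath_append_left z l l' ht).symm) h, h'⟩
  -- Concatenation is a bijection between the supports of the two families: the cut is recovered
  -- from the uniqueness of the stopping time in `Φ`.
  refine tsum_eq_tsum_of_ne_zero_bij (g := g) (f := f)
    (fun i => (i.1.1.1, i.1.1.2 ++ i.1.2)) ?_ ?_ ?_
  · rintro ⟨⟨⟨z, l⟩, l₁⟩, hi⟩ ⟨⟨⟨z', l'⟩, l₁'⟩, hi'⟩ h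
    simp only [Prod.mk.injEq] at h
    obtain ⟨rfl, h⟩ := h
    have e1 := hcond hi
    have e2 := hcond hi'
    have e3 := (happ e1.1 e1.2).1
    have e4 := (happ e2.1 e2.2).1
    simp only at e3 e4
    rw [h] at e3
    have e5 := hΦ.unique e3 e4
    obtain ⟨rfl, rfl⟩ := List.append_inj h e5
    rfl
  · rintro ⟨z, l⟩ hl
    have hl' : ∃ K k, l.length = K + k ∧ Φ K (listPath z l) ∧ Ψ k (shift K (listPath z l)) := by
      by_contra hcon
      exact hl (if_neg hcon)
    obtain ⟨K, k, hlen, hK, hk⟩ := hl'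
    have hsplit : l.take K ++ l.drop K = l := List.take_append_drop K l
    have hlenK : (l.take K).length = K := by simp; omega
    have hlenk : (l.drop K).length = k := by simp; omega
    have hΦ' : Φ (l.take K).length (listPath z (l.take K)) := by
      rw [hlenK]
      refine hΦ.congr (fun t ht => ?_) hK
      conv_lhs => rw [← hsplit]
      exact listPath_append_left _ _ _ (by omega)
    have hΨ' : Ψ (l.drop K).length (listPath 0 (l.drop K)) := by
      have := shift_listPath_append z (l.take K) (l.drop K)
      rw [hsplit, hlenK] at this
      rwa [hlenk, ← this]
    have hw := pathWeight_append h1 h2 h3 (hj _ _ hΦ') (hpos _ _ (listPath_zero _ _) hΨ')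
    have hgv : g ((z, l.take K), l.drop K) = f (z, l) := by
      simp only [hg, hf]
      rw [if_pos hΦ', if_pos hΨ', ← hw, hsplit, if_pos ⟨K, k, hlen, hK, hk⟩]
    exact ⟨⟨((z, l.take K), l.drop K), by rw [Function.mem_support, hgv]; exact hl⟩,
      by simp [hsplit]⟩
  · rintro ⟨⟨⟨z, l⟩, l'⟩, hi⟩
    have e1 := hcond hi
    have e2 := happ e1.1 e1.2
    have hw := pathWeight_append h1 h2 h3 (hj _ _ e1.1) (hpos _ _ (listPath_zero _ _) e1.2)
    simp only [hg, hf]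
    rw [if_pos e1.1, if_pos e1.2, if_pos ⟨_, _, by rw [List.length_append], e2⟩, hw]

end ConstrainedWalk

/-! ### The expected number of visits of a level before death -/

theorem ENNReal.tsum_le_tsum_of_support_injective {α β : Type*} {f : α → ℝ≥0∞} {g : β → ℝ≥0∞}
    (i : Function.support f → β) (hi : Function.Injective i)
    (h : ∀ a : Function.support f, f a ≤ g (i a)) : ∑' a, f a ≤ ∑' b, g b := by
  rw [← tsum_subtype_support f]
  exact (ENNReal.tsum_le_tsum h).trans (ENNReal.tsum_comp_le_tsum_of_injective hi g)

namespace SitePath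

variable {d : ℕ} [NeZero d]

/-- The list of increments of an excursion from a level: it returns to the level at its end, for
the first time. -/
def IsExcursion (e : List (Site d)) : Prop :=
  e ≠ [] ∧ e.sum 0 = 0 ∧ ∀ t, 0 < t → t < e.length → (e.take t).sum 0 ≠ 0

/-- A nonempty path from a level to that level begins with an excursion. -/
theorem exists_excursion {l : List (Site d)} (hl : l ≠ []) (hsum : l.sum 0 = 0) :
    ∃ e l', IsExcursion e ∧ l'.sum 0 = 0 ∧ l = e ++ l' := by
  classical
  have hex : ∃ t, 0 < t ∧ t ≤ l.length ∧ (l.take t).sum 0 = 0 :=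
    ⟨l.length, List.length_pos_of_ne_nil hl, le_rfl, by simpa using hsum⟩
  obtain ⟨t, ⟨h1, h2, h3⟩, hmin⟩ : ∃ t, (0 < t ∧ t ≤ l.length ∧ (l.take t).sum 0 = 0) ∧
      ∀ s < t, ¬ (0 < s ∧ s ≤ l.length ∧ (l.take s).sum 0 = 0) :=
    ⟨Nat.find hex, Nat.find_spec hex, fun s hs => Nat.find_min hex hs⟩
  refine ⟨l.take t, l.drop t, ⟨?_, h3, fun s hs hst => ?_⟩, ?_, (List.take_append_drop t l).symm⟩
  · intro h
    have := congrArg List.length h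
    rw [List.length_take, List.length_nil] at this
    omega
  · have hst' : s < t := by
      rw [List.length_take] at hst
      omega
    rw [List.take_take, min_eq_left hst'.le]
    intro h
    exact hmin s hst' ⟨hs, by omega, h⟩
  · have : (l.take t).sum + (l.drop t).sum = l.sum := by
      rw [← List.sum_append, List.take_append_drop]
    have h4 := congrFun this 0
    rw [Pi.add_apply, h3, hsum, zero_add] at h4
    exact h4

/-- An excursion meets the level again only at its end. -/
theorem filter_visited_excursion {e : List (Site d)} (he : IsExcursion e) {x : Site d}
    (hx : x 0 = 0) : (visited x e).filter (fun x => x 0 = 0) = {x + e.sum} := by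
  have h1 := trace_eq_map x e
  obtain ⟨n, hn⟩ : ∃ n, e.length = n + 1 :=
    ⟨e.length - 1, by have := List.length_pos_of_ne_nil he.1; omega⟩
  rw [visited_eq_map, hn, Multiset.range_succ, Multiset.map_cons, ← hn, listPath_length,
    Multiset.filter_cons_of_pos, Multiset.filter_eq_nil.2]
  · rfl
  · intro y hy
    rw [Multiset.mem_map] at hy
    obtain ⟨t, ht, rfl⟩ := hy
    rw [Multiset.mem_range] at ht
    rw [listPath, Pi.add_apply, hx, zero_add]
    exact he.2.2 (t + 1) (by omega) (by omega)
  · rw [Pi.add_apply, hx, he.2.1, add_zero]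

end SitePath

namespace ConstrainedWalk

variable {d : ℕ} {Ω : Type*} [NeZero d] [MeasurableSpace Ω] {W : ConstrainedWalk d Ω}
  {P : Measure Ω}

open Classical in
theorem measure_increments_mem (h1 : W.A1 P) {Q : List (Site d) → Prop}
    (hQ : ∀ {ω k k'}, Q (W.increments ω 0 k) → Q (W.increments ω 0 k') → k = k') :
    P {ω | ∃ k, Q (W.increments ω 0 k)} =
      ∑' l, if Q l then (l.map (W.stepLaw P)).prod else 0 := by
  have hmem : ∀ {ω : Ω} {l : List (Site d)},
      (∀ t (ht : t < l.length), W.ξ t ω = l[t]) ↔ l = W.increments ω 0 l.length := by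
    intro ω l
    constructor
    · intro h
      refine List.ext_getElem (by simp [increments]) fun t ht _ => ?_
      rw [← h t ht]
      simp [increments]
    · intro h t ht
      have h2 : ∀ {l' : List (Site d)} (ht' : t < l'.length), l = l' → l[t] = l'[t] := by
        rintro l' ht' rfl; rfl
      rw [h2 (by simpa [increments] using ht) h]
      simp [increments]
  have e : {ω | ∃ k, Q (W.increments ω 0 k)} = ⋃ l : List (Site d),
      if Q l then {ω | ∀ t (ht : t < l.length), W.ξ t ω = l[t]} else ∅ := by
    ext ω
    rw [Set.mem_iUnion]
    constructor
    · rintro ⟨k, hk⟩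
      refine ⟨W.increments ω 0 k, ?_⟩
      rw [if_pos hk, Set.mem_ofPred_eq, hmem, length_increments]
    · rintro ⟨l, hl⟩
      split_ifs at hl with h
      · rw [Set.mem_ofPred_eq, hmem] at hl
        exact ⟨l.length, hl ▸ h⟩
      · exact absurd hl (Set.notMem_empty _)
  rw [e, measure_iUnion]
  · refine tsum_congr fun l => ?_
    split_ifs
    · exact measure_increments_eq h1 l
    · exact measure_empty
  · intro l l' hne
    rw [Function.onFun, Set.disjoint_left]
    intro ω h h'
    split_ifs at h h' with hl hl'
    · rw [Set.mem_ofPred_eq, hmem] at h h'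
      refine hne ?_
      have := hQ (h ▸ hl) (h' ▸ hl')
      rw [h, h', this]
    all_goals simp_all
  · intro l
    split_ifs
    · have : {ω | ∀ t (ht : t < l.length), W.ξ t ω = l[t]} =
          ⋂ t : ℕ, ⋂ ht : t < l.length, W.ξ t ⁻¹' {l[t]} := by
        ext ω; simp
      rw [this]
      exact MeasurableSet.iInter fun t => MeasurableSet.iInter fun ht =>
        h1.meas t (measurableSet_singleton _)
    · exact .empty

open Classical in
/-- The distribution of the displacement of an excursion from a level, on the event that the walk
returns to that level. -/
def excursionLaw (W : ConstrainedWalk d Ω) (P : Measure Ω) (v : Site d) : ℝ≥0∞ :=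
  ∑' e : List (Site d), if IsExcursion e ∧ e.sum = v then (e.map (W.stepLaw P)).prod else 0

open Classical in
/-- The expected number of visits of the level `0` by the walk started at `0`, before the
environment at level `0` stops it. -/
def levelSojourn (W : ConstrainedWalk d Ω) (P : Measure Ω) : ℝ≥0∞ :=
  ∑' l : List (Site d), if l.sum 0 = 0 then
    (l.map (W.stepLaw P)).prod * W.envWeight P ((trace 0 l).filter fun x => x 0 = 0) else 0

-- Strip off the first excursion and use induction. Only the visits of the level enter the weight,
-- and these are the endpoints of the excursions, that is, the positions of a walk with law
-- `excursionLaw`. Excursions are nonempty, so a path of length at most `N` contains at most `N` of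
-- them.
open Classical in
theorem tsum_level_le_lifetime (N : ℕ) (c : Multiset (Site d)) {x : Site d} (hx : x 0 = 0) :
    (∑' l : List (Site d), if l.sum 0 = 0 ∧ l.length ≤ N then (l.map (W.stepLaw P)).prod *
      W.envWeight P (c + (visited x l).filter fun x => x 0 = 0) else 0) ≤
      lifetime (W.excursionLaw P) (W.envWeight P) N c x := by
  induction N generalizing c x with
  | zero =>
    rw [tsum_eq_single []]
    · simp [visited, lifetime]
    · intro l hl
      rw [if_neg]
      rintro ⟨-, h⟩
      exact hl (List.length_eq_zero_iff.1 (Nat.le_zero.1 h))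
  | succ N ih =>
    rw [ENNReal.tsum_eq_add_tsum_ite [], lifetime]
    refine add_le_add (by simp [visited]) ?_
    have hstep : ∑' v, W.excursionLaw P v *
        lifetime (W.excursionLaw P) (W.envWeight P) N ((x + v) ::ₘ c) (x + v) =
        ∑' e : List (Site d), if IsExcursion e then (e.map (W.stepLaw P)).prod *
          lifetime (W.excursionLaw P) (W.envWeight P) N ((x + e.sum) ::ₘ c) (x + e.sum) else 0 := by
      simp only [excursionLaw, ← ENNReal.tsum_mul_right]
      rw [ENNReal.tsum_comm]
      refine tsum_congr fun e => ?_
      rw [tsum_eq_single e.sum]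
      · simp
      · intro v hv
        rw [if_neg fun h => hv h.2.symm, zero_mul]
    rw [hstep]
    have hle : ∀ e : List (Site d), (if IsExcursion e then (e.map (W.stepLaw P)).prod *
          (∑' l : List (Site d), if l.sum 0 = 0 ∧ l.length ≤ N then (l.map (W.stepLaw P)).prod *
            W.envWeight P ((x + e.sum) ::ₘ c +
              (visited (x + e.sum) l).filter fun x => x 0 = 0) else 0) else 0) ≤
        if IsExcursion e then (e.map (W.stepLaw P)).prod *
          lifetime (W.excursionLaw P) (W.envWeight P) N ((x + e.sum) ::ₘ c) (x + e.sum) else 0 := by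
      intro e
      split_ifs with he
      · gcongr
        refine ih _ ?_
        rw [Pi.add_apply, hx, he.2.1, add_zero]
      · exact le_rfl
    refine le_trans ?_ (ENNReal.tsum_le_tsum hle)
    have hprod : ∀ e : List (Site d), (if IsExcursion e then (e.map (W.stepLaw P)).prod *
          (∑' l : List (Site d), if l.sum 0 = 0 ∧ l.length ≤ N then (l.map (W.stepLaw P)).prod *
            W.envWeight P ((x + e.sum) ::ₘ c +
              (visited (x + e.sum) l).filter fun x => x 0 = 0) else 0) else 0) =
        ∑' l : List (Site d), if IsExcursion e ∧ l.sum 0 = 0 ∧ l.length ≤ N then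
          (e.map (W.stepLaw P)).prod * ((l.map (W.stepLaw P)).prod *
            W.envWeight P ((x + e.sum) ::ₘ c +
              (visited (x + e.sum) l).filter fun x => x 0 = 0)) else 0 := by
      intro e
      by_cases he : IsExcursion e
      · simp only [he, if_true, true_and, ← ENNReal.tsum_mul_left, mul_ite, mul_zero]
      · simp [he]
    rw [tsum_congr hprod, ← ENNReal.tsum_prod (f := fun e l : List (Site d) =>
      if IsExcursion e ∧ l.sum 0 = 0 ∧ l.length ≤ N then
          (e.map (W.stepLaw P)).prod * ((l.map (W.stepLaw P)).prod *
            W.envWeight P ((x + e.sum) ::ₘ c +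
              (visited (x + e.sum) l).filter fun x => x 0 = 0)) else 0)]
    set f : List (Site d) → ℝ≥0∞ := fun l => if l = [] then 0 else
      if l.sum 0 = 0 ∧ l.length ≤ N + 1 then (l.map (W.stepLaw P)).prod *
        W.envWeight P (c + (visited x l).filter fun x => x 0 = 0) else 0 with hf
    have hdec : ∀ l : Function.support f, ∃ i : List (Site d) × List (Site d),
        IsExcursion i.1 ∧ i.2.sum 0 = 0 ∧ l.1 = i.1 ++ i.2 ∧ l.1.length ≤ N + 1 := by
      rintro ⟨l, hl⟩
      have hl0 : l ≠ [] := fun h => hl (by simp [hf, h])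
      have hl1 : l.sum 0 = 0 ∧ l.length ≤ N + 1 := by
        by_contra hcon
        refine hl ?_
        simp only [hf]
        rw [if_neg hl0, if_neg hcon]
      obtain ⟨e, l', he, hl', hel⟩ := exists_excursion hl0 hl1.1
      exact ⟨(e, l'), he, hl', hel, hl1.2⟩
    choose i hi using hdec
    refine (le_of_eq (tsum_congr fun l => ?_)).trans
      (ENNReal.tsum_le_tsum_of_support_injective (f := f) i ?_ ?_)
    · by_cases h : l = [] <;> simp [hf, h]
    · intro a b hab
      have h1 := (hi a).2.2.1
      have h2 := (hi b).2.2.1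
      rw [hab, ← h2] at h1
      exact Subtype.ext h1
    · intro a
      obtain ⟨he, hl', hel, hlen⟩ := hi a
      have hpos := List.length_pos_of_ne_nil he.1
      have hlen' : (i a).2.length ≤ N := by
        rw [hel, List.length_append] at hlen
        omega
      rw [if_pos ⟨he, hl', hlen'⟩]
      have ha0 : a.1 ≠ [] := by
        rw [hel]
        simp [he.1]
      have ha1 : a.1.sum 0 = 0 := by
        rw [hel, List.sum_append, Pi.add_apply, he.2.1, hl', add_zero]
      simp only [hf]
      rw [if_neg ha0, if_pos ⟨ha1, hlen⟩, hel, List.map_append, List.prod_append, mul_assoc,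
        visited_append, Multiset.filter_add, filter_visited_excursion he hx, ← add_assoc,
        add_comm c, Multiset.singleton_add]

theorem levelSojourn_le {B : ℝ≥0∞}
    (hB : ∀ N, lifetime (W.excursionLaw P) (W.envWeight P) N {0} 0 ≤ B) :
    W.levelSojourn P ≤ B := by
  classical
  rw [levelSojourn, ENNReal.tsum_eq_iSup_sum]
  refine iSup_le fun s => ?_
  refine le_trans ?_ ((tsum_level_le_lifetime (W := W) (P := P) (s.sup List.length) {0}
    (x := 0) rfl).trans (hB _))
  refine le_trans (Finset.sum_le_sum fun l hl => ?_) (ENNReal.sum_le_tsum s)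
  by_cases h : l.sum 0 = 0
  · rw [if_pos h, if_pos ⟨h, Finset.le_sup (f := List.length) hl⟩, trace,
      Multiset.filter_cons_of_pos (p := fun x : Site d => x 0 = 0) _ rfl, ← Multiset.singleton_add]
  · rw [if_neg h]
    exact zero_le

theorem increments_sum (ω : Ω) (k : ℕ) :
    (W.increments ω 0 k).sum = ∑ j ∈ Finset.range k, W.ξ j ω := by
  induction k with
  | zero => simp [increments]
  | succ k ih =>
    rw [Finset.sum_range_succ, ← ih]
    simp [increments, List.range_succ]

theorem increments_take (ω : Ω) {t k : ℕ} (h : t ≤ k) :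
    (W.increments ω 0 k).take t = W.increments ω 0 t := by
  rw [increments, increments, ← List.map_take, List.take_range, min_eq_left h]

theorem isExcursion_increments_unique {ω : Ω} {k k' : ℕ} (h : IsExcursion (W.increments ω 0 k))
    (h' : IsExcursion (W.increments ω 0 k')) : k = k' := by
  have key : ∀ {k k' : ℕ}, IsExcursion (W.increments ω 0 k) → IsExcursion (W.increments ω 0 k') →
      k' ≤ k := by
    intro k k' h h'
    by_contra hcon
    push Not at hcon
    have hk : 0 < k := by
      have := List.length_pos_of_ne_nil h.1
      rwa [length_increments] at this
    refine h'.2.2 k hk (by rwa [length_increments]) ?_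
    rw [increments_take ω hcon.le]
    exact h.2.1
  exact le_antisymm (key h' h) (key h h')

theorem exists_isExcursion_iff {ω : Ω} {k : ℕ} :
    IsExcursion (W.increments ω 0 k) ↔ W.returnLevel ω = k ∧ 0 < k := by
  rw [returnLevel, sInf_image_eq_coe]
  simp only [Set.mem_ofPred_eq, ← increments_sum]
  constructor
  · intro h
    have hk : 0 < k := by
      have := List.length_pos_of_ne_nil h.1
      rwa [length_increments] at this
    refine ⟨⟨⟨hk, h.2.1⟩, ?_⟩, hk⟩
    rintro t ht ⟨ht0, hts⟩
    refine h.2.2 t ht0 (by rwa [length_increments]) ?_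
    rwa [increments_take ω ht.le]
  · rintro ⟨⟨⟨hk, h1⟩, h2⟩, -⟩
    refine ⟨fun h => ?_, h1, fun t ht0 ht h => ?_⟩
    · have := congrArg List.length h
      rw [length_increments] at this
      simp at this
      omega
    · rw [length_increments] at ht
      rw [increments_take ω ht.le] at h
      exact h2 t ht ⟨ht0, h⟩

theorem returnLevel_lt_top_iff {ω : Ω} :
    W.returnLevel ω < ⊤ ↔ ∃ k, IsExcursion (W.increments ω 0 k) := by
  constructor
  · intro h
    obtain ⟨k, hk⟩ := ENat.ne_top_iff_exists.1 h.ne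
    refine ⟨k, exists_isExcursion_iff.2 ⟨hk.symm, ?_⟩⟩
    have := hk.symm
    rw [returnLevel, sInf_image_eq_coe] at this
    exact this.1.1
  · rintro ⟨k, hk⟩
    rw [(exists_isExcursion_iff.1 hk).1]
    exact ENat.natCast_lt_top k

theorem tsum_excursionLaw (h1 : W.A1 P) :
    ∑' v, W.excursionLaw P v = P {ω | W.returnLevel ω < ⊤} := by
  classical
  simp only [returnLevel_lt_top_iff]
  rw [measure_increments_mem h1 isExcursion_increments_unique]
  simp only [excursionLaw]
  rw [ENNReal.tsum_comm]
  refine tsum_congr fun e => ?_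
  rw [tsum_eq_single e.sum]
  · simp
  · intro v hv
    rw [if_neg fun h => hv h.2.symm]

/-- An excursion with zero displacement makes the first return to the level a first return to the
origin. This links the degenerate case with the hypothesis on the mean in A4. -/
theorem excursionLaw_zero_le (h1 : W.A1 P) : W.excursionLaw P 0 ≤
    P {ω | W.returnLevel ω = W.returnOrigin ω ∧ W.returnOrigin ω < ⊤} := by
  classical
  refine le_trans (le_of_eq ?_) ((measure_increments_mem h1
    (Q := fun l => IsExcursion l ∧ l.sum = 0)
    fun h h' => isExcursion_increments_unique h.1 h'.1).symm.le.trans (measure_mono ?_))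
  · rw [excursionLaw]
    congr!
  rintro ω ⟨k, hk, hk0⟩
  have h2 := exists_isExcursion_iff.1 hk
  have h3 : W.returnOrigin ω = k := by
    have h4 := h2.1
    rw [returnLevel, sInf_image_eq_coe] at h4
    rw [returnOrigin, sInf_image_eq_coe]
    refine ⟨⟨h2.2, by rw [← increments_sum, hk0]⟩, fun t ht h => h4.2 t ht ⟨h.1, ?_⟩⟩
    rw [h.2]
    rfl
  refine ⟨h2.1.trans h3.symm, ?_⟩
  rw [h3]
  exact ENat.natCast_lt_top k

theorem exists_loop_of_returnOrigin (h1 : W.A1 P) (h : 0 < P {ω | W.returnOrigin ω < ⊤}) :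
    ∃ l : List (Site d), l ≠ [] ∧ l.sum = 0 ∧ (l.map (W.stepLaw P)).prod ≠ 0 := by
  by_contra hcon
  push Not at hcon
  refine h.ne' (measure_mono_null (t := ⋃ l ∈ {l : List (Site d) | l ≠ [] ∧ l.sum = 0},
    {ω | ∀ t (ht : t < l.length), W.ξ t ω = l[t]}) ?_ ?_)
  · intro ω hω
    rw [Set.mem_ofPred_eq, returnOrigin, sInf_image_lt_top] at hω
    obtain ⟨t, ht, hts⟩ := hω
    simp only [Set.mem_iUnion]
    refine ⟨W.increments ω 0 t, ⟨fun h => ?_, ?_⟩, fun s hs => by simp [increments]⟩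
    · have := congrArg List.length h
      rw [length_increments] at this
      simp at this
      omega
    · rw [increments_sum, hts]
  · refine (measure_biUnion_null_iff (Set.to_countable _)).2 fun l hl => ?_
    rw [measure_increments_eq h1]
    exact hcon l hl.1 hl.2

/-- Cut at its visits of the level, a possible loop of the original walk becomes a possible loop of
the walk of excursions. -/
theorem exists_excursion_loop {l : List (Site d)} (hsum : l.sum 0 = 0)
    (hl : (l.map (W.stepLaw P)).prod ≠ 0) : ∃ l' : List (Site d), l'.sum = l.sum ∧
      (∀ v ∈ l', W.excursionLaw P v ≠ 0) ∧ (l ≠ [] → l' ≠ []) := by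
  classical
  induction hn : l.length using Nat.strong_induction_on generalizing l with
  | _ n ih =>
    by_cases h0 : l = []
    · exact ⟨[], by simp [h0]⟩
    · obtain ⟨e, r, he, hr, rfl⟩ := exists_excursion h0 hsum
      rw [List.map_append, List.prod_append] at hl
      have hpos := List.length_pos_of_ne_nil he.1
      obtain ⟨r', hr1, hr2, -⟩ := ih r.length (by rw [List.length_append] at hn; omega) hr
        (right_ne_zero_of_mul hl) rfl
      refine ⟨e.sum :: r', by simp [hr1], ?_, by simp⟩
      intro v hv
      rcases List.mem_cons.1 hv with rfl | hv
      · refine fun h => left_ne_zero_of_mul hl ?_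
        have := (ENNReal.tsum_eq_zero.1 h) e
        rwa [if_pos ⟨he, rfl⟩] at this
      · exact hr2 v hv

variable [IsProbabilityMeasure P]

/-- Every site with more than `h` visits costs at least the factor `P(H(0) ≥ h + 1)`; the other
factors are at most one. -/
theorem envWeight_le_pow_numMulti (h : ℕ) (c : Multiset (Site d)) :
    W.envWeight P c ≤ W.limitTail P (h + 1) ^ numMulti h c := by
  classical
  have e : numMulti h c = (c.toFinset.filter fun x => h < c.count x).card := by
    rw [numMulti]
    congr!
  rw [e, envWeight]
  calc ∏ x ∈ c.toFinset, W.limitTail P (c.count x)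
      ≤ ∏ x ∈ c.toFinset, if h < c.count x then W.limitTail P (h + 1) else 1 := by
        refine Finset.prod_le_prod' fun x _ => ?_
        split_ifs with hx
        · exact limitTail_anti hx
        · exact limitTail_le_one _
    _ = _ := by rw [← Finset.prod_filter, Finset.prod_const]

theorem exists_limitTail_lt_one (h2 : W.A2 P) (hfin : 0 < P {ω | W.H 0 ω < ⊤}) :
    ∃ h, W.limitTail P (h + 1) < 1 := by
  by_contra hcon
  push Not at hcon
  refine hfin.ne' (measure_mono_null (t := ⋃ h : ℕ, {ω | ((h + 1 : ℕ) : ℕ∞) ≤ W.H 0 ω}ᶜ) ?_ ?_)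
  · intro ω hω
    obtain ⟨k, hk⟩ := ENat.ne_top_iff_exists.1 (show W.H 0 ω < ⊤ from hω).ne
    refine Set.mem_iUnion.2 ⟨k, ?_⟩
    rw [Set.mem_compl_iff, Set.mem_ofPred_eq, ← hk]
    exact_mod_cast (Nat.lt_succ_self k).not_ge
  · refine measure_iUnion_null fun h => ?_
    rw [prob_compl_eq_zero_iff]
    · exact le_antisymm prob_le_one (hcon h)
    · exact h2.meas_env 0 (.of_discrete (s := {k | ((h + 1 : ℕ) : ℕ∞) ≤ k}))

theorem sum_limitTail_le (h2 : W.A2 P) (N : ℕ) :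
    ∑ k ∈ Finset.range N, W.limitTail P (k + 1) ≤ ∫⁻ ω, (W.H 0 ω : ℝ≥0∞) ∂P := by
  classical
  have hm : ∀ k : ℕ, MeasurableSet {ω | ((k + 1 : ℕ) : ℕ∞) ≤ W.H 0 ω} := fun k =>
    h2.meas_env 0 (.of_discrete (s := {j | ((k + 1 : ℕ) : ℕ∞) ≤ j}))
  calc ∑ k ∈ Finset.range N, W.limitTail P (k + 1)
      = ∫⁻ ω, ∑ k ∈ Finset.range N,
          {ω | ((k + 1 : ℕ) : ℕ∞) ≤ W.H 0 ω}.indicator (fun _ => (1 : ℝ≥0∞)) ω ∂P := by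
        rw [lintegral_finsetSum _ fun k _ => measurable_const.indicator (hm k)]
        refine Finset.sum_congr rfl fun k _ => ?_
        rw [lintegral_indicator_const (hm k), one_mul]
        rfl
    _ ≤ _ := by
        refine lintegral_mono fun ω => ?_
        simp only [Set.indicator_apply, Set.mem_ofPred_eq, Finset.sum_boole]
        generalize W.H 0 ω = h
        induction h using ENat.recTopCoe with
        | top => simp
        | coe m =>
          rw [ENat.toENNReal_coe]
          norm_cast
          calc _ ≤ (Finset.range m).card := Finset.card_le_card fun k hk => by
                simp only [Finset.mem_filter, Finset.mem_range] at hk ⊢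
                have := hk.2
                omega
            _ = m := Finset.card_range m

theorem levelSojourn_ne_top (h1 : W.A1 P) (h2 : W.A2 P) (h4 : W.A4 P)
    (hfin : P {ω | W.returnLevel ω < ⊤} = 1 → 0 < P {ω | W.H 0 ω < ⊤}) :
    W.levelSojourn P ≠ ⊤ := by
  have hsum := tsum_excursionLaw (P := P) h1
  have hle : ∑' v, W.excursionLaw P v ≤ 1 := hsum ▸ prob_le_one
  -- Total mass below one means that the walk may never come back to the level.
  rcases hle.lt_or_eq with hlt | heq
  · refine ne_top_of_le_ne_top (b := (1 - ∑' v, W.excursionLaw P v)⁻¹) ?_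
      (levelSojourn_le fun N => (lifetime_le_geometric envWeight_le_one N {0} 0).trans ?_)
    · rw [ENNReal.inv_ne_top]
      exact (tsub_pos_of_lt hlt).ne'
    · rw [← ENNReal.tsum_geometric]
      exact ENNReal.sum_le_tsum _
  · have hret : P {ω | W.returnLevel ω < ⊤} = 1 := hsum ▸ heq
    -- In the recurrent case it matters whether excursions can have a nonzero displacement. If not,
    -- the visits pile up at one site and the mean of the limit is needed.
    by_cases h0 : ∀ v, v ≠ 0 → W.excursionLaw P v = 0
    · have hp0 : W.excursionLaw P 0 = 1 := by
        rw [← heq, tsum_eq_single 0 fun v hv => h0 v hv]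
      have hH := h4.finite_mean (le_antisymm prob_le_one (hp0 ▸ excursionLaw_zero_le h1))
      refine ne_top_of_le_ne_top hH.ne (levelSojourn_le fun N =>
        (lifetime_le_of_const h0 hp0.le N {0} 0).trans
          (le_trans (Finset.sum_le_sum fun k _ => ?_) (sum_limitTail_le h2 (N + 1))))
      have e : ({0} : Multiset (Site d)) + Multiset.replicate k 0 =
          Multiset.replicate (k + 1) 0 := by
        rw [Multiset.replicate_succ, Multiset.singleton_add]
      rw [e, envWeight, Multiset.toFinset_replicate, if_neg (Nat.succ_ne_zero k),
        Finset.prod_singleton, Multiset.count_replicate_self]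
    · push Not at h0
      obtain ⟨v, hv, hpv⟩ := h0
      obtain ⟨l₀, hl₀, hl₀s, hl₀p⟩ := exists_loop_of_returnOrigin h1 (h4.returns hret)
      obtain ⟨l, hls, hlp, hl⟩ := exists_excursion_loop (l := l₀) (by rw [hl₀s]; rfl) hl₀p
      rw [hl₀s] at hls
      -- If `v` were the only possible displacement, the loop would be a positive multiple of `v`
      -- equal to zero, although the lattice is torsion-free.
      have hu : ∃ u, v ≠ u ∧ W.excursionLaw P u ≠ 0 := by
        by_contra hcon
        push Not at hcon
        have h5 : ∀ u ∈ l, u = v := fun u hu => by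
          by_contra hne
          exact hlp u hu (hcon u (Ne.symm hne))
        have h6 := List.eq_replicate_of_mem h5
        rw [h6, List.sum_replicate] at hls
        rcases smul_eq_zero.1 hls with h7 | h7
        · exact hl hl₀ (List.length_eq_zero_iff.1 h7)
        · exact hv h7
      obtain ⟨u, huv, hpu⟩ := hu
      obtain ⟨h, hγ⟩ := exists_limitTail_lt_one h2 (hfin hret)
      obtain ⟨B, hB, hBle⟩ := lifetime_bounded_of_returning heq huv hpv hpu (hl hl₀) hls hlp h hγ
      exact ne_top_of_le_ne_top hB (levelSojourn_le fun N =>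
        (lifetime_mono (envWeight_le_pow_numMulti h) N {0} 0).trans (hBle N {0} 0))

end ConstrainedWalk

/-! ### Submultiplicativity of the hitting probabilities -/

theorem ENNReal.tsum_mul_tsum_mul_tsum {α β γ : Type*} (f : α → ℝ≥0∞) (g : β → ℝ≥0∞)
    (h : γ → ℝ≥0∞) : (∑' a, f a) * (∑' b, g b) * (∑' c, h c) =
      ∑' p : α × β × γ, f p.1 * g p.2.1 * h p.2.2 := by
  rw [ENNReal.tsum_prod (f := fun a (q : β × γ) => f a * g q.1 * h q.2), mul_assoc,
    ← ENNReal.tsum_mul_right]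
  refine tsum_congr fun a => ?_
  rw [ENNReal.tsum_prod (f := fun b c => f a * g b * h c), ← ENNReal.tsum_mul_right,
    ← ENNReal.tsum_mul_left]
  refine tsum_congr fun b => ?_
  rw [ENNReal.tsum_mul_left, mul_assoc]

namespace SitePath

variable {d : ℕ} [NeZero d]

/-- After its last visit of `j`, the path cannot be below `j`: a skip-free climb to `j + m` would
visit `j` once more. The argument runs backwards in time from `N`. -/
theorem SkipFree.exists_firstAt_last {y : ℕ → Site d} (hy : SkipFree y) {j m N : ℕ}
    (hN : FirstAt (j + m) N y) : ∃ K σ, K ≤ σ ∧ σ ≤ N ∧ FirstAt j K y ∧ y σ 0 = j ∧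
      ∀ t, σ < t → t ≤ N → (j : ℤ) < y t 0 := by
  classical
  have hN2 := hN.2
  push_cast at hN2
  obtain ⟨K, hK⟩ := exists_hit_eq (hit_lt_top.2 (⟨N, by omega⟩ : ∃ t, (j : ℤ) ≤ y t 0))
  have hKj := hy.firstAt hK
  have hKN : K ≤ N := by
    by_contra hcon
    have := hKj.1 N (by omega)
    omega
  set σ := Nat.findGreatest (fun t => y t 0 = (j : ℤ)) N with hσ
  have h1 : y σ 0 = j := Nat.findGreatest_spec (P := fun t => y t 0 = (j : ℤ)) hKN hKj.2
  have h2 : ∀ t, σ < t → t ≤ N → y t 0 ≠ j := fun t ht htN =>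
    Nat.findGreatest_is_greatest ht htN
  have h3 : ∀ i t, t + i = N → σ < t → (j : ℤ) < y t 0 := by
    intro i
    induction i with
    | zero =>
      intro t ht hσt
      obtain rfl : t = N := ht
      have := h2 t hσt le_rfl
      omega
    | succ i ih =>
      intro t ht hσt
      have := ih (t + 1) (by omega) (by omega)
      have h4 := hy.2 t
      have h5 := h2 t hσt (by omega)
      omega
  exact ⟨K, σ, Nat.le_findGreatest hKN hKj.2, Nat.findGreatest_le N, hKj, h1,
    fun t ht htN => h3 (N - t) t (by omega) ht⟩

theorem isStopping_firstAt (j : ℕ) : IsStopping fun K (y : ℕ → Site d) => FirstAt j K y :=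
  ⟨fun h hK => hK.congr h, fun h h' => by
    have := h.hit_eq.symm.trans h'.hit_eq
    exact_mod_cast this⟩

theorem isStopping_hit (j : ℕ) {Q : (ℕ → Site d) → Prop}
    (hQ : ∀ {K : ℕ} {y y' : ℕ → Site d}, hit j y = K → (∀ t ≤ K, y t = y' t) → Q y → Q y') :
    IsStopping fun K (y : ℕ → Site d) => hit j y = K ∧ Q y :=
  ⟨fun h hK => ⟨hit_congr h hK.1, hQ hK.1 h hK.2⟩, fun h h' => by
    have := h.1.symm.trans h'.1
    exact_mod_cast this⟩

theorem isStopping_staysUntil (j : ℕ) : IsStopping fun K (y : ℕ → Site d) => StaysUntil j K y :=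
  ⟨fun h hK => hK.congr h, fun h h' => by
    have := h.1.symm.trans h'.1
    exact_mod_cast this⟩

theorem isStopping_isInit (j : ℕ) :
    IsStopping fun K (y : ℕ → Site d) => hit j y = K ∧ IsInit j y :=
  isStopping_hit j fun hK h hy => hy.congr hK h

theorem isStopping_isBlock (j : ℕ) :
    IsStopping fun K (y : ℕ → Site d) => hit j y = K ∧ IsBlock j y :=
  isStopping_hit j fun hK h hy => hy.congr hK h

end SitePath

namespace ConstrainedWalk

variable {d : ℕ} {Ω : Type*} [NeZero d] [MeasurableSpace Ω] {W : ConstrainedWalk d Ω}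
  {P : Measure Ω}

theorem ae_skipFree (h1 : W.A1 P) (h2 : W.A2 P) : ∀ᵐ ω ∂P, SkipFree (W.path ω) := by
  have hstep : ∀ t, ∀ᵐ ω ∂P, W.ξ t ω 0 ≤ 1 := fun t =>
    (h1.ident t).symm.ae_mem_snd (t := {v : Site d | v 0 ≤ 1}) .of_discrete h1.skip_free
  filter_upwards [h2.start, ae_all_iff.2 hstep] with ω h hξ
  refine ⟨by rwa [path_zero], fun t => ?_⟩
  rw [path_succ, Pi.add_apply]
  linarith [hξ t]

theorem skipFree_of_pathWeight_ne_zero (h1 : W.A1 P) (h2 : W.A2 P) {z : Site d}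
    {l : List (Site d)} (h : W.pathWeight P z l ≠ 0) : SkipFree (listPath z l) := by
  have hne : ∃ ω ∈ W.startsWith z l, SkipFree (W.path ω) := by
    by_contra hcon
    push Not at hcon
    exact h (measure_mono_null (fun ω hω => hcon ω hω.1) (ae_iff.1 (ae_skipFree h1 h2)))
  obtain ⟨ω, hω, hs⟩ := hne
  have hp := fun t ht => path_eq_of_startsWith (t := t) hω ht
  refine ⟨by rw [← hp 0 (Nat.zero_le _)]; exact hs.1, fun t => ?_⟩
  rcases lt_or_ge t l.length with ht | ht
  · rw [← hp t ht.le, ← hp (t + 1) ht]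
    exact hs.2 t
  · rw [listPath, listPath, List.take_of_length_le ht, List.take_of_length_le (by omega)]
    linarith

theorem zeroEnv_zeroEnv : W.zeroEnv.zeroEnv = W.zeroEnv := by
  have : W.zeroEnv.zeroEnv.H = W.zeroEnv.H := by
    ext1 x
    by_cases hx : 0 ≤ x 0
    · rw [zeroEnv_H hx]
    · rw [zeroEnv_H_of_not hx, zeroEnv_H_of_not hx]
  calc W.zeroEnv.zeroEnv = ⟨W.zeroEnv.S₀, W.zeroEnv.ξ, W.zeroEnv.zeroEnv.H⟩ := rfl
    _ = W.zeroEnv := by rw [this]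

theorem zeroEnv_path_zero (ω : Ω) : W.zeroEnv.path ω 0 = 0 := by rw [path_zero]; rfl

/-- Under P_0 a visit of a negative height is fatal, so survival implies the half-space condition in
`StaysUntil`. -/
theorem zeroEnv_path_nonneg {ω : Ω} {K : ℕ}
    (h : (K : ℕ∞) < death (W.zeroEnv.path ω) (W.zeroEnv.env ω)) :
    ∀ t ≤ K, 0 ≤ W.zeroEnv.path ω t 0 := by
  intro t ht
  by_contra hcon
  have h1 := coe_lt_death_iff.1 h t ht
  rw [env, zeroEnv_H_of_not hcon] at h1
  have h2 : visits (W.zeroEnv.path ω) K (W.zeroEnv.path ω t) = 0 := by simpa using h1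
  rw [visits, Finset.card_eq_zero, Finset.filter_eq_empty_iff] at h2
  exact h2 (Finset.mem_range.2 (Nat.lt_succ_of_le ht)) rfl

variable [IsProbabilityMeasure P]

theorem levelSojourn_zeroEnv : W.zeroEnv.levelSojourn P = W.levelSojourn P := by
  simp only [levelSojourn, envWeight_zeroEnv]
  rfl

/-- Cut the trajectory at the first and at the last visit of level `j`. The first piece reaches `j`,
the middle one runs from level to level, and the last one stays above `j` and gains height `m`. The
three pieces determine the trajectory, so comparing sums over an injection is enough, with
`pathWeight_append_le` for each term. -/
theorem measure_pathEvent_firstAt_add_le (h1 : W.A1 P) (h2 : W.A2 P) (h3 : W.A3 P) (j m : ℕ) :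
    P (W.pathEvent (FirstAt (j + m))) ≤
      P (W.pathEvent (FirstAt j)) * W.levelSojourn P * P (W.zeroEnv.pathEvent (StaysUntil m)) := by
  classical
  rw [measure_pathEvent h1 h2 (isStopping_firstAt (j + m)),
    measure_pathEvent h1 h2 (isStopping_firstAt j),
    measure_pathEvent_zeroEnv h1 h2 h3 (isStopping_staysUntil m), levelSojourn,
    ENNReal.tsum_mul_tsum_mul_tsum]
  set f : Site d × List (Site d) → ℝ≥0∞ := fun i =>
    if FirstAt (j + m) i.2.length (listPath i.1 i.2) then W.pathWeight P i.1 i.2 else 0 with hf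
  have hdec : ∀ i : Function.support f, ∃ p : (Site d × List (Site d)) × List (Site d) ×
      List (Site d), i.1 = (p.1.1, p.1.2 ++ (p.2.1 ++ p.2.2)) ∧
      FirstAt j p.1.2.length (listPath p.1.1 p.1.2) ∧ p.2.1.sum 0 = 0 ∧
      StaysUntil m p.2.2.length (listPath 0 p.2.2) ∧
      ∀ t < p.2.2.length, 0 < listPath 0 p.2.2 (t + 1) 0 := by
    rintro ⟨⟨z, l⟩, hi⟩
    have hl : FirstAt (j + m) l.length (listPath z l) := by
      by_contra hcon
      exact hi (if_neg hcon)
    have hw : W.pathWeight P z l ≠ 0 := by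
      have : f (z, l) = W.pathWeight P z l := if_pos hl
      rw [← this]
      exact hi
    obtain ⟨K, σ, hKσ, hσ, hK, hσj, hlast⟩ :=
      (skipFree_of_pathWeight_ne_zero h1 h2 hw).exists_firstAt_last hl
    have e1 : (l.take σ).take K ++ (l.take σ).drop K = l.take σ := List.take_append_drop _ _
    have e2 : l.take σ ++ l.drop σ = l := List.take_append_drop _ _
    have e3 : (l.take σ).length = σ := by rw [List.length_take]; omega
    have e4 : ((l.take σ).take K).length = K := by rw [List.length_take]; omega
    have e5 : ∀ t, z + (l.take σ).sum + ((l.drop σ).take t).sum = listPath z l (σ + t) := by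
      intro t
      rw [listPath, List.take_add, List.sum_append, add_assoc]
    have e6 : z + (l.take σ).sum = listPath z l σ := rfl
    have e7 : ∀ t, (j : ℤ) + listPath 0 (l.drop σ) t 0 = listPath z l (σ + t) 0 := by
      intro t
      rw [← e5, e6, Pi.add_apply, hσj, listPath, zero_add]
    refine ⟨((z, (l.take σ).take K), (l.take σ).drop K, l.drop σ), ?_, ?_, ?_, ⟨?_, ?_⟩, ?_⟩
    · simp only
      rw [← List.append_assoc, e1, e2]
    · simp only
      rw [e4]
      refine hK.congr fun t ht => ?_
      rw [listPath, listPath, List.take_take, List.take_take, min_eq_left (by omega),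
        min_eq_left ht]
    · simp only
      have h3 : z + ((l.take σ).take K).sum + ((l.take σ).drop K).sum = listPath z l σ := by
        rw [add_assoc, ← List.sum_append, e1, e6]
      have h4 : z + ((l.take σ).take K).sum = listPath z l K := by
        rw [List.take_take, min_eq_left hKσ, listPath]
      have h5 := congrFun h3 0
      rw [h4, Pi.add_apply, hK.2, hσj] at h5
      linarith
    · simp only
      rw [hit_eq_coe]
      have h3 := hl.2
      have h4 := hl.1
      push_cast at h3 h4
      constructor
      · have := e7 (l.drop σ).length
        rw [List.length_drop, Nat.add_sub_cancel' hσ, h3] at this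
        rw [List.length_drop]
        linarith
      · intro t ht
        rw [List.length_drop] at ht
        have := h4 (σ + t) (by omega)
        have := e7 t
        linarith
    · intro t ht
      simp only [List.length_drop] at ht ⊢
      rcases Nat.eq_zero_or_pos t with rfl | htpos
      · rw [listPath_zero]
        rfl
      · have h3 := hlast (σ + t) (by omega) (by omega)
        have := e7 t
        linarith
    · intro t ht
      simp only [List.length_drop] at ht ⊢
      have h3 := hlast (σ + (t + 1)) (by omega) (by omega)
      have := e7 (t + 1)
      linarith
  choose p hp using hdec
  refine ENNReal.tsum_le_tsum_of_support_injective (f := f) p ?_ ?_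
  · intro a b hab
    refine Subtype.ext ?_
    rw [(hp a).1, (hp b).1, hab]
  · intro a
    obtain ⟨e, hK, hsum, hstay, hpos⟩ := hp a
    rw [if_pos hK, if_pos hsum, if_pos hstay]
    refine le_trans ?_ (pathWeight_append_le h1 h2 h3 hK hsum hpos)
    rw [e]
    simp only [hf]
    split_ifs
    · exact le_rfl
    · exact zero_le

end ConstrainedWalk

/-! ### The renewal equation and the exponential rate -/

namespace SitePath

variable {d : ℕ} [NeZero d]

theorem isBlock_shift_iff {j i K : ℕ} {y : ℕ → Site d} (hK : FirstAt j K y) :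
    IsBlock i (shift K y) ↔ 0 < i ∧ IsSep (j + i) y j ∧ IsSep (j + i) y (j + i) ∧
      ∀ r, 0 < r → r < i → ¬ IsSep (j + i) y (j + r) := by
  have := isSep_shift (i := i) (r := 0) hK
  rw [add_zero] at this
  rw [IsBlock, this, isSep_shift hK]
  simp only [isSep_shift hK]

end SitePath

namespace ConstrainedWalk

variable {d : ℕ} {Ω : Type*} [NeZero d] [MeasurableSpace Ω] {W : ConstrainedWalk d Ω}
  {P : Measure Ω}

theorem measure_congr_of_skipFree (h1 : W.A1 P) (h2 : W.A2 P) {A B : Set Ω}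
    (h : ∀ ω, SkipFree (W.path ω) → (ω ∈ A ↔ ω ∈ B)) : P A = P B := by
  refine measure_congr ?_
  filter_upwards [ae_skipFree h1 h2] with ω hω
  exact propext (h ω hω)

/-- The event that the walk reaches a level before death. -/
theorem mem_pathEvent_firstAt {ω : Ω} (h : SkipFree (W.path ω)) {n : ℕ} :
    ω ∈ W.pathEvent (FirstAt n) ↔ hit n (W.path ω) < death (W.path ω) (W.env ω) := by
  constructor
  · rintro ⟨K, hK, hd⟩
    rwa [hK.hit_eq]
  · intro hd
    obtain ⟨K, hK⟩ := exists_hit_eq hd.lt_top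
    exact ⟨K, h.firstAt hK, hK ▸ hd⟩

theorem mem_pathEvent_hit {ω : Ω} {n : ℕ} {Q : (ℕ → Site d) → Prop} :
    ω ∈ W.pathEvent (fun K y => hit n y = K ∧ Q y) ↔
      hit n (W.path ω) < death (W.path ω) (W.env ω) ∧ Q (W.path ω) := by
  constructor
  · rintro ⟨K, ⟨hK, hQ⟩, hd⟩
    exact ⟨hK ▸ hd, hQ⟩
  · rintro ⟨hd, hQ⟩
    obtain ⟨K, hK⟩ := exists_hit_eq hd.lt_top
    exact ⟨K, ⟨hK, hQ⟩, hK ▸ hd⟩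

theorem mem_pathEvent_staysUntil {ω : Ω} {n : ℕ} :
    ω ∈ W.zeroEnv.pathEvent (StaysUntil n) ↔
      hit n (W.zeroEnv.path ω) < death (W.zeroEnv.path ω) (W.zeroEnv.env ω) := by
  constructor
  · rintro ⟨K, hK, hd⟩
    rwa [hK.1]
  · intro hd
    obtain ⟨K, hK⟩ := exists_hit_eq hd.lt_top
    exact ⟨K, ⟨hK, zeroEnv_path_nonneg (hK ▸ hd)⟩, hK ▸ hd⟩

theorem mem_pathEvent_concat {ω : Ω} {i j : ℕ} {Φ Ψ : ℕ → (ℕ → Site d) → Prop}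
    (hΦ : ∀ {K y}, Φ K y → FirstAt j K y) (hΨ : ∀ {k : ℕ} {x}, Ψ k x → hit i x = k) :
    ω ∈ W.pathEvent (fun N y => ∃ K k : ℕ, N = K + k ∧ Φ K y ∧ Ψ k (shift K y)) ↔
      hit (j + i) (W.path ω) < death (W.path ω) (W.env ω) ∧
        ∃ K k : ℕ, Φ K (W.path ω) ∧ Ψ k (shift K (W.path ω)) := by
  constructor
  · rintro ⟨_, ⟨K, k, rfl, hK, hk⟩, hd⟩
    exact ⟨(hit_shift (hΦ hK)).2 (hΨ hk) ▸ hd, K, k, hK, hk⟩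
  · rintro ⟨hd, K, k, hK, hk⟩
    exact ⟨K + k, ⟨K, k, rfl, hK, hk⟩, (hit_shift (hΦ hK)).2 (hΨ hk) ▸ hd⟩


variable [IsProbabilityMeasure P]

/-- `P_0` of the event that the level `n` is reached before death. -/
def probReach (W : ConstrainedWalk d Ω) (P : Measure Ω) (n : ℕ) : ℝ≥0∞ :=
  P (W.zeroEnv.pathEvent (StaysUntil n))

/-- `P_0` of the event that the level `n` is reached before death, at the end of a block. -/
def probBlock (W : ConstrainedWalk d Ω) (P : Measure Ω) (n : ℕ) : ℝ≥0∞ :=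
  P (W.zeroEnv.pathEvent fun K y => hit n y = K ∧ IsBlock n y)

/-- `P_*` of the event that the level `n` is reached before death, at the end of an initial
block. -/
def probInit (W : ConstrainedWalk d Ω) (P : Measure Ω) (n : ℕ) : ℝ≥0∞ :=
  P (W.pathEvent fun K y => hit n y = K ∧ IsInit n y)

theorem probEtaZero_eq (h1 : W.A1 P) (h2 : W.A2 P) (n : ℕ) :
    W.probEtaZero P n = (W.probInit P n).toReal := by
  rw [probEtaZero, probInit, Measure.real]
  congr 1
  refine measure_congr_of_skipFree h1 h2 fun ω hω => ?_
  rw [mem_pathEvent_hit]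
  exact etaStar_eq_zero_iff hω

theorem probKappaZero_eq (n : ℕ) : W.probKappaZero P n = (W.probBlock P n).toReal := by
  rw [probKappaZero, probBlock, Measure.real]
  congr 2
  ext ω
  rw [mem_pathEvent_hit]
  exact kappaStar_eq_zero_iff

theorem probReach_eq (h1 : W.A1 P) (h2 : W.A2 P) (h3 : W.A3 P) (n : ℕ) :
    W.probReach P n = P (W.zeroEnv.pathEvent (FirstAt n)) :=
  measure_congr_of_skipFree (zeroEnv_a1 h1) (zeroEnv_a2 h2 h3) fun ω hω => by
    rw [mem_pathEvent_staysUntil, mem_pathEvent_firstAt hω]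

theorem probReach_add_le (h1 : W.A1 P) (h2 : W.A2 P) (h3 : W.A3 P) (m n : ℕ) :
    W.probReach P (m + n) ≤ W.levelSojourn P * W.probReach P m * W.probReach P n := by
  have := measure_pathEvent_firstAt_add_le (zeroEnv_a1 h1) (zeroEnv_a2 h2 h3) (zeroEnv_a3 h3) m n
  rwa [zeroEnv_zeroEnv, levelSojourn_zeroEnv, ← probReach_eq h1 h2 h3, ← probReach_eq h1 h2 h3,
    ← probReach, mul_comm (W.probReach P m)] at this

theorem measure_pathEvent_firstAt_le (h1 : W.A1 P) (h2 : W.A2 P) (h3 : W.A3 P) (n : ℕ) :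
    P (W.pathEvent (FirstAt n)) ≤ W.levelSojourn P * W.probReach P n := by
  have := measure_pathEvent_firstAt_add_le h1 h2 h3 0 n
  rw [zero_add] at this
  refine this.trans ?_
  rw [mul_assoc]
  exact mul_le_of_le_one_left' prob_le_one

/-- The event that `m + n` is reached contains the event that, in addition, `m` is separating, whose
probability is exactly the product. -/
theorem probReach_mul_le (h1 : W.A1 P) (h2 : W.A2 P) (h3 : W.A3 P) (m n : ℕ) :
    W.probReach P m * W.probReach P n ≤ W.probReach P (m + n) := by
  have h := measure_pathEvent_shift (zeroEnv_a1 h1) (zeroEnv_a2 h2 h3) (zeroEnv_a3 h3)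
    (isStopping_firstAt m) (isStopping_staysUntil n) (j := m) (fun _ _ h => h)
    (fun _ _ _ h => h.2)
  rw [zeroEnv_zeroEnv, ← probReach_eq h1 h2 h3, ← probReach] at h
  rw [← h]
  refine measure_mono fun ω hω => ?_
  rw [mem_pathEvent_staysUntil]
  obtain ⟨_, ⟨K, k, rfl, hK, hk⟩, hd⟩ := hω
  rwa [(hit_shift hK).2 hk.1]

theorem probReach_zero (h1 : W.A1 P) (h2 : W.A2 P) (h3 : W.A3 P) : W.probReach P 0 = 1 := by
  classical
  refine le_antisymm prob_le_one ?_
  rw [probReach, measure_pathEvent_zeroEnv h1 h2 h3 (isStopping_staysUntil 0)]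
  refine le_trans (le_of_eq ?_) (ENNReal.le_tsum [])
  rw [if_pos ⟨by rw [hit_eq_coe]; simp [listPath], by simp [listPath]⟩,
    pathWeight_zeroEnv h1 h2 h3]
  · simp [trace, visited, envWeight_singleton h3]
  · simp [trace, visited]

theorem probReach_one_pos (h1 : W.A1 P) (h2 : W.A2 P) (h3 : W.A3 P) : 0 < W.probReach P 1 := by
  classical
  obtain ⟨v, hv, hv0⟩ : ∃ v : Site d, v 0 = 1 ∧ W.stepLaw P v ≠ 0 := by
    by_contra hcon
    push Not at hcon
    refine h1.up.ne' (measure_mono_null (t := ⋃ v ∈ {v : Site d | v 0 = 1}, {ω | W.ξ 0 ω = v})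
      ?_ ((measure_biUnion_null_iff (Set.to_countable _)).2 fun v hv => hcon v hv))
    intro ω hω
    simp only [Set.mem_iUnion]
    exact ⟨W.ξ 0 ω, hω, rfl⟩
  have hstay : StaysUntil 1 [v].length (listPath 0 [v]) := by
    refine ⟨?_, ?_⟩
    · rw [hit_eq_coe]
      simp [listPath, hv]
    · intro t ht
      have : t = 0 ∨ t = 1 := by simp at ht; omega
      rcases this with rfl | rfl <;> simp [listPath, hv]
  have hne : (0 : Site d) ≠ v := by
    rintro rfl
    simp at hv
  rw [probReach, measure_pathEvent_zeroEnv h1 h2 h3 (isStopping_staysUntil 1)]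
  refine lt_of_lt_of_le (pos_iff_ne_zero.2 hv0) (le_trans (le_of_eq ?_) (ENNReal.le_tsum [v]))
  rw [if_pos hstay, pathWeight_zeroEnv h1 h2 h3]
  · have e : trace 0 [v] = {0} + {v} := by simp [trace, visited]
    rw [e, envWeight_add (by simpa using hne), envWeight_singleton h3, envWeight_singleton h3]
    simp
  · intro x hx
    have : x = 0 ∨ x = v := by simpa [trace, visited] using hx
    rcases this with rfl | rfl
    · exact le_rfl
    · rw [hv]; exact zero_le_one

theorem probReach_pos (h1 : W.A1 P) (h2 : W.A2 P) (h3 : W.A3 P) (n : ℕ) :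
    0 < W.probReach P n := by
  induction n with
  | zero => rw [probReach_zero h1 h2 h3]; exact one_pos
  | succ n ih =>
    refine lt_of_lt_of_le ?_ (probReach_mul_le h1 h2 h3 n 1)
    exact ENNReal.mul_pos ih.ne' (probReach_one_pos h1 h2 h3).ne'

/-- Decomposition at the last separating level. -/
theorem probReach_succ (h1 : W.A1 P) (h2 : W.A2 P) (h3 : W.A3 P) (n : ℕ) :
    W.probReach P (n + 1) =
      ∑ k ∈ Finset.range (n + 1), W.probBlock P (k + 1) * W.probReach P (n - k) := by
  classical
  have a1 := zeroEnv_a1 h1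
  have a2 := zeroEnv_a2 h2 h3
  -- On `E k` the last separating level below `n + 1` is `n - k`, and the block above it has height
  -- `k + 1`.
  set E : ℕ → Set Ω := fun k => W.zeroEnv.pathEvent fun N y => ∃ K k' : ℕ, N = K + k' ∧
    FirstAt (n - k) K y ∧ hit (k + 1) (shift K y) = k' ∧ IsBlock (k + 1) (shift K y) with hE
  have hmem : ∀ {k ω}, k < n + 1 → (ω ∈ E k ↔
      hit (n + 1) (W.zeroEnv.path ω) < death (W.zeroEnv.path ω) (W.zeroEnv.env ω) ∧
      IsSep (n + 1) (W.zeroEnv.path ω) (n - k) ∧ IsSep (n + 1) (W.zeroEnv.path ω) (n + 1) ∧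
        ∀ r, n - k < r → r < n + 1 → ¬ IsSep (n + 1) (W.zeroEnv.path ω) r) := by
    intro k ω hk
    have hn : n - k + (k + 1) = n + 1 := by omega
    have := mem_pathEvent_concat (W := W.zeroEnv) (ω := ω) (i := k + 1) (j := n - k)
      (Φ := FirstAt (n - k)) (Ψ := fun k' x => hit (k + 1) x = k' ∧ IsBlock (k + 1) x)
      (fun h => h) fun h => h.1
    rw [hn] at this
    refine this.trans (and_congr_right fun hd => ?_)
    obtain ⟨N, hN⟩ := exists_hit_eq hd.lt_top
    constructor
    · rintro ⟨K, k', hK, -, hb⟩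
      rw [isBlock_shift_iff hK, hn] at hb
      refine ⟨hb.2.1, hb.2.2.1, fun r hr hrn => ?_⟩
      have := hb.2.2.2 (r - (n - k)) (by omega) (by omega)
      rwa [Nat.add_sub_cancel' hr.le] at this
    · rintro ⟨hs, hs', hr⟩
      obtain ⟨K, hK⟩ := hs.exists_firstAt
      rw [← hn] at hN
      obtain ⟨k', rfl⟩ := exists_hit_shift hK hN
      refine ⟨K, k', hK, (hit_shift hK).1 hN, ?_⟩
      rw [isBlock_shift_iff hK, hn]
      exact ⟨Nat.succ_pos k, hs, hs', fun r hr0 hrk => hr _ (by omega) (by omega)⟩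
  have hmeas : ∀ k, MeasurableSet (E k) ∧
      P (E k) = W.probBlock P (k + 1) * W.probReach P (n - k) := by
    intro k
    have hst := isStopping_firstAt (d := d) (n - k)
    have hst' := isStopping_isBlock (d := d) (k + 1)
    refine ⟨measurableSet_pathEvent a1 a2 (hst.concat hst'), ?_⟩
    have h := measure_pathEvent_shift a1 a2 (zeroEnv_a3 h3) hst hst' (fun _ _ h => h)
      (fun k x hx h => (h.2.staysUntil hx h.1).2)
    rw [zeroEnv_zeroEnv, ← probReach_eq h1 h2 h3, mul_comm] at h
    exact h
  have hdisj : Set.PairwiseDisjoint ↑(Finset.range (n + 1)) E := by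
    intro k hk k' hk' hne
    rw [Function.onFun, Set.disjoint_left]
    intro ω h h'
    simp only [Finset.coe_range, Set.mem_Iio] at hk hk'
    rw [hmem hk] at h
    rw [hmem hk'] at h'
    rcases lt_or_gt_of_ne hne with hlt | hlt
    · exact h'.2.2.2 (n - k) (by omega) (by omega) h.2.1
    · exact h.2.2.2 (n - k') (by omega) (by omega) h'.2.1
  rw [Finset.sum_congr rfl fun k _ => (hmeas k).2.symm,
    ← measure_biUnion_finset hdisj fun k _ => (hmeas k).1]
  refine measure_congr_of_skipFree a1 a2 fun ω hω => ?_
  rw [mem_pathEvent_staysUntil]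
  simp only [Set.mem_iUnion, Finset.mem_range, exists_prop]
  constructor
  · intro hd
    have hself := hω.isSep_self hd.lt_top
    obtain ⟨N, hN⟩ := exists_hit_eq hd.lt_top
    -- Under P_0 level `0` is always separating on survival, so a last separating level below `n +
    -- 1` exists.
    have hsep0 : IsSep (n + 1) (W.zeroEnv.path ω) 0 := by
      rw [isSep_iff hN]
      refine ⟨Nat.zero_le _, 0, Nat.zero_le _, ⟨fun t ht => absurd ht (Nat.not_lt_zero t), ?_⟩,
        fun t _ ht => ?_⟩
      · rw [zeroEnv_path_zero]
        rfl
      · exact zeroEnv_path_nonneg (hN ▸ hd) t ht.le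
    set j := Nat.findGreatest (IsSep (n + 1) (W.zeroEnv.path ω)) n with hj
    have hjn : j ≤ n := Nat.findGreatest_le n
    refine ⟨n - j, by omega, (hmem (by omega)).2 ⟨hd, ?_, hself, fun r hr hrn => ?_⟩⟩
    · rw [Nat.sub_sub_self hjn]
      exact Nat.findGreatest_spec (Nat.zero_le _) hsep0
    · rw [Nat.sub_sub_self hjn] at hr
      exact Nat.findGreatest_is_greatest hr (by omega)
  · rintro ⟨k, hk, hω'⟩
    exact ((hmem hk).1 hω').1

/-- Decomposition at the first separating level. -/
theorem sum_probInit_mul_le (h1 : W.A1 P) (h2 : W.A2 P) (h3 : W.A3 P) (n : ℕ) :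
    ∑ k ∈ Finset.range (n + 1), W.probInit P k * W.probReach P (n - k) ≤
      P (W.pathEvent (FirstAt n)) := by
  -- On `E k` the lowest `n`-separating level is `k`. Disjointness alone gives the inequality; the
  -- events need not be shown to be exhaustive.
  set E : ℕ → Set Ω := fun k => W.pathEvent fun N y => ∃ K k' : ℕ, N = K + k' ∧
    (hit k y = K ∧ IsInit k y) ∧ StaysUntil (n - k) k' (shift K y) with hE
  have hmem : ∀ {k ω}, k < n + 1 → ω ∈ E k →
      hit n (W.path ω) < death (W.path ω) (W.env ω) ∧ IsSep n (W.path ω) k ∧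
        ∀ r < k, ¬ IsSep n (W.path ω) r := by
    intro k ω hk hω
    have hn : k + (n - k) = n := by omega
    have h := (mem_pathEvent_concat (W := W) (ω := ω) (i := n - k) (j := k)
      (Φ := fun K y => hit k y = K ∧ IsInit k y) (Ψ := StaysUntil (n - k))
      (fun h => h.2.firstAt h.1) fun h => h.1).1 hω
    rw [hn] at h
    obtain ⟨hd, K, k', hK, hk'⟩ := h
    have hf := hK.2.firstAt hK.1
    have hN := (hit_shift hf).2 hk'.1
    have hs := (isSep_add_iff hN).2 ⟨K, k', rfl, hf, hk'⟩
    rw [hn] at hs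
    refine ⟨hd, hs, fun r hr => ?_⟩
    rw [isSep_restrict hs hr.le]
    exact hK.2.2 r hr
  have hmeas : ∀ k, MeasurableSet (E k) ∧
      P (E k) = W.probInit P k * W.probReach P (n - k) := by
    intro k
    have hst := isStopping_isInit (d := d) k
    have hst' := isStopping_staysUntil (d := d) (n - k)
    exact ⟨measurableSet_pathEvent h1 h2 (hst.concat hst'),
      measure_pathEvent_shift h1 h2 h3 hst hst' (fun _ _ h => h.2.firstAt h.1)
        (fun k x hx h => h.2)⟩
  have hdisj : Set.PairwiseDisjoint ↑(Finset.range (n + 1)) E := by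
    intro k hk k' hk' hne
    rw [Function.onFun, Set.disjoint_left]
    intro ω h h'
    simp only [Finset.coe_range, Set.mem_Iio] at hk hk'
    have h := hmem hk h
    have h' := hmem hk' h'
    rcases lt_or_gt_of_ne hne with hlt | hlt
    · exact h'.2.2 k hlt h.2.1
    · exact h.2.2 k' hlt h'.2.1
  rw [Finset.sum_congr rfl fun k _ => (hmeas k).2.symm,
    ← measure_biUnion_finset hdisj fun k _ => (hmeas k).1]
  refine measure_mono_ae ?_
  filter_upwards [ae_skipFree h1 h2] with ω hω hω'
  obtain ⟨k, hk, hω'⟩ := Set.mem_iUnion₂.1 (show ω ∈ ⋃ k ∈ Finset.range (n + 1), E k from hω')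
  exact (mem_pathEvent_firstAt hω).2 (hmem (Finset.mem_range.1 hk) hω').1

/-- For target level `0` there is no lower level to exclude, so the positivity is the last clause of
A2. -/
theorem probInit_zero_pos (h1 : W.A1 P) (h2 : W.A2 P) : 0 < W.probInit P 0 := by
  refine lt_of_lt_of_eq h2.reach (measure_congr_of_skipFree h1 h2 fun ω hω => ?_)
  rw [mem_pathEvent_hit]
  constructor
  · intro h
    exact ⟨h, hω.isSep_self (show hit 0 (W.path ω) < _ from h).lt_top,
      fun i hi => absurd hi (Nat.not_lt_zero i)⟩
  · intro h
    exact h.1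

theorem exists_rate (h1 : W.A1 P) (h2 : W.A2 P) (h3 : W.A3 P) (h4 : W.A4 P)
    (hfin : P {ω | W.returnLevel ω < ⊤} = 1 → 0 < P {ω | W.H 0 ω < ⊤}) :
    ∃ q μ ψ₀ : ℝ, (0 < q ∧ q ≤ 1) ∧
      HasSum (fun k : ℕ => W.probKappaZero P (k + 1) / q ^ (k + 1)) 1 ∧
      (HasSum (fun k : ℕ => ((k + 1 : ℕ) : ℝ) * (W.probKappaZero P (k + 1) / q ^ (k + 1))) μ ∧
        1 ≤ μ) ∧
      (HasSum (fun k : ℕ => W.probEtaZero P k / q ^ k) ψ₀ ∧ 0 < ψ₀) := by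
  have hM := levelSojourn_ne_top h1 h2 h4 hfin
  have hfa : ∀ n, W.probReach P n ≠ ⊤ := fun n => measure_ne_top P _
  have hfu : ∀ n, W.probBlock P n ≠ ⊤ := fun n => measure_ne_top P _
  have hfe : ∀ n, W.probInit P n ≠ ⊤ := fun n => measure_ne_top P _
  refine exists_renewal_rate (a := fun n => (W.probReach P n).toReal)
    (u := W.probKappaZero P) (e := W.probEtaZero P) (M := (W.levelSojourn P).toReal)
    ?_ ?_ ?_ ?_ ?_ ?_ ?_ ?_ ?_ ?_
  · rw [probReach_zero h1 h2 h3, ENNReal.toReal_one]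
  · exact fun n => ENNReal.toReal_pos (probReach_pos h1 h2 h3 n).ne' (hfa n)
  · exact fun n => ENNReal.toReal_mono ENNReal.one_ne_top prob_le_one
  · intro m n
    rw [← ENNReal.toReal_mul]
    exact ENNReal.toReal_mono (hfa _) (probReach_mul_le h1 h2 h3 m n)
  · intro m n
    rw [← ENNReal.toReal_mul, ← ENNReal.toReal_mul]
    exact ENNReal.toReal_mono (ENNReal.mul_ne_top (ENNReal.mul_ne_top hM (hfa _)) (hfa _))
      (probReach_add_le h1 h2 h3 m n)
  · exact fun n => measureReal_nonneg
  · intro n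
    rw [probReach_succ h1 h2 h3 n,
      ENNReal.toReal_sum fun k _ => ENNReal.mul_ne_top (hfu _) (hfa _)]
    simp only [ENNReal.toReal_mul, probKappaZero_eq]
  · exact fun n => measureReal_nonneg
  · rw [probEtaZero_eq h1 h2]
    exact ENNReal.toReal_pos (probInit_zero_pos h1 h2).ne' (hfe 0)
  · intro n
    have h := ENNReal.toReal_mono (ENNReal.mul_ne_top hM (hfa _))
      ((sum_probInit_mul_le h1 h2 h3 n).trans (measure_pathEvent_firstAt_le h1 h2 h3 n))
    rw [ENNReal.toReal_sum fun k _ => ENNReal.mul_ne_top (hfe _) (hfa _)] at h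
    simpa only [ENNReal.toReal_mul, probEtaZero_eq h1 h2] using h

end ConstrainedWalk

/-! ### The joint distribution of the blocks -/

namespace SitePath

variable {d : ℕ} [NeZero d]

/-- The level `k` is reached at time `K`, at the end of an initial block with states `y`. -/
def InitBlock (k K : ℕ) (y : Fin (K + 1) → Site d) (N : ℕ) (w : ℕ → Site d) : Prop :=
  N = K ∧ (hit k w = K ∧ IsInit k w) ∧ ∀ t : Fin (K + 1), w t = y t

/-- The level `l` is reached at time `k`, at the end of a block with increments `x`. -/
def IncrBlock (l k : ℕ) (x : Fin k → Site d) (N : ℕ) (w : ℕ → Site d) : Prop :=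
  N = k ∧ (hit l w = k ∧ IsBlock l w) ∧ ∀ t : Fin k, w (t + 1) - w 0 = x t

/-- The separating levels are `L 0, …, L m`, they are reached at the times `K 0, …, K m`, and the
path consists of prescribed blocks. -/
def BlockChain (m : ℕ) (L K : ℕ → ℕ) (y : Fin (K 0 + 1) → Site d)
    (x : ∀ i, Fin (K (i + 1) - K i) → Site d) (N : ℕ) (w : ℕ → Site d) : Prop :=
  N = K m ∧ IsChain m L K w ∧ (∀ t : Fin (K 0 + 1), w t = y t) ∧
    ∀ i < m, ∀ t : Fin (K (i + 1) - K i), w (K i + t + 1) - w (K i) = x i t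

theorem isStopping_initBlock (k K : ℕ) (y : Fin (K + 1) → Site d) :
    IsStopping (InitBlock k K y) := by
  constructor
  · rintro N w w' h ⟨rfl, ⟨h1, h2⟩, h3⟩
    exact ⟨rfl, ⟨hit_congr h h1, h2.congr h1 h⟩, fun t => by
      rw [← h t (Nat.lt_succ_iff.1 t.2), h3]⟩
  · rintro N N' w ⟨rfl, -⟩ ⟨rfl, -⟩
    rfl

theorem isStopping_incrBlock (l k : ℕ) (x : Fin k → Site d) : IsStopping (IncrBlock l k x) := by
  constructor
  · rintro N w w' h ⟨rfl, ⟨h1, h2⟩, h3⟩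
    exact ⟨rfl, ⟨hit_congr h h1, h2.congr h1 h⟩, fun t => by
      rw [← h (t + 1) t.2, ← h 0 (Nat.zero_le _), h3]⟩
  · rintro N N' w ⟨rfl, -⟩ ⟨rfl, -⟩
    rfl

theorem blockChain_zero_iff {L K : ℕ → ℕ} {y : Fin (K 0 + 1) → Site d}
    {x : ∀ i, Fin (K (i + 1) - K i) → Site d} {N : ℕ} {w : ℕ → Site d} :
    BlockChain 0 L K y x N w ↔ InitBlock (L 0) (K 0) y N w := by
  simp [BlockChain, InitBlock, IsChain]

theorem blockChain_succ_iff {m : ℕ} {L K : ℕ → ℕ} {y : Fin (K 0 + 1) → Site d}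
    {x : ∀ i, Fin (K (i + 1) - K i) → Site d} (hK : K m < K (m + 1)) {N : ℕ} {w : ℕ → Site d} :
    BlockChain (m + 1) L K y x N w ↔ ∃ K' k, N = K' + k ∧ BlockChain m L K y x K' w ∧
      IncrBlock (L (m + 1) - L m) (K (m + 1) - K m) (x m) k (shift K' w) := by
  have hincr : ∀ t, shift (K m) w (t + 1) - shift (K m) w 0 = w (K m + t + 1) - w (K m) := by
    intro t
    rw [shift_zero, sub_zero, shift, add_assoc]
  constructor
  · rintro ⟨rfl, ⟨h1, h2, h3⟩, h4, h5⟩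
    refine ⟨K m, K (m + 1) - K m, by omega, ⟨rfl, ⟨h1, h2, fun i hi => h3 i (by omega)⟩, h4,
      fun i hi => h5 i (by omega)⟩, rfl, h3 m (Nat.lt_succ_self m), fun t => ?_⟩
    rw [hincr]
    exact h5 m (Nat.lt_succ_self m) t
  · rintro ⟨_, _, rfl, ⟨rfl, ⟨h1, h2, h3⟩, h4, h5⟩, rfl, h6, h7⟩
    refine ⟨by omega, ⟨h1, h2, fun i hi => ?_⟩, h4, fun i hi => ?_⟩
    · rcases Nat.lt_succ_iff_lt_or_eq.1 hi with hi | rfl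
      · exact h3 i hi
      · exact h6
    · rcases Nat.lt_succ_iff_lt_or_eq.1 hi with hi | rfl
      · exact h5 i hi
      · intro t
        rw [← hincr]
        exact h7 t

theorem isStopping_blockChain {m : ℕ} {L K : ℕ → ℕ} {y : Fin (K 0 + 1) → Site d}
    {x : ∀ i, Fin (K (i + 1) - K i) → Site d} (hLK : ∀ i < m, L i < L (i + 1) ∧ K i < K (i + 1)) :
    IsStopping (BlockChain m L K y x) := by
  induction m with
  | zero =>
    have e : BlockChain 0 L K y x = InitBlock (L 0) (K 0) y := by
      ext N w
      exact blockChain_zero_iff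
    rw [e]
    exact isStopping_initBlock _ _ _
  | succ m ih =>
    have e : BlockChain (m + 1) L K y x = fun N w => ∃ K' k, N = K' + k ∧
        BlockChain m L K y x K' w ∧
        IncrBlock (L (m + 1) - L m) (K (m + 1) - K m) (x m) k (shift K' w) := by
      ext N w
      exact blockChain_succ_iff (hLK m (Nat.lt_succ_self m)).2
    rw [e]
    exact (ih fun i hi => hLK i (by omega)).concat (isStopping_incrBlock _ _ _)

end SitePath

namespace ConstrainedWalk

variable {d : ℕ} {Ω : Type*} [NeZero d] [MeasurableSpace Ω] {W : ConstrainedWalk d Ω}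
  {P : Measure Ω} [IsProbabilityMeasure P]

/-- The last block is split off at the first visit of `L m`, where it is a separate P_0 factor; then
induction. -/
theorem measure_blockChain (h1 : W.A1 P) (h2 : W.A2 P) (h3 : W.A3 P) {m : ℕ} {L K : ℕ → ℕ}
    {y : Fin (K 0 + 1) → Site d} {x : ∀ i, Fin (K (i + 1) - K i) → Site d}
    (hLK : ∀ i < m, L i < L (i + 1) ∧ K i < K (i + 1)) :
    P (W.pathEvent (BlockChain m L K y x)) = P (W.pathEvent (InitBlock (L 0) (K 0) y)) *
      ∏ i ∈ Finset.range m,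
        P (W.zeroEnv.pathEvent (IncrBlock (L (i + 1) - L i) (K (i + 1) - K i) (x i))) := by
  induction m with
  | zero =>
    have e : BlockChain 0 L K y x = InitBlock (L 0) (K 0) y := by
      ext N w
      exact blockChain_zero_iff
    rw [e, Finset.prod_range_zero, mul_one]
  | succ m ih =>
    have e : BlockChain (m + 1) L K y x = fun N w => ∃ K' k, N = K' + k ∧
        BlockChain m L K y x K' w ∧
        IncrBlock (L (m + 1) - L m) (K (m + 1) - K m) (x m) k (shift K' w) := by
      ext N w
      exact blockChain_succ_iff (hLK m (Nat.lt_succ_self m)).2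
    have hLK' : ∀ i < m, L i < L (i + 1) ∧ K i < K (i + 1) := fun i hi => hLK i (by omega)
    rw [e, measure_pathEvent_shift h1 h2 h3 (isStopping_blockChain hLK')
      (isStopping_incrBlock _ _ _) (j := L m), ih hLK', Finset.prod_range_succ, mul_assoc]
    · rintro K' w ⟨rfl, h, -⟩
      exact h.firstAt hLK' m le_rfl
    · rintro k w hw ⟨rfl, ⟨h, h'⟩, -⟩
      exact (h'.staysUntil hw h).2

theorem mem_pathEvent_blockChain {m : ℕ} {L K : ℕ → ℕ}
    {y : Fin (K 0 + 1) → Site d} {x : ∀ i, Fin (K (i + 1) - K i) → Site d}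
    (hLK : ∀ i < m, L i < L (i + 1) ∧ K i < K (i + 1)) {ω : Ω} :
    ω ∈ W.pathEvent (BlockChain m L K y x) ↔
      etaStar (L m) (W.path ω) (W.env ω) = (m : ℤ) ∧
      (nu (L m) (W.path ω) 0 = L 0 ∧ hit (nu (L m) (W.path ω) 0) (W.path ω) = (K 0 : ℕ∞) ∧
        ∀ t : Fin (K 0 + 1), W.path ω t = y t) ∧
      ∀ i < m, blockHeight (L m) (W.path ω) i = L (i + 1) - L i ∧
        blockDuration (L m) (W.path ω) i = K (i + 1) - K i ∧
        ∀ t : Fin (K (i + 1) - K i), W.path ω (K i + t + 1) - W.path ω (K i) = x i t := by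
  have heta : etaStar (L m) (W.path ω) (W.env ω) = (m : ℤ) ↔
      hit (L m) (W.path ω) < death (W.path ω) (W.env ω) ∧ eta (L m) (W.path ω) = m := by
    rw [etaStar]
    by_cases hd : hit (L m) (W.path ω) < death (W.path ω) (W.env ω)
    · simp [hd]
    · rw [if_neg hd]
      simp only [hd, false_and, iff_false]
      omega
  rw [heta]
  constructor
  · rintro ⟨_, ⟨rfl, hc, hy, hx⟩, hd⟩
    have hK := (hc.firstAt hLK m le_rfl).hit_eq
    obtain ⟨h1, h2, h3, h4, h5⟩ := (isChain_iff hLK).2 hc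
    exact ⟨⟨hK ▸ hd, h2⟩, ⟨h3, h4, hy⟩, fun i hi => ⟨(h5 i hi).1, (h5 i hi).2, hx i hi⟩⟩
  · rintro ⟨⟨hd, h2⟩, ⟨h3, h4, hy⟩, h5⟩
    have hc := (isChain_iff hLK).1 ⟨hd.lt_top, h2, h3, h4, fun i hi => ⟨(h5 i hi).1, (h5 i hi).2.1⟩⟩
    have hK := (hc.firstAt hLK m le_rfl).hit_eq
    exact ⟨K m, ⟨rfl, hc, hy, fun i hi => (h5 i hi).2.2⟩, hK ▸ hd⟩

theorem mem_pathEvent_initBlock {k K : ℕ} {y : Fin (K + 1) → Site d} {ω : Ω} :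
    ω ∈ W.pathEvent (InitBlock k K y) ↔
      (hit k (W.path ω) < death (W.path ω) (W.env ω) ∧ IsInit k (W.path ω)) ∧
      hit k (W.path ω) = K ∧ (K : ℕ∞) < death (W.path ω) (W.env ω) ∧
        ∀ t : Fin (K + 1), W.path ω t = y t := by
  constructor
  · rintro ⟨_, ⟨rfl, ⟨h1, h2⟩, h3⟩, hd⟩
    exact ⟨⟨h1 ▸ hd, h2⟩, h1, hd, h3⟩
  · rintro ⟨⟨-, h2⟩, h1, hd, h3⟩
    exact ⟨K, ⟨rfl, ⟨h1, h2⟩, h3⟩, hd⟩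

theorem mem_pathEvent_incrBlock {l k : ℕ} {x : Fin k → Site d} {ω : Ω} :
    ω ∈ W.pathEvent (IncrBlock l k x) ↔
      (hit l (W.path ω) < death (W.path ω) (W.env ω) ∧ IsBlock l (W.path ω)) ∧
      hit l (W.path ω) = k ∧ (k : ℕ∞) < death (W.path ω) (W.env ω) ∧
        ∀ t : Fin k, W.path ω (t + 1) - W.path ω 0 = x t := by
  constructor
  · rintro ⟨_, ⟨rfl, ⟨h1, h2⟩, h3⟩, hd⟩
    exact ⟨⟨h1 ▸ hd, h2⟩, h1, hd, h3⟩
  · rintro ⟨⟨-, h2⟩, h1, hd, h3⟩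
    exact ⟨k, ⟨rfl, ⟨h1, h2⟩, h3⟩, hd⟩

theorem measurableSet_path_block (h1 : W.A1 P) (h2 : W.A2 P) {l k : ℕ}
    {Q : (ℕ → Site d) → Prop} (hQ : ∀ {w w' : ℕ → Site d}, (∀ t ≤ k, w t = w' t) → Q w → Q w') :
    MeasurableSet {ω | hit l (W.path ω) = (k : ℕ∞) ∧
      (k : ℕ∞) < death (W.path ω) (W.env ω) ∧ Q (W.path ω)} := by
  have hst : IsStopping fun N w => N = k ∧ hit l w = (k : ℕ∞) ∧ Q w := by
    constructor
    · rintro N w w' h ⟨rfl, h1, h2⟩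
      exact ⟨rfl, hit_congr h h1, hQ h h2⟩
    · rintro N N' w ⟨rfl, -⟩ ⟨rfl, -⟩
      rfl
  convert measurableSet_pathEvent h1 h2 hst using 1
  ext ω
  constructor
  · rintro ⟨h1, hd, h2⟩
    exact ⟨k, ⟨rfl, h1, h2⟩, hd⟩
  · rintro ⟨_, ⟨rfl, h1, h2⟩, hd⟩
    exact ⟨h1, hd, h2⟩

end ConstrainedWalk

/-- Multiply the conditional law by the probability of the condition. If that probability or `c` is
zero, both sides vanish, so no positivity has to be assumed. -/
theorem measureReal_inter_of_cond_eq {Ω Ω' : Type*} [MeasurableSpace Ω] [MeasurableSpace Ω']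
    {P : Measure Ω} {Q : Measure Ω'} [IsFiniteMeasure P] [IsFiniteMeasure Q] {A B : Set Ω'}
    {A' B' : Set Ω} (hA : MeasurableSet A) (hB' : MeasurableSet B') {c : ℝ}
    (h : cond Q A B = cond P A' B') (hlaw : Q.real A = P.real A' / c) :
    Q.real (A ∩ B) = P.real (A' ∩ B') / c := by
  have hQ : Q.real (A ∩ B) ≤ Q.real A := measureReal_mono Set.inter_subset_left
  have hP : P.real (A' ∩ B') ≤ P.real A' := measureReal_mono Set.inter_subset_left
  rcases eq_or_ne (P.real A') 0 with h0 | h0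
  · rw [h0, zero_div] at hlaw
    rw [le_antisymm (hQ.trans hlaw.le) measureReal_nonneg,
      le_antisymm (hP.trans h0.le) measureReal_nonneg, zero_div]
  rcases eq_or_ne c 0 with rfl | hc
  · rw [div_zero] at hlaw ⊢
    exact le_antisymm (hQ.trans hlaw.le) measureReal_nonneg
  rw [cond_apply hA, cond_apply' hB'] at h
  have h' := congrArg ENNReal.toReal h
  rw [ENNReal.toReal_mul, ENNReal.toReal_mul, ENNReal.toReal_inv, ENNReal.toReal_inv] at h'
  change (Q.real A)⁻¹ * Q.real (A ∩ B) = (P.real A')⁻¹ * P.real (A' ∩ B') at h'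
  rw [hlaw] at h'
  field_simp at h' ⊢
  exact h'

/-! ### Joint laws of the blocks of an arbitrary core process. -/

namespace CoreData.IsCore

open ConstrainedWalk

variable {d : ℕ} {Ω Ω' : Type*} [NeZero d] [MeasurableSpace Ω] [MeasurableSpace Ω']
  {W : ConstrainedWalk d Ω} {P : Measure Ω} [IsProbabilityMeasure P] {Q : Measure Ω'}
  [IsProbabilityMeasure Q] {C : CoreData d Ω'} {q ψ₀ : ℝ}

theorem measureReal_init (hC : C.IsCore Q W P q ψ₀) (h1 : W.A1 P) (h2 : W.A2 P) (k K : ℕ)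
    (y : Fin (K + 1) → Site d) :
    Q.real {ω | C.ν₀ ω = k ∧ C.T₀ ω = K ∧ ∀ t : Fin (K + 1), C.S ω t = y t} =
      P.real (W.pathEvent (InitBlock k K y)) / (ψ₀ * q ^ k) := by
  have h := measureReal_inter_of_cond_eq (hC.meas_nu (measurableSet_singleton k))
    (measurableSet_path_block h1 h2 (l := k) (k := K)
      (Q := fun w => ∀ t : Fin (K + 1), w t = y t)
      fun h hw t => by rw [← h t (Nat.lt_succ_iff.1 t.2), hw])
    (hC.law_init k K y) (hC.law_nu k)
  refine h.trans ?_
  congr 1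
  rw [Measure.real, Measure.real]
  congr 1
  refine measure_congr_of_skipFree h1 h2 fun ω hω => ?_
  rw [mem_pathEvent_initBlock, ← etaStar_eq_zero_iff hω]
  rfl

theorem measureReal_block (hC : C.IsCore Q W P q ψ₀) (h1 : W.A1 P) (h2 : W.A2 P) (h3 : W.A3 P)
    (i : ℕ) {l : ℕ} (hl : 1 ≤ l) (k : ℕ) (x : Fin k → Site d) :
    Q.real {ω | C.lam i ω = l ∧ C.tau i ω = k ∧ ∀ t : Fin k, C.incr i ω t = x t} =
      P.real (W.zeroEnv.pathEvent (IncrBlock l k x)) / q ^ l := by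
  have h := measureReal_inter_of_cond_eq (hC.meas_lam i (measurableSet_singleton l))
    (measurableSet_path_block (zeroEnv_a1 h1) (zeroEnv_a2 h2 h3) (l := l) (k := k)
      (Q := fun w => ∀ t : Fin k, w (t + 1) - w 0 = x t)
      fun h hw t => by rw [← h (t + 1) t.2, ← h 0 (Nat.zero_le _), hw])
    (hC.law_block i l k x hl) (hC.law_lam i l hl)
  refine h.trans ?_
  congr 2
  ext ω
  rw [mem_pathEvent_incrBlock, ← kappaStar_eq_zero_iff]
  rfl

/-- The product formula involves the hitting time of the initial level, the prescribed laws involve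
`T₀`. Initial blocks that no trajectory of `W` can realise have probability zero, and there are only
countably many. -/
theorem ae_hit_eq (hC : C.IsCore Q W P q ψ₀) (h1 : W.A1 P) (h2 : W.A2 P) :
    ∀ᵐ ω ∂Q, hit (C.ν₀ ω) (C.S ω) = C.T₀ ω := by
  rw [ae_iff]
  refine measure_mono_null (t := ⋃ k : ℕ, ⋃ K : ℕ, ⋃ y ∈ {y : Fin (K + 1) → Site d |
    W.pathEvent (InitBlock k K y) = ∅},
    {ω | C.ν₀ ω = k ∧ C.T₀ ω = K ∧ ∀ t : Fin (K + 1), C.S ω t = y t}) ?_ ?_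
  · intro ω hω
    simp only [Set.mem_iUnion]
    refine ⟨C.ν₀ ω, C.T₀ ω, fun t => C.S ω t, ?_, rfl, rfl, fun t => rfl⟩
    rw [Set.mem_ofPred_eq, Set.eq_empty_iff_forall_notMem]
    rintro ω' h
    obtain ⟨-, h4, -, h5⟩ := mem_pathEvent_initBlock.1 h
    exact hω (hit_congr (fun t ht => h5 ⟨t, Nat.lt_succ_of_le ht⟩) h4)
  · refine measure_iUnion_null fun k => measure_iUnion_null fun K =>
      (measure_biUnion_null_iff (Set.to_countable _)).2 fun y hy => ?_
    rw [← measureReal_eq_zero_iff, hC.measureReal_init h1 h2, hy]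
    simp

theorem measureReal_blockChain (hC : C.IsCore Q W P q ψ₀) (hq : 0 < q) (hψ : 0 < ψ₀)
    (h1 : W.A1 P) (h2 : W.A2 P) (h3 : W.A3 P) {m : ℕ} {L K : ℕ → ℕ}
    {y : Fin (K 0 + 1) → Site d} {x : ∀ i, Fin (K (i + 1) - K i) → Site d}
    (hLK : ∀ i < m, L i < L (i + 1) ∧ K i < K (i + 1)) :
    P.real (W.pathEvent (BlockChain m L K y x)) = ψ₀ * q ^ L m *
      Q.real {ω | C.ν₀ ω = L 0 ∧ hit (C.ν₀ ω) (C.S ω) = (K 0 : ℕ∞) ∧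
        ∀ t : Fin (K 0 + 1), C.S ω t = y t} *
      ∏ i ∈ Finset.range m, Q.real {ω | C.lam i ω = L (i + 1) - L i ∧
        C.tau i ω = K (i + 1) - K i ∧ ∀ t : Fin (K (i + 1) - K i), C.incr i ω t = x i t} := by
  have e0 : Q.real {ω | C.ν₀ ω = L 0 ∧ hit (C.ν₀ ω) (C.S ω) = (K 0 : ℕ∞) ∧
        ∀ t : Fin (K 0 + 1), C.S ω t = y t} =
      P.real (W.pathEvent (InitBlock (L 0) (K 0) y)) / (ψ₀ * q ^ L 0) := by
    rw [← hC.measureReal_init h1 h2]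
    refine measureReal_congr ?_
    filter_upwards [hC.ae_hit_eq h1 h2] with ω hω
    refine propext (and_congr_right fun _ => and_congr_left fun _ => ?_)
    rw [hω, Nat.cast_inj]
  -- The heights of the blocks telescope.
  have hpow : q ^ L m = q ^ L 0 * ∏ i ∈ Finset.range m, q ^ (L (i + 1) - L i) := by
    clear e0
    induction m with
    | zero => simp
    | succ m ih =>
      rw [Finset.prod_range_succ, ← mul_assoc, ← ih fun i hi => hLK i (by omega), ← pow_add]
      have := (hLK m (Nat.lt_succ_self m)).1
      congr 1
      omega
  have hprod : ∏ i ∈ Finset.range m, Q.real {ω | C.lam i ω = L (i + 1) - L i ∧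
        C.tau i ω = K (i + 1) - K i ∧ ∀ t : Fin (K (i + 1) - K i), C.incr i ω t = x i t} =
      (∏ i ∈ Finset.range m, P.real (W.zeroEnv.pathEvent
        (IncrBlock (L (i + 1) - L i) (K (i + 1) - K i) (x i)))) /
        ∏ i ∈ Finset.range m, q ^ (L (i + 1) - L i) := by
    rw [← Finset.prod_div_distrib]
    refine Finset.prod_congr rfl fun i hi => hC.measureReal_block h1 h2 h3 i ?_ _ _
    have := hLK i (Finset.mem_range.1 hi)
    omega
  have hne : ∏ i ∈ Finset.range m, q ^ (L (i + 1) - L i) ≠ 0 :=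
    Finset.prod_ne_zero_iff.2 fun i _ => (pow_pos hq _).ne'
  have hne0 := (pow_pos hq (L 0)).ne'
  rw [e0, hprod, hpow, Measure.real, measure_blockChain h1 h2 h3 hLK, ENNReal.toReal_mul,
    ENNReal.toReal_prod]
  simp only [Measure.real]
  field_simp

end CoreData.IsCore

/-! ### The construction of the core process -/

/-- A level, an initial state and a list of increments. -/
structure BlockData (d : ℕ) where
  level : ℕ
  start : Site d
  incrs : List (Site d)

namespace BlockData

variable {d : ℕ}

/-- The equivalence with a product. -/
def equivProd : BlockData d ≃ ℕ × Site d × List (Site d) where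
  toFun b := (b.level, b.start, b.incrs)
  invFun p := ⟨p.1, p.2.1, p.2.2⟩
  left_inv _ := rfl
  right_inv _ := rfl

instance : MeasurableSpace (BlockData d) := ⊤

instance : DiscreteMeasurableSpace (BlockData d) := ⟨fun _ => MeasurableSpace.measurableSet_top⟩

instance : Countable (BlockData d) := equivProd.injective.countable

instance : Inhabited (BlockData d) := ⟨⟨0, 0, []⟩⟩

/-- The finite path, constant after its end. -/
def path (b : BlockData d) : ℕ → Site d := listPath b.start b.incrs

/-- The duration of the path. -/
def length (b : BlockData d) : ℕ := b.incrs.length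

/-- The list of increments, made nonempty. -/
def steps (b : BlockData d) : List (Site d) := if b.incrs = [] then [0] else b.incrs

theorem steps_length_pos (b : BlockData d) : 0 < b.steps.length := by
  rw [steps]
  split_ifs with h
  · simp
  · exact List.length_pos_of_ne_nil h

end BlockData

namespace ConstrainedWalk

variable {d : ℕ} {Ω : Type*} [NeZero d] [MeasurableSpace Ω]

open Classical in
/-- The law of a random level and of the path up to this level: the probability of the level `n`
is proportional to `c n` and to the probability that the walk arrives at this level before death,
with a path that satisfies `B n`. -/
def blockLaw (V : ConstrainedWalk d Ω) (P : Measure Ω) (B : ℕ → (ℕ → Site d) → Prop)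
    (c : ℕ → ℝ≥0∞) : Measure (BlockData d) :=
  Measure.sum fun b : BlockData d => (if hit b.level b.path = b.length ∧ B b.level b.path then
    c b.level * V.pathWeight P b.start b.incrs else 0) • Measure.dirac b

variable {V W : ConstrainedWalk d Ω} {P : Measure Ω} {B : ℕ → (ℕ → Site d) → Prop} {c : ℕ → ℝ≥0∞}

/-- Each atom is the tilted weight of one finite trajectory, so the sum is the one in
`measure_pathEvent`. -/
theorem blockLaw_apply (h1 : V.A1 P) (h2 : V.A2 P) {Φ : ℕ → (ℕ → Site d) → Prop}
    (hΦ : IsStopping Φ) {n : ℕ} (h : ∀ {N : ℕ} {w}, Φ N w → hit n w = N ∧ B n w) :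
    V.blockLaw P B c {b | b.level = n ∧ Φ b.length b.path} = c n * P (V.pathEvent Φ) := by
  classical
  rw [blockLaw, Measure.sum_apply _ .of_discrete, measure_pathEvent h1 h2 hΦ,
    ← ENNReal.tsum_mul_left, ← BlockData.equivProd.symm.tsum_eq, ENNReal.tsum_prod',
    tsum_eq_single n]
  · refine tsum_congr fun p => ?_
    rw [Measure.smul_apply, Measure.dirac_apply' _ .of_discrete, smul_eq_mul]
    simp only [BlockData.equivProd, Equiv.coe_fn_symm_mk, Set.indicator_apply, Set.mem_ofPred_eq,
      true_and, BlockData.length, BlockData.path]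
    by_cases hp : Φ p.2.length (listPath p.1 p.2)
    · simp [hp, h hp]
    · simp [hp]
  · intro n' hn'
    refine ENNReal.tsum_eq_zero.2 fun p => ?_
    rw [Measure.smul_apply, Measure.dirac_apply' _ .of_discrete, Set.indicator_of_notMem, smul_zero]
    exact fun hmem => hn' hmem.1

/-- The law is supported by the data in which the path arrives at the level at its end. -/
theorem ae_blockLaw : ∀ᵐ b ∂(V.blockLaw P B c), hit b.level b.path = b.length ∧ B b.level b.path := by
  rw [ae_iff, blockLaw, Measure.sum_apply _ .of_discrete, ENNReal.tsum_eq_zero]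
  intro b
  split_ifs with h
  · rw [Measure.smul_apply, Measure.dirac_apply' _ .of_discrete, Set.indicator_of_notMem, smul_zero]
    exact fun hmem => hmem h
  · rw [zero_smul, Measure.coe_zero, Pi.zero_apply]

theorem blockLaw_level (h1 : V.A1 P) (h2 : V.A2 P)
    (hB : ∀ {n K : ℕ} {y y' : ℕ → Site d}, hit n y = K → (∀ t ≤ K, y t = y' t) → B n y → B n y')
    (n : ℕ) : V.blockLaw P B c {b | b.level = n} =
      c n * P (V.pathEvent fun K y => hit n y = K ∧ B n y) := by
  rw [← blockLaw_apply (B := B) h1 h2 (isStopping_hit n hB) fun h => h]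
  refine measure_congr ?_
  filter_upwards [ae_blockLaw] with b hb
  refine propext ⟨fun h => ?_, fun h => h.1⟩
  obtain rfl : b.level = n := h
  exact ⟨rfl, hb⟩

theorem blockLaw_univ (h1 : V.A1 P) (h2 : V.A2 P)
    (hB : ∀ {n K : ℕ} {y y' : ℕ → Site d}, hit n y = K → (∀ t ≤ K, y t = y' t) → B n y → B n y') :
    V.blockLaw P B c Set.univ =
      ∑' n, c n * P (V.pathEvent fun K y => hit n y = K ∧ B n y) := by
  have e : (Set.univ : Set (BlockData d)) = ⋃ n : ℕ, {b | b.level = n} := by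
    ext b
    simp
  rw [e, measure_iUnion _ fun n => .of_discrete]
  · exact tsum_congr fun n => blockLaw_level h1 h2 hB n
  · intro n n' hne
    rw [Function.onFun, Set.disjoint_left]
    rintro b rfl h
    exact hne h

variable [IsProbabilityMeasure P] {q ψ₀ : ℝ}

/-- The law of the initial block of a core process. -/
def initLaw (W : ConstrainedWalk d Ω) (P : Measure Ω) (q ψ₀ : ℝ) : Measure (BlockData d) :=
  W.blockLaw P IsInit fun n => ENNReal.ofReal (1 / (ψ₀ * q ^ n))

/-- The law of the other blocks of a core process. -/
def incrLaw (W : ConstrainedWalk d Ω) (P : Measure Ω) (q : ℝ) : Measure (BlockData d) :=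
  W.zeroEnv.blockLaw P IsBlock fun n => ENNReal.ofReal (1 / q ^ n)

theorem isProbabilityMeasure_initLaw (h1 : W.A1 P) (h2 : W.A2 P) (hq : 0 < q) (hψ : 0 < ψ₀)
    (hsum : HasSum (fun k : ℕ => W.probEtaZero P k / q ^ k) ψ₀) :
    IsProbabilityMeasure (W.initLaw P q ψ₀) := by
  constructor
  rw [initLaw, blockLaw_univ h1 h2 fun hK h hy => hy.congr hK h]
  have hterm : ∀ n, ENNReal.ofReal (1 / (ψ₀ * q ^ n)) *
      P (W.pathEvent fun K y => hit n y = K ∧ IsInit n y) =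
      ENNReal.ofReal (W.probEtaZero P n / q ^ n / ψ₀) := by
    intro n
    rw [probEtaZero_eq h1 h2, ← probInit, ← ENNReal.ofReal_toReal (a := W.probInit P n)
      (measure_ne_top _ _), ← ENNReal.ofReal_mul (by positivity),
      ENNReal.toReal_ofReal ENNReal.toReal_nonneg]
    congr 1
    field_simp
  have hs := hsum.div_const ψ₀
  rw [div_self hψ.ne'] at hs
  rw [tsum_congr hterm, ← ENNReal.ofReal_tsum_of_nonneg (fun n => ?_) hs.summable, hs.tsum_eq,
    ENNReal.ofReal_one]
  have := measureReal_nonneg (μ := P) (s := {ω | etaStar n (W.path ω) (W.env ω) = 0})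
  exact div_nonneg (div_nonneg this (pow_pos hq n).le) hψ.le

theorem isProbabilityMeasure_incrLaw (h1 : W.A1 P) (h2 : W.A2 P) (h3 : W.A3 P) (hq : 0 < q)
    (hsum : HasSum (fun k : ℕ => W.probKappaZero P (k + 1) / q ^ (k + 1)) 1) :
    IsProbabilityMeasure (W.incrLaw P q) := by
  constructor
  rw [incrLaw, blockLaw_univ (zeroEnv_a1 h1) (zeroEnv_a2 h2 h3) fun hK h hy => hy.congr hK h]
  have hterm : ∀ n, ENNReal.ofReal (1 / q ^ n) *
      P (W.zeroEnv.pathEvent fun K y => hit n y = K ∧ IsBlock n y) =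
      ENNReal.ofReal (W.probKappaZero P n / q ^ n) := by
    intro n
    rw [probKappaZero_eq, ← probBlock, ← ENNReal.ofReal_toReal (a := W.probBlock P n)
      (measure_ne_top _ _), ← ENNReal.ofReal_mul (by positivity),
      ENNReal.toReal_ofReal ENNReal.toReal_nonneg]
    congr 1
    field_simp
  -- Blocks have positive height, so the series may start at one.
  have h0 : W.probKappaZero P 0 = 0 := by
    rw [probKappaZero_eq, probBlock]
    have : (W.zeroEnv.pathEvent fun K y => hit 0 y = K ∧ IsBlock 0 y) = ∅ := by
      rw [Set.eq_empty_iff_forall_notMem]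
      rintro ω ⟨K, ⟨-, h⟩, -⟩
      exact lt_irrefl 0 h.1
    rw [this, measure_empty, ENNReal.toReal_zero]
  rw [tsum_congr hterm, tsum_eq_zero_add' ENNReal.summable, h0, zero_div, ENNReal.ofReal_zero,
    zero_add, ← ENNReal.ofReal_tsum_of_nonneg (fun n => ?_) hsum.summable, hsum.tsum_eq,
    ENNReal.ofReal_one]
  exact div_nonneg measureReal_nonneg (pow_pos hq _).le

end ConstrainedWalk

/-! ### Gluing blocks into one path. -/

namespace CoreData

variable {d : ℕ}

/-- The list of the increments of the process up to the end of the block number `m`. -/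
def joinedSteps (ω : ℕ → BlockData d) : ℕ → List (Site d)
  | 0 => (ω 0).incrs
  | m + 1 => joinedSteps ω m ++ (ω (m + 1)).steps

/-- The process that is made up from a sequence of blocks. -/
def ofBlocks (d : ℕ) : CoreData d (ℕ → BlockData d) where
  ν₀ ω := (ω 0).level
  T₀ ω := (ω 0).length
  lam i ω := (ω (i + 1)).level
  tau i ω := (ω (i + 1)).steps.length
  S ω t := listPath (ω 0).start (joinedSteps ω t) t

variable {ω ω' : ℕ → BlockData d}

theorem length_joinedSteps (m : ℕ) : (joinedSteps ω m).length = (ofBlocks d).T m ω := by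
  induction m with
  | zero => simp [joinedSteps, T, ofBlocks, BlockData.length]
  | succ m ih =>
    rw [joinedSteps, List.length_append, ih, T, T, Finset.sum_range_succ, add_assoc]
    rfl

/-- Every later block contributes a step, because `steps` pads empty lists. Hence the blocks with
indices up to `t` always determine the state at time `t`. -/
theorem le_length_joinedSteps (m : ℕ) : m ≤ (joinedSteps ω m).length := by
  induction m with
  | zero => exact Nat.zero_le _
  | succ m ih =>
    have := (ω (m + 1)).steps_length_pos
    rw [joinedSteps, List.length_append]
    omega

theorem joinedSteps_prefix {m m' : ℕ} (h : m ≤ m') : joinedSteps ω m <+: joinedSteps ω m' := by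
  induction m', h using Nat.le_induction with
  | base => exact List.prefix_rfl
  | succ m' _ ih => exact ih.trans (List.prefix_append _ _)

theorem joinedSteps_congr {m : ℕ} (h : ∀ i ≤ m, ω i = ω' i) :
    joinedSteps ω m = joinedSteps ω' m := by
  induction m with
  | zero => rw [joinedSteps, joinedSteps, h 0 le_rfl]
  | succ m ih => rw [joinedSteps, joinedSteps, ih fun i hi => h i (by omega), h _ le_rfl]

theorem ofBlocks_S {m t : ℕ} (h : t ≤ (joinedSteps ω m).length) :
    (ofBlocks d).S ω t = listPath (ω 0).start (joinedSteps ω m) t := by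
  change listPath (ω 0).start (joinedSteps ω t) t = _
  rcases le_total m t with hmt | hmt
  · obtain ⟨l, hl⟩ := joinedSteps_prefix (ω := ω) hmt
    rw [← hl, listPath_append_left _ _ _ h]
  · obtain ⟨l, hl⟩ := joinedSteps_prefix (ω := ω) hmt
    rw [← hl, listPath_append_left _ _ _ (le_length_joinedSteps t)]

theorem ofBlocks_S_init {t : ℕ} (h : t ≤ (ofBlocks d).T₀ ω) :
    (ofBlocks d).S ω t = (ω 0).path t :=
  ofBlocks_S (m := 0) h

theorem ofBlocks_incr {i t : ℕ} (h : t < (ofBlocks d).tau i ω) :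
    (ofBlocks d).incr i ω t = listPath 0 (ω (i + 1)).steps (t + 1) := by
  have ht : t + 1 ≤ (ω (i + 1)).steps.length := h
  rw [incr, ← length_joinedSteps, ofBlocks_S (m := i + 1), ofBlocks_S (m := i + 1), joinedSteps,
    ← shift_listPath_append (ω 0).start (joinedSteps ω i), shift, add_assoc]
  · rw [joinedSteps, List.length_append]
    omega
  · rw [joinedSteps, List.length_append]
    omega

theorem measurable_ofBlocks_S (t : ℕ) : Measurable fun ω => (ofBlocks d).S ω t := by
  classical
  let g : (Fin (t + 1) → BlockData d) → Site d := fun r =>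
    (ofBlocks d).S (fun i => if h : i < t + 1 then r ⟨i, h⟩ else default) t
  have e : (fun ω => (ofBlocks d).S ω t) = g ∘ fun ω i => ω i := by
    ext1 ω
    change listPath _ _ _ = listPath _ _ _
    rw [joinedSteps_congr (ω := ω) (ω' := fun i => if h : i < t + 1 then ω i else default)
      fun i hi => by rw [dif_pos (Nat.lt_succ_of_le hi)]]
    simp
  rw [e]
  exact (measurable_of_countable g).comp (by fun_prop)

/-- The `i`-th block as a function of the `i`-th coordinate. -/
def blockOf (d : ℕ) : ℕ → BlockData d → ℕ × ℕ × List (Site d)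
  | 0, b => (b.level, b.length, List.ofFn fun t : Fin (b.length + 1) => b.path t)
  | _ + 1, b => (b.level, b.steps.length,
      List.ofFn fun t : Fin b.steps.length => listPath 0 b.steps (t + 1))

/-- Each block is a function of one coordinate, so independence of the blocks is that of a product
measure. -/
theorem ofBlocks_block (i : ℕ) : (ofBlocks d).block i ω = blockOf d i (ω i) := by
  cases i with
  | zero =>
    simp only [block, blockOf]
    congr 3
    ext1 t
    exact ofBlocks_S_init (Nat.lt_succ_iff.1 t.2)
  | succ i =>
    simp only [block, blockOf]
    congr 3
    ext1 t
    exact ofBlocks_incr t.2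

end CoreData

/-- The tilting factor is constant on the conditioning event and cancels. -/
theorem cond_eq_of_measure_eq_mul {Ω Ω' : Type*} [MeasurableSpace Ω] [MeasurableSpace Ω']
    {P : Measure Ω} {Q : Measure Ω'} {A B : Set Ω'} {A' B' : Set Ω} {c : ℝ≥0∞}
    (hA : MeasurableSet A) (hB' : MeasurableSet B') (hc0 : c ≠ 0) (hc : c ≠ ⊤)
    (h : Q A = c * P A') (h' : Q (A ∩ B) = c * P (A' ∩ B')) : cond Q A B = cond P A' B' := by
  rw [cond_apply hA, cond_apply' hB', h, h', ENNReal.mul_inv (Or.inl hc0) (Or.inl hc),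
    mul_mul_mul_comm, ENNReal.inv_mul_cancel hc0 hc, one_mul]

/-! ### The product of the block laws gives a core process. -/

namespace CoreData

open ConstrainedWalk

variable {Ω : Type*} [NeZero d] [MeasurableSpace Ω] {W : ConstrainedWalk d Ω}
  {P : Measure Ω} [IsProbabilityMeasure P] {q ψ₀ : ℝ}

/-- The laws of the blocks of a core process. -/
def blockLaws (W : ConstrainedWalk d Ω) (P : Measure Ω) (q ψ₀ : ℝ) : ℕ → Measure (BlockData d)
  | 0 => W.initLaw P q ψ₀
  | _ + 1 => W.incrLaw P q

theorem initLaw_level (h1 : W.A1 P) (h2 : W.A2 P) (k : ℕ) :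
    W.initLaw P q ψ₀ {b | b.level = k} = ENNReal.ofReal (1 / (ψ₀ * q ^ k)) *
      P {ω | etaStar k (W.path ω) (W.env ω) = 0} := by
  rw [initLaw, blockLaw_level h1 h2 fun hK h hy => hy.congr hK h]
  congr 1
  refine (measure_congr_of_skipFree h1 h2 fun ω hω => ?_).symm
  rw [mem_pathEvent_hit]
  exact etaStar_eq_zero_iff hω

theorem incrLaw_level (h1 : W.A1 P) (h2 : W.A2 P) (h3 : W.A3 P) (l : ℕ) :
    W.incrLaw P q {b | b.level = l} = ENNReal.ofReal (1 / q ^ l) *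
      P {ω | kappaStar l (W.zeroEnv.path ω) (W.zeroEnv.env ω) = ((0 : ℕ) : WithBot ℕ)} := by
  rw [incrLaw, blockLaw_level (zeroEnv_a1 h1) (zeroEnv_a2 h2 h3) fun hK h hy => hy.congr hK h]
  congr 2
  ext ω
  rw [mem_pathEvent_hit]
  exact kappaStar_eq_zero_iff.symm

theorem initLaw_block (h1 : W.A1 P) (h2 : W.A2 P) (k K : ℕ) (y : Fin (K + 1) → Site d) :
    W.initLaw P q ψ₀ {b | b.level = k ∧ b.length = K ∧ ∀ t : Fin (K + 1), b.path t = y t} =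
      ENNReal.ofReal (1 / (ψ₀ * q ^ k)) * P (W.pathEvent (InitBlock k K y)) := by
  have h := blockLaw_apply (B := IsInit) (c := fun n => ENNReal.ofReal (1 / (ψ₀ * q ^ n))) h1 h2
    (isStopping_initBlock k K y) (n := k) (by rintro N w ⟨rfl, h, -⟩; exact h)
  rw [← h]
  refine measure_congr ?_
  filter_upwards [ae_blockLaw] with b hb
  refine propext ⟨?_, ?_⟩
  · rintro ⟨rfl, h5, h6⟩
    rw [h5] at hb
    exact ⟨rfl, h5, hb, h6⟩
  · rintro ⟨rfl, h5, -, h6⟩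
    exact ⟨rfl, h5, h6⟩

theorem incrLaw_block (h1 : W.A1 P) (h2 : W.A2 P) (h3 : W.A3 P) (l k : ℕ) (x : Fin k → Site d) :
    W.incrLaw P q {b | b.level = l ∧ b.steps.length = k ∧
        ∀ t : Fin k, listPath 0 b.steps (t + 1) = x t} =
      ENNReal.ofReal (1 / q ^ l) * P (W.zeroEnv.pathEvent (IncrBlock l k x)) := by
  have h := blockLaw_apply (B := IsBlock) (c := fun n => ENNReal.ofReal (1 / q ^ n))
    (zeroEnv_a1 h1) (zeroEnv_a2 h2 h3) (isStopping_incrBlock l k x) (n := l)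
    (by rintro N w ⟨rfl, h, -⟩; exact h)
  rw [← h]
  refine measure_congr ?_
  filter_upwards [ae_blockLaw] with b hb
  -- A block of positive height needs at least one step, so the padding in `steps` is almost surely
  -- inactive.
  have hne : b.incrs ≠ [] := by
    intro h0
    have hlen : b.length = 0 := by rw [BlockData.length, h0, List.length_nil]
    rw [hlen] at hb
    obtain ⟨-, T, hT, hT', -⟩ := (isSep_iff hb.1).1 hb.2.2.1
    obtain rfl : T = 0 := Nat.le_zero.1 hT
    have h7 := (hit_eq_coe.1 hb.1).1
    rw [hT'.2] at h7
    have := hb.2.1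
    omega
  have hst : b.steps = b.incrs := if_neg hne
  have hpath : ∀ t, b.path (t + 1) - b.path 0 = listPath 0 b.incrs (t + 1) := by
    intro t
    rw [BlockData.path, listPath_zero, listPath, listPath, zero_add, add_sub_cancel_left]
  refine propext ⟨?_, ?_⟩
  · rintro ⟨rfl, h5, h6⟩
    rw [hst] at h5 h6
    refine ⟨rfl, h5, ?_, fun t => by rw [hpath]; exact h6 t⟩
    rw [← h5]
    exact hb
  · rintro ⟨rfl, h5, -, h6⟩
    refine ⟨rfl, by rw [hst]; exact h5, fun t => ?_⟩
    rw [hst, ← hpath]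
    exact h6 t

theorem isCore_ofBlocks (h1 : W.A1 P) (h2 : W.A2 P) (h3 : W.A3 P) (hq : 0 < q) (hψ : 0 < ψ₀)
    [∀ i, IsProbabilityMeasure (blockLaws W P q ψ₀ i)] :
    (ofBlocks d).IsCore (Measure.infinitePi (blockLaws W P q ψ₀)) W P q ψ₀ := by
  have hev : ∀ (i : ℕ) (s : Set (BlockData d)), Measure.infinitePi (blockLaws W P q ψ₀)
      {ω | ω i ∈ s} = blockLaws W P q ψ₀ i s := fun i s =>
    (measurePreserving_eval_infinitePi (blockLaws W P q ψ₀) i).measure_preimage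
      (MeasurableSet.of_discrete.nullMeasurableSet)
  have hcoord : ∀ {β : Type} [MeasurableSpace β] (f : BlockData d → β) (i : ℕ),
      Measurable fun ω : ℕ → BlockData d => f (ω i) := fun f i =>
    (Measurable.of_discrete (f := f)).comp (measurable_pi_apply i)
  have hnu : ∀ k : ℕ, Measure.infinitePi (blockLaws W P q ψ₀) {ω | (ω 0).level = k} =
      ENNReal.ofReal (1 / (ψ₀ * q ^ k)) *
        P {ω | etaStar k (W.path ω) (W.env ω) = 0} := by
    intro k
    exact (hev 0 {b | b.level = k}).trans (initLaw_level h1 h2 k)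
  have hlam : ∀ i l : ℕ, Measure.infinitePi (blockLaws W P q ψ₀) {ω | (ω (i + 1)).level = l} =
      ENNReal.ofReal (1 / q ^ l) * P {ω | kappaStar l (W.zeroEnv.path ω) (W.zeroEnv.env ω) =
        ((0 : ℕ) : WithBot ℕ)} := by
    intro i l
    exact (hev (i + 1) {b | b.level = l}).trans (incrLaw_level h1 h2 h3 l)
  have hc : ∀ k : ℕ, 0 < 1 / (ψ₀ * q ^ k) := fun k => by positivity
  have hc' : ∀ k : ℕ, 0 < 1 / q ^ k := fun k => by positivity
  refine
    { meas_nu := hcoord BlockData.level 0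
      meas_T := hcoord BlockData.length 0
      meas_lam := fun i => hcoord BlockData.level (i + 1)
      meas_tau := fun i => hcoord (fun b => b.steps.length) (i + 1)
      meas_S := measurable_ofBlocks_S
      indep := ?_
      law_nu := fun k => ?_
      law_init := fun k K y => ?_
      law_lam := fun i l hl => ?_
      law_block := fun i l k x hl => ?_ }
  · have e : (ofBlocks d).block = fun i ω => blockOf d i (ω i) := by
      ext1 i
      ext1 ω
      exact ofBlocks_block i
    rw [e]
    refine iIndepFun_infinitePi fun i => ?_
    exact fun s _ => .of_discrete
  · change Measure.real _ {ω : ℕ → BlockData d | (ω 0).level = k} = _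
    rw [Measure.real, hnu, ENNReal.toReal_mul, ENNReal.toReal_ofReal (hc k).le, probEtaZero,
      Measure.real, one_div_mul_eq_div]
  · refine cond_eq_of_measure_eq_mul (hcoord BlockData.level 0 (measurableSet_singleton k))
      (measurableSet_path_block h1 h2 (l := k) (k := K)
        (Q := fun w => ∀ t : Fin (K + 1), w t = y t)
        fun h hw t => by rw [← h t (Nat.lt_succ_iff.1 t.2), hw])
      (ENNReal.ofReal_pos.2 (hc k)).ne' ENNReal.ofReal_ne_top (hnu k) ?_
    have e : {ω : ℕ → BlockData d | (ofBlocks d).ν₀ ω = k} ∩ {ω | (ofBlocks d).T₀ ω = K ∧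
        ∀ t : Fin (K + 1), (ofBlocks d).S ω t = y t} = {ω | ω 0 ∈ {b : BlockData d |
          b.level = k ∧ b.length = K ∧ ∀ t : Fin (K + 1), b.path t = y t}} := by
      ext ω
      refine and_congr_right fun _ => and_congr_right fun hK => forall_congr' fun t => ?_
      rw [ofBlocks_S_init]
      have : (ofBlocks d).T₀ ω = K := hK
      rw [this]
      exact Nat.lt_succ_iff.1 t.2
    rw [e, hev]
    refine (initLaw_block h1 h2 k K y).trans ?_
    congr 1
    refine measure_congr_of_skipFree h1 h2 fun ω hω => ?_
    rw [mem_pathEvent_initBlock, ← etaStar_eq_zero_iff hω]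
    rfl
  · change Measure.real _ {ω : ℕ → BlockData d | (ω (i + 1)).level = l} = _
    rw [Measure.real, hlam, ENNReal.toReal_mul, ENNReal.toReal_ofReal (hc' l).le, probKappaZero,
      Measure.real, one_div_mul_eq_div]
  · refine cond_eq_of_measure_eq_mul (hcoord BlockData.level (i + 1) (measurableSet_singleton l))
      (measurableSet_path_block (zeroEnv_a1 h1) (zeroEnv_a2 h2 h3) (l := l) (k := k)
        (Q := fun w => ∀ t : Fin k, w (t + 1) - w 0 = x t)
        fun h hw t => by rw [← h (t + 1) t.2, ← h 0 (Nat.zero_le _), hw])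
      (ENNReal.ofReal_pos.2 (hc' l)).ne' ENNReal.ofReal_ne_top (hlam i l) ?_
    have e : {ω : ℕ → BlockData d | (ofBlocks d).lam i ω = l} ∩ {ω | (ofBlocks d).tau i ω = k ∧
        ∀ t : Fin k, (ofBlocks d).incr i ω t = x t} = {ω | ω (i + 1) ∈ {b : BlockData d |
          b.level = l ∧ b.steps.length = k ∧
            ∀ t : Fin k, listPath 0 b.steps (t + 1) = x t}} := by
      ext ω
      refine and_congr_right fun _ => and_congr_right fun hK => forall_congr' fun t => ?_
      rw [ofBlocks_incr]
      have : (ofBlocks d).tau i ω = k := hK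
      rw [this]
      exact t.2
    rw [e, hev]
    refine (incrLaw_block h1 h2 h3 l k x).trans ?_
    congr 2
    ext ω
    rw [mem_pathEvent_incrBlock, ← kappaStar_eq_zero_iff]
    rfl

end CoreData

end

/-! ### The theorem. -/

theorem corollary2 {d : ℕ} [NeZero d] {Ω : Type*} [MeasurableSpace Ω]
    (P : Measure Ω) [IsProbabilityMeasure P] (W : ConstrainedWalk d Ω)
    (h1 : W.A1 P) (h2 : W.A2 P) (h3 : W.A3 P) (h4 : W.A4 P)
    (hfin : P {ω | W.returnLevel ω < ⊤} = 1 → 0 < P {ω | W.H 0 ω < ⊤}) :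
    ∃ q μ ψ₀ : ℝ,
      (0 < q ∧ q ≤ 1) ∧
      HasSum (fun k : ℕ => W.probKappaZero P (k + 1) / q ^ (k + 1)) 1 ∧
      (HasSum (fun k : ℕ => ((k + 1 : ℕ) : ℝ) * (W.probKappaZero P (k + 1) / q ^ (k + 1))) μ ∧
        1 ≤ μ) ∧
      (HasSum (fun k : ℕ => W.probEtaZero P k / q ^ k) ψ₀ ∧ 0 < ψ₀) ∧
      (∃ (Ω' : Type) (_ : MeasurableSpace Ω') (Q : Measure Ω') (C : CoreData d Ω'),
        IsProbabilityMeasure Q ∧ C.IsCore Q W P q ψ₀) ∧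
      ∀ (Ω' : Type*) [MeasurableSpace Ω'] (Q : Measure Ω') [IsProbabilityMeasure Q]
        (C : CoreData d Ω'), C.IsCore Q W P q ψ₀ →
        ∀ (n m : ℕ) (L K : ℕ → ℕ) (y : Fin (K 0 + 1) → Site d)
          (x : ∀ i : ℕ, Fin (K (i + 1) - K i) → Site d),
          1 ≤ m → L m = n →
          (∀ i < m, L i < L (i + 1) ∧ K i < K (i + 1) ∧
            L (i + 1) - L i ≤ K (i + 1) - K i) →
          P.real {ω | SitePath.etaStar n (W.path ω) (W.env ω) = (m : ℤ) ∧
              (SitePath.nu n (W.path ω) 0 = L 0 ∧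
                SitePath.hit (SitePath.nu n (W.path ω) 0) (W.path ω) = (K 0 : ℕ∞) ∧
                ∀ t : Fin (K 0 + 1), W.path ω t = y t) ∧
              ∀ i < m,
                SitePath.blockHeight n (W.path ω) i = L (i + 1) - L i ∧
                SitePath.blockDuration n (W.path ω) i = K (i + 1) - K i ∧
                ∀ t : Fin (K (i + 1) - K i),
                  W.path ω (K i + t + 1) - W.path ω (K i) = x i t} =
            ψ₀ * q ^ n *
              Q.real {ω | C.ν₀ ω = L 0 ∧ SitePath.hit (C.ν₀ ω) (C.S ω) = (K 0 : ℕ∞) ∧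
                ∀ t : Fin (K 0 + 1), C.S ω t = y t} *
              ∏ i ∈ Finset.range m,
                Q.real {ω | C.lam i ω = L (i + 1) - L i ∧
                  C.tau i ω = K (i + 1) - K i ∧
                  ∀ t : Fin (K (i + 1) - K i), C.incr i ω t = x i t} := by
  obtain ⟨q, μ, ψ₀, hq, hlam, hmean, hψ⟩ := ConstrainedWalk.exists_rate h1 h2 h3 h4 hfin
  refine ⟨q, μ, ψ₀, hq, hlam, hmean, hψ, ?_, ?_⟩
  · have : ∀ i, IsProbabilityMeasure (CoreData.blockLaws W P q ψ₀ i) := by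
      rintro (_ | i)
      · exact ConstrainedWalk.isProbabilityMeasure_initLaw h1 h2 hq.1 hψ.2 hψ.1
      · exact ConstrainedWalk.isProbabilityMeasure_incrLaw h1 h2 h3 hq.1 hlam
    exact ⟨ℕ → BlockData d, inferInstance, Measure.infinitePi (CoreData.blockLaws W P q ψ₀),
      CoreData.ofBlocks d, inferInstance, CoreData.isCore_ofBlocks h1 h2 h3 hq.1 hψ.2⟩
  · intro Ω' _ Q _ C hC n m L K y x hm hn hLK
    subst hn
    have hLK' : ∀ i < m, L i < L (i + 1) ∧ K i < K (i + 1) := fun i hi =>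
      ⟨(hLK i hi).1, (hLK i hi).2.1⟩
    rw [← hC.measureReal_blockChain hq.1 hψ.2 h1 h2 h3 hLK']
    congr 1
    ext ω
    exact (ConstrainedWalk.mem_pathEvent_blockChain hLK').symm
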